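/- Let $V$ be a countable set, $0\in V$, $\lambda\ge 0$, and let $p(x,y)=p(y,x)\ge 0$ $(x,y\in V)$ be irreducible rates with $\sup_x\sum_y p(x,y)<\infty$. Let $X$ be the continuous-time random walk on $V$ with generator $L_{RW}f(x)=\sum_y p(x,y)(f(y)-f(x))$, with law $P_x$ and expectation $E_x$ when $X_0=x$. Consider independent particles, each moving as $X$, together with a source that creates new particles at $0$ at rate $\lambda$; the occupation numbers $\eta\in\mathbb N^V$ form a process with formal generator $$L f(\eta)=\tfrac12\sum_{x,y\in V}p(x,y)\big(\eta_x(f(\eta^{x,y})-f(\eta))+\eta_y(f(\eta^{y,x})-f(\eta))\big)+\lambda\,(f(\eta+e_0)-f(\eta)),$$ where $\eta^{x,y}$ is $\eta$ with one particle moved from $x$ to $y$; precisely, for every $\eta$ with finitely many particles and every bounded local $f$, $\frac{d}{dt}\mathbb E_\eta f(\eta(t))\big|_{t=0^+}=Lf(\eta)$. For $z\in\mathbb R^V$ and $f$ depending only on the coordinates in a finite set $\Lambda$ put $$\mathcal Gf(z)=\sum_{k\in\mathbb N^\Lambda}f(k)\prod_{i\in\Lambda}\frac{z_i^{k_i}}{k_i!}e^{-z_i},\qquad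 \mathcal L F(z)=-\tfrac12\sum_{x,y\in V}p(x,y)(z_x-z_y)(\partial_x-\partial_y)F(z)+\lambda\,\partial_0F(z),$$ so that $\mathcal L$ is the first-order operator of the system $\frac{dz_x}{dt}=\sum_y p(x,y)(z_y-z_x)+\lambda\delta_{x,0}$. For a non-local $g$, $\mathcal Gg(z)$ denotes the limit, as finite sets $\Lambda'\uparrow V$, of the (absolutely convergent) series over $k\in\mathbb N^{\Lambda'}$ with $g$ evaluated at $k$ extended by $0$. Write $\nu_\rho$ for the product of the Poisson measures with parameters $\rho(x)$, $x\in V$, and $\nu_\rho(t)$ for the law of the process at time $t$ started from $\nu_\rho$. 1. (Intertwining.) Let $f$ depend only on the coordinates in the finite set $\Lambda$, and let $z\in\mathbb R^V$ be such that $\sum_yp(x,y)|z_y|<\infty$ for $x\in\Lambda$ and the series $\mathcal Gf$ converges absolutely in a neighbourhood of $z$. Then the partial derivatives of $\mathcal Gf$ at $z$ exist, the sum in $\mathcal L\mathcal Gf(z)$ converges, $\mathcal GLf(z)$ exists, and $\mathcal G Lf(z)=\mathcal L\,\mathcal Gf(z)$. 2. (Evolution.) Let $\rho:V\to[0,\infty)$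 satisfy $E_x\rho(X_t)<\infty$ for all $x\in V$, $t\ge0$. Then, started from $\nu_\rho$, at each time almost surely every site carries finitely many particles, and for all $t\ge 0$ $$\nu_\rho(t)=\nu_{\rho_t},\qquad \rho_t(x)=E_x\rho(X_t)+\lambda\int_0^tP_x(X_s=0)\,ds.$$ The density solves $\frac{d}{dt}\rho_t(x)=L_{RW}\rho_t(x)+\lambda\delta_{x,0}$, $\rho_0=\rho$ (and, if $\rho$ is bounded, it is the only solution that is bounded on $[0,T]\times V$ for every $T$); and for every bounded local $f$ and $t\ge0$, $Lf$ is $\nu_\rho(t)$-integrable and $\frac{d}{dt}\int f\,d\nu_\rho(t)=\int Lf\,d\nu_\rho(t)$. 3. (Divergence.) Let $\lambda>0$. If the walk is recurrent, then $\rho_t(x)\to\infty$ as $t\to\infty$ for every $x$ and every $\rho$ as in 2. If $\rho$ is bounded, then for each $x$, $\rho_t(x)\to\infty$ as $t\to\infty$ if and only if the walk is recurrent. 4. (Transient case.) If the walk is transient and $\rho\equiv r\ge 0$ is constant, then $\int_0^\infty P_x(X_s=0)\,ds<\infty$ for all $x$, and $\nu_r(t)$ converges weakly, as $t\to\infty$,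 to $\nu_{\rho_\infty}$ with $$\rho_\infty(x)=r+\lambda\int_0^\infty P_x(X_s=0)\,ds,\qquad L_{RW}\rho_\infty(x)=-\lambda\delta_{x,0}\quad\text{for all }x\in V.$$ -/

import Mathlib

open MeasureTheory ProbabilityTheory Filter Topology

/-! ### Rates and the single random walk -/

/-- The `n`-step rates of `p`, with the identity for `n = 0`. -/
noncomputable def nStepRate {V : Type*} (p : V → V → ℝ) : ℕ → V → V → ℝ
  | 0 => fun x y => Set.indicator {x} (fun _ => (1 : ℝ)) y
  | n + 1 => fun x y => ∑' z, p x z * nStepRate p n z y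

/-- Symmetric irreducible random walk transition rates on `V` with bounded total rates. The rates
are not assumed to sum to one, and `p x x` need not vanish. -/
structure SymmRates (V : Type*) where
  p : V → V → ℝ
  nonneg : ∀ x y, 0 ≤ p x y
  symm : ∀ x y, p x y = p y x
  irreducible : ∀ x y, ∃ n, 0 < nStepRate p n x y
  bounded : ∃ C : ℝ, ∀ x, Summable (p x) ∧ ∑' y, p x y ≤ C

/-- The Kronecker delta. -/
noncomputable def kron {V : Type*} (x y : V) : ℝ := Set.indicator {x} (fun _ => (1 : ℝ)) y

namespace SymmRates

variable {V : Type*} (R : SymmRates V)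

/-- The generator of the random walk, `∑ y, p x y (f y - f x)`. -/
noncomputable def genRW (f : V → ℝ) (x : V) : ℝ := ∑' y, R.p x y * (f y - f x)

/-- Total rate out of `x`. -/
noncomputable def total (x : V) : ℝ := ∑' y, R.p x y

/-- The rate of the uniform clock, a common strict upper bound of all the total rates. -/
noncomputable def clockRate : ℝ := 1 + ⨆ x, R.total x

lemma total_nonneg (x : V) : 0 ≤ R.total x := tsum_nonneg (R.nonneg x)

lemma summable_row (x : V) : Summable (R.p x) := (R.bounded.choose_spec x).1

lemma total_lt_clockRate (x : V) : R.total x < R.clockRate := by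
  obtain ⟨C, hC⟩ := R.bounded
  have : R.total x ≤ ⨆ x, R.total x :=
    le_ciSup (f := R.total) ⟨C, by rintro _ ⟨y, rfl⟩; exact (hC y).2⟩ x
  unfold clockRate
  linarith

lemma clockRate_pos (x : V) : 0 < R.clockRate :=
  (R.total_nonneg x).trans_lt (R.total_lt_clockRate x)

/-- Transition probabilities of the skeleton chain, `I + L / clockRate`: at each tick of a clock of
rate `clockRate` the walker moves from `x` to `y` with probability `p x y / clockRate`, and stays
at `x` with the remaining probability. -/
noncomputable def stepProb (x y : V) : ℝ :=
  R.p x y / R.clockRate + kron x y * (1 - R.total x / R.clockRate)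

lemma stepProb_nonneg (x y : V) : 0 ≤ R.stepProb x y := by
  have h := R.clockRate_pos x
  have h1 : R.total x / R.clockRate ≤ 1 := (div_le_one h).2 (R.total_lt_clockRate x).le
  have h2 : 0 ≤ kron x y := Set.indicator_nonneg (fun _ _ => zero_le_one) _
  exact add_nonneg (div_nonneg (R.nonneg x y) h.le) (mul_nonneg h2 (by linarith))

lemma hasSum_stepProb (x : V) : HasSum (R.stepProb x) 1 := by
  have h1 : HasSum (fun y => R.p x y / R.clockRate) (R.total x / R.clockRate) :=
    (R.summable_row x).hasSum.div_const _
  have h2 : HasSum (fun y => kron x y) (1 : ℝ) := by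
    have := hasSum_single (f := fun y => kron x y) x
      (fun y hy => Set.indicator_of_notMem (by simpa using hy) _)
    simpa [kron] using this
  have h3 := h1.add (h2.mul_right (1 - R.total x / R.clockRate))
  rw [one_mul, add_sub_cancel] at h3
  exact h3

/-- The law of one step of the skeleton chain from `x`. -/
noncomputable def stepPMF (x : V) : PMF V :=
  ⟨fun y => ENNReal.ofReal (R.stepProb x y), by
    have h := ENNReal.ofReal_tsum_of_nonneg (R.stepProb_nonneg x) (R.hasSum_stepProb x).summable
    rw [(R.hasSum_stepProb x).tsum_eq, ENNReal.ofReal_one] at h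
    rw [h]
    exact ENNReal.summable.hasSum⟩

variable [Countable V] [MeasurableSpace V] [DiscreteMeasurableSpace V]

/-- The one-step kernel of the skeleton chain, as a function of the past trajectory. -/
noncomputable def stepKernel (n : ℕ) : Kernel (∀ _ : Finset.Iic n, V) V where
  toFun h := (R.stepPMF (h ⟨n, Finset.mem_Iic.2 le_rfl⟩)).toMeasure
  measurable' :=
    (Measurable.of_discrete (f := fun x : V => (R.stepPMF x).toMeasure)).comp
      (measurable_pi_apply _)

instance (n : ℕ) : IsMarkovKernel (R.stepKernel n) :=
  ⟨fun h => PMF.toMeasure.isProbabilityMeasure (R.stepPMF (h ⟨n, Finset.mem_Iic.2 le_rfl⟩))⟩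

/-- The law of the skeleton chain started at `x`. -/
noncomputable def skeletonLaw (x : V) : Measure (ℕ → V) :=
  Kernel.traj (X := fun _ => V) R.stepKernel 0 (fun _ => x)

end SymmRates

/-- The law of a sequence of independent exponential waiting times of mean one. -/
noncomputable def expClock : Measure (ℕ → ℝ) := Measure.infinitePi (fun _ : ℕ => expMeasure 1)

/-- Time of the `k`-th arrival (`k = 0, 1, …`) for the waiting times `e`. -/
noncomputable def arrivalTime (e : ℕ → ℝ) (k : ℕ) : ℝ := ∑ j ∈ Finset.range (k + 1), e j

/-- Number of arrivals up to time `s`. Under `expClock` this is a Poisson process of rate one. -/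
noncomputable def arrivalCount (e : ℕ → ℝ) (s : ℝ) : ℕ := Set.ncard {k | arrivalTime e k ≤ s}

/-- Sample space of a single walk: the waiting times of its clock and its skeleton chain. -/
abbrev WalkSample (V : Type*) := (ℕ → ℝ) × (ℕ → V)

namespace SymmRates

variable {V : Type*} (R : SymmRates V)

/-- The position `X_t` of the continuous-time random walk: the skeleton chain evaluated at the
number of ticks, up to time `t`, of a Poisson clock of rate `clockRate`. -/
noncomputable def walk (t : ℝ) (w : WalkSample V) : V := w.2 (arrivalCount w.1 (R.clockRate * t))

variable [Countable V] [MeasurableSpace V] [DiscreteMeasurableSpace V]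

/-- The law `P_x` of the continuous-time random walk started at `x`. -/
noncomputable def walkLaw (x : V) : Measure (WalkSample V) := expClock.prod (R.skeletonLaw x)

/-- The walk is recurrent: from every `x` it almost surely visits `x` at arbitrarily late times. -/
def IsRecurrent : Prop :=
  ∀ x, ∀ᵐ w ∂(R.walkLaw x), ¬ BddAbove {t : ℝ | 0 ≤ t ∧ R.walk t w = x}

/-- The walk is transient: from every `x` it almost surely has a last visit time to `x`. -/
def IsTransient : Prop :=
  ∀ x, ∀ᵐ w ∂(R.walkLaw x), BddAbove {t : ℝ | 0 ≤ t ∧ R.walk t w = x}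

/-- `P_x(X_s = o)`. -/
noncomputable def hitProb (o x : V) (s : ℝ) : ℝ := (R.walkLaw x).real {w | R.walk s w = o}

/-- The density `ρ_t x = E_x ρ(X_t) + lam ∫_0^t P_x(X_s = o) ds`. -/
noncomputable def density (o : V) (lam : ℝ) (ρ : V → ℝ) (t : ℝ) (x : V) : ℝ :=
  (∫ w, ρ (R.walk t w) ∂(R.walkLaw x)) + lam * ∫ s in (0 : ℝ)..t, R.hitProb o x s

/-- Density profiles `ρ : V → [0, ∞)` for which `E_x ρ(X_t)` is finite for all `x` and `t`. -/
def Admissible (ρ : V → ℝ) : Prop :=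
  (∀ x, 0 ≤ ρ x) ∧ ∀ t, 0 ≤ t → ∀ x, Integrable (fun w => ρ (R.walk t w)) (R.walkLaw x)

end SymmRates

/-! ### Independent random walkers with a source -/

/-- Sample space of the particle system: the initial configuration, the paths of the particles
initially present (labelled by their site and a number), the waiting times of the source, and the
paths of the particles created by the source. -/
abbrev SystemSample (V : Type*) :=
  (V → ℕ) × (V × ℕ → WalkSample V) × (ℕ → ℝ) × (ℕ → WalkSample V)

namespace SymmRates

variable {V : Type*} (R : SymmRates V)

/-- The particles initially present (`(x, i)` with `i < η_x`) that are at `y` at time `t`. -/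
def initialAt (t : ℝ) (y : V) (ω : SystemSample V) : Set (V × ℕ) :=
  {a | a.2 < ω.1 a.1 ∧ R.walk t (ω.2.1 a) = y}

/-- The particles created by the source up to time `t` that are at `y` at time `t`. The `k`-th
particle is created at time `arrivalTime k / lam`, hence at rate `lam`; for `lam = 0` almost surely
no particle is ever created. -/
def createdAt (lam t : ℝ) (y : V) (ω : SystemSample V) : Set ℕ :=
  {k | arrivalTime ω.2.2.1 k ≤ lam * t ∧
    R.walk (t - arrivalTime ω.2.2.1 k / lam) (ω.2.2.2 k) = y}

/-- The configuration at time `t`: the number of particles at each site. -/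
noncomputable def config (lam t : ℝ) (ω : SystemSample V) : V → ℕ := fun y =>
  (R.initialAt t y ω).ncard + (R.createdAt lam t y ω).ncard

variable [Countable V] [MeasurableSpace V] [DiscreteMeasurableSpace V]

/-- The joint law, for the source at `o` and the initial law `μ`: all the walks and the source
clock are independent of each other and of the initial configuration. -/
noncomputable def systemLaw (o : V) (μ : Measure (V → ℕ)) : Measure (SystemSample V) :=
  μ.prod ((Measure.infinitePi (fun a : V × ℕ => R.walkLaw a.1)).prod
    (expClock.prod (Measure.infinitePi (fun _ : ℕ => R.walkLaw o))))

/-- The law at time `t` of independent random walkers with source of intensity `lam` at `o`, started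
from the law `μ`. -/
noncomputable def lawAt (o : V) (lam : ℝ) (μ : Measure (V → ℕ)) (t : ℝ) : Measure (V → ℕ) :=
  (R.systemLaw o μ).map (R.config lam t)

end SymmRates

/-- The product over `x` of the Poisson measures with parameters `ρ x`. -/
noncomputable def poissonProduct {V : Type*} (ρ : V → ℝ) : Measure (V → ℕ) :=
  Measure.infinitePi (fun x => poissonMeasure (ρ x).toNNReal)

/-! ### The generators and the generating-function map -/

open scoped Classical in
/-- The configuration `η + e_x`. -/
noncomputable def addParticle {V : Type*} (η : V → ℕ) (x : V) : V → ℕ :=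
  Function.update η x (η x + 1)

open scoped Classical in
/-- The configuration in which a particle has moved from `x` to `y`; it is `η` itself if there is
no particle at `x`. -/
noncomputable def moveParticle {V : Type*} (η : V → ℕ) (x y : V) : V → ℕ :=
  if η x = 0 then η else addParticle (Function.update η x (η x - 1)) y

/-- Both jumps across the edge `xy`, weighted by the numbers of particles. -/
noncomputable def edgeJump {V : Type*} (f : (V → ℕ) → ℝ) (η : V → ℕ) (x y : V) : ℝ :=
  (η x : ℝ) * (f (moveParticle η x y) - f η) + (η y : ℝ) * (f (moveParticle η y x) - f η)

/-- The partial derivative of `F` in the coordinate `x`. -/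
noncomputable def partialDeriv {V : Type*} (F : (V → ℝ) → ℝ) (x : V) (z : V → ℝ) : ℝ :=
  deriv (fun s : ℝ => F (fun y => z y + s * kron x y)) 0

namespace SymmRates

variable {V : Type*} (R : SymmRates V)

/-- The generator of independent random walkers with source of intensity `lam` at `o`. The factor
`1 / 2` is there because the sum is over ordered pairs and every term contains both jumps across
the edge, so that each particle jumps from `x` to `y` at rate `p x y`. -/
noncomputable def genIRW (o : V) (lam : ℝ) (f : (V → ℕ) → ℝ) (η : V → ℕ) : ℝ :=
  (1 / 2) * (∑' e : V × V, R.p e.1 e.2 * edgeJump f η e.1 e.2)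
    + lam * (f (addParticle η o) - f η)

/-- The summand of the first-order operator belonging to the ordered pair `e`. -/
noncomputable def flowTerm (F : (V → ℝ) → ℝ) (z : V → ℝ) (e : V × V) : ℝ :=
  -(R.p e.1 e.2) * (z e.1 - z e.2) * (partialDeriv F e.1 z - partialDeriv F e.2 z)

/-- The first-order operator of the system
`dz_x/dt = ∑ y, p x y (z_y - z_x) + lam δ_{x,o}`; the factor `1 / 2` is as in `genIRW`. -/
noncomputable def genFlow (o : V) (lam : ℝ) (F : (V → ℝ) → ℝ) (z : V → ℝ) : ℝ :=
  (1 / 2) * (∑' e : V × V, R.flowTerm F z e) + lam * partialDeriv F o z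

end SymmRates

open scoped Classical in
/-- The configuration equal to `k` on `Λ` and to `0` off `Λ`. -/
noncomputable def extendZero {V : Type*} (Λ : Finset V) (k : Λ → ℕ) : V → ℕ :=
  fun x => if h : x ∈ Λ then k ⟨x, h⟩ else 0

/-- The terms of the generating function in the variables `z_i`, `i ∈ Λ`. -/
noncomputable def genFunTerm {V : Type*} (Λ : Finset V) (g : (V → ℕ) → ℝ) (z : V → ℝ)
    (k : Λ → ℕ) : ℝ :=
  (∏ i : Λ, z i ^ k i / (Nat.factorial (k i) : ℝ) * Real.exp (-z i)) * g (extendZero Λ k)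

/-- The generating function `𝒢 g` of a function `g` that depends on the coordinates in `Λ`. -/
noncomputable def genFun {V : Type*} (Λ : Finset V) (g : (V → ℕ) → ℝ) (z : V → ℝ) : ℝ :=
  ∑' k : Λ → ℕ, genFunTerm Λ g z k

/-- `𝒢 g z = a` for a function `g` that need not be local: the generating functions over the finite
sets `Λ` converge absolutely as soon as `Λ` is large, and tend to `a` as `Λ` increases to `V`. For
`g` local, with absolutely convergent series, they do not depend on `Λ` once `Λ` is large. -/
def HasGenFun {V : Type*} (g : (V → ℕ) → ℝ) (z : V → ℝ) (a : ℝ) : Prop :=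
  (∀ᶠ Λ : Finset V in atTop, Summable (genFunTerm Λ g z)) ∧
    Tendsto (fun Λ : Finset V => genFun Λ g z) atTop (𝓝 a)

open scoped ENNReal

/-! Walk and density. The walk is a skeleton chain with kernel `I + L / clockRate` run by an
independent Poisson clock, so `E_x ρ(X_t)` is a Poisson mixture of the `n`-step means of `ρ`
(`lintegral_walk`). Admissibility of `ρ` says that the exponential generating series of these means
is entire. Differentiating a Poisson mixture produces the mixture of the forward differences
(`EntireSeq.hasDerivAt`), which is Kolmogorov's equation, without any boundedness of `ρ`.
Integrating this equation in time for `P_x(X_s = o)` gives the source term of the density (Duhamel).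
A Poisson weight has time integral `1 / clockRate`, so the total occupation time of `o` is the Green
function of the skeleton chain divided by `clockRate` (`lintegral_hitProb`). Divergence and the
transient limit then follow from the classical dichotomy: recurrence means an infinite Green
function (`isRecurrent_iff_green`).

Intertwining. Under Poisson weights a factor `k x` may be traded for a factor `z x` and one more
particle at `x` (`hasSum_mul_prodWeight`), and `∂_x` acts on a generating function as the increment
under adding a particle at `x` (`ConvergesBeyond.tsum_deriv`). With `D` denoting that increment, the
two jumps across an edge `xy` become `(z x - z y) * (D y - D x)`, which is the edge term of the
flow. The rest is Fubini and dominated convergence over the edges that touch the support of `f`.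

Evolution. Laws on `V → ℕ` are determined by the expectations of products of `u y ^ η y` with
factors in `[0, 1]`. Particles initially present contribute `E_x u(X_t)` each; the source
contributes the exponential functional of a Poisson process (`lintegral_prod_arrivals`). For Poisson
initial data the exponent is a sum of `ρ x * (E_x u(X_t) - 1)` plus a source term, and the symmetry
of the walk rewrites it as a sum of `ρ_t y * (u y - 1)`. This is the generating function of the
Poisson product with density `ρ_t` (`Admissible.lawAt_poissonProduct`). For nonnegative `z` the map
`𝒢` is expectation, so the forward equation is the chain rule for `𝒢 f` along `ρ_t`, combined with
the intertwining identity.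

Generator and limit. The generator at a finite configuration is obtained by induction on the number
of particles: the empty configuration is the Poisson product of density zero, and one additional
particle moves independently of the rest (`lawAt_dirac_addParticle`). Weak convergence follows by
realizing all Poisson product measures on a single space of Poisson processes. -/

instance isProbabilityMeasure_expMeasure_one : IsProbabilityMeasure (expMeasure 1) :=
  isProbabilityMeasure_expMeasure one_pos

instance : IsProbabilityMeasure expClock := by unfold expClock; infer_instance

/-! ### The Poisson clock -/

/-- Prepend a value to a sequence. -/
def seqCons {α : Type*} (v : α) (e : ℕ → α) : ℕ → α
  | 0 => v
  | n + 1 => e n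

@[simp] lemma seqCons_zero {α : Type*} (v : α) (e : ℕ → α) : seqCons v e 0 = v := rfl
@[simp] lemma seqCons_succ {α : Type*} (v : α) (e : ℕ → α) (n : ℕ) :
    seqCons v e (n + 1) = e n := rfl

lemma measurable_seqCons {α : Type*} [MeasurableSpace α] :
    Measurable (fun q : α × (ℕ → α) => seqCons q.1 q.2) := by
  refine measurable_pi_lambda _ fun n => ?_
  cases n with
  | zero => exact measurable_fst
  | succ n => exact (measurable_pi_apply n).comp measurable_snd

/-- Conditioning on the first waiting time rests on this. It is checked on finite-dimensional boxes:
the constraint at index `0` separates from the others, whose indices drop by one. -/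
lemma infinitePi_map_seqCons {α : Type*} [MeasurableSpace α] (μ : Measure α)
    [IsProbabilityMeasure μ] :
    (μ.prod (Measure.infinitePi fun _ : ℕ => μ)).map (fun q => seqCons q.1 q.2) =
      Measure.infinitePi fun _ : ℕ => μ := by
  refine Measure.eq_infinitePi _ fun s t ht => ?_
  rw [Measure.map_apply measurable_seqCons (.pi s.countable_toSet fun i _ => ht i)]
  have hpre : (fun q : α × (ℕ → α) => seqCons q.1 q.2) ⁻¹' (Set.pi s t) =
      (if 0 ∈ s then t 0 else Set.univ) ×ˢ
        Set.pi ((s.erase 0).image Nat.pred : Finset ℕ) (fun i => t (i + 1)) := by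
    ext ⟨v, e⟩
    simp only [Set.mem_preimage, Set.mem_pi, Finset.mem_coe, Set.mem_prod, Finset.mem_image,
      Finset.mem_erase]
    constructor
    · intro h
      refine ⟨?_, ?_⟩
      · split_ifs with h0
        · exact h 0 h0
        · trivial
      · rintro i ⟨j, ⟨hj0, hj⟩, rfl⟩
        obtain ⟨k, rfl⟩ := Nat.exists_eq_succ_of_ne_zero hj0
        exact h _ hj
    · rintro ⟨h0, h1⟩ i hi
      cases i with
      | zero => simpa [hi] using h0
      | succ k => exact h1 k ⟨k + 1, ⟨by simp, hi⟩, rfl⟩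
  rw [hpre, Measure.prod_prod, Measure.infinitePi_pi _ fun i _ => ht _]
  have himg : ∏ i ∈ (s.erase 0).image Nat.pred, μ (t (i + 1)) = ∏ i ∈ s.erase 0, μ (t i) := by
    rw [Finset.prod_image]
    · refine Finset.prod_congr rfl fun i hi => ?_
      obtain ⟨k, rfl⟩ := Nat.exists_eq_succ_of_ne_zero (Finset.ne_of_mem_erase hi)
      rfl
    · intro i hi j hj hij
      have := Finset.ne_of_mem_erase hi
      have := Finset.ne_of_mem_erase hj
      simp only [Nat.pred_eq_sub_one] at hij
      omega
  rw [himg]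
  split_ifs with h0
  · exact Finset.mul_prod_erase s (fun i => μ (t i)) h0
  · rw [measure_univ, one_mul, Finset.erase_eq_of_notMem h0]

lemma lintegral_expClock {G : (ℕ → ℝ) → ℝ≥0∞} (hG : Measurable G) :
    ∫⁻ e, G e ∂expClock = ∫⁻ v, ∫⁻ e, G (seqCons v e) ∂expClock ∂(expMeasure 1) := by
  have h := infinitePi_map_seqCons (expMeasure 1)
  unfold expClock
  conv_lhs => rw [← h]
  rw [lintegral_map hG measurable_seqCons]
  exact lintegral_prod _ (hG.comp measurable_seqCons).aemeasurable

lemma lintegral_expMeasure_one {φ : ℝ → ℝ≥0∞} (hφ : Measurable φ) :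
    ∫⁻ v, φ v ∂(expMeasure 1) = ∫⁻ v in Set.Ici 0, ENNReal.ofReal (Real.exp (-v)) * φ v := by
  have hm : Measurable (exponentialPDF 1) := (measurable_exponentialPDFReal 1).ennreal_ofReal
  have : expMeasure 1 = volume.withDensity (exponentialPDF 1) := rfl
  rw [this, lintegral_withDensity_eq_lintegral_mul _ hm hφ, ← lintegral_indicator measurableSet_Ici]
  refine lintegral_congr fun v => ?_
  by_cases hv : 0 ≤ v
  · simp [hv, exponentialPDF_of_nonneg hv]
  · simp [hv, exponentialPDF_of_neg (not_le.1 hv)]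

lemma arrivalTime_seqCons_zero (v : ℝ) (e : ℕ → ℝ) : arrivalTime (seqCons v e) 0 = v := by
  simp [arrivalTime]

lemma arrivalTime_seqCons_succ (v : ℝ) (e : ℕ → ℝ) (k : ℕ) :
    arrivalTime (seqCons v e) (k + 1) = v + arrivalTime e k := by
  simp only [arrivalTime, Finset.sum_range_succ' _ (k + 1), seqCons_succ, seqCons_zero]
  ring

lemma measurable_arrivalTime (k : ℕ) : Measurable fun e : ℕ → ℝ => arrivalTime e k := by
  unfold arrivalTime; fun_prop

/-- The event that exactly the first `m` arrivals, shifted by `s`, are at most `T`. -/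
def arrivalEvent (T s : ℝ) (m : ℕ) : Set (ℕ → ℝ) :=
  {e | (∀ k < m, s + arrivalTime e k ≤ T) ∧ T < s + arrivalTime e m}

lemma measurableSet_arrivalEvent (T s : ℝ) (m : ℕ) : MeasurableSet (arrivalEvent T s m) := by
  have h := measurable_arrivalTime
  unfold arrivalEvent
  measurability

lemma seqCons_mem_arrivalEvent_zero {T s v : ℝ} {e : ℕ → ℝ} :
    seqCons v e ∈ arrivalEvent T s 0 ↔ T - s < v := by
  simp [arrivalEvent, arrivalTime_seqCons_zero, sub_lt_iff_lt_add']

/-- The renewal recursion, and the reason why `arrivalEvent` carries a shift: after a first waiting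
time `v` the clock starts afresh at `s + v`. -/
lemma seqCons_mem_arrivalEvent_succ {T s v : ℝ} {e : ℕ → ℝ} {m : ℕ} :
    seqCons v e ∈ arrivalEvent T s (m + 1) ↔ s + v ≤ T ∧ e ∈ arrivalEvent T (s + v) m := by
  simp only [arrivalEvent, Set.mem_ofPred_eq, arrivalTime_seqCons_succ, add_assoc, ← and_assoc]
  refine and_congr_left fun _ => ⟨fun h => ⟨?_, fun k hk => ?_⟩, fun h k hk => ?_⟩
  · simpa [arrivalTime_seqCons_zero] using h 0 (Nat.succ_pos _)
  · simpa [arrivalTime_seqCons_succ, add_assoc] using h (k + 1) (Nat.succ_lt_succ hk)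
  · cases k with
    | zero => simpa [arrivalTime_seqCons_zero] using h.1
    | succ k => simpa [arrivalTime_seqCons_succ] using h.2 k (Nat.lt_of_succ_lt_succ hk)

/-- The weight `s ^ n / n! * exp (-s)` of the Poisson distribution. -/
noncomputable def poissonWeight (n : ℕ) (s : ℝ) : ℝ := s ^ n / n.factorial * Real.exp (-s)

/-- Induction on `m`, conditioning on the first waiting time. Nonnegativity of `h` is needed only up
to `T`; in the application `h` has a probabilistic meaning only there. -/
lemma lintegral_arrivalEvent {h : ℝ → ℝ} (hc : Continuous h) {T : ℝ} (h0 : ∀ a ≤ T, 0 ≤ h a)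
    (m : ℕ) : ∀ s ≤ T, ∫⁻ e, (arrivalEvent T s m).indicator
      (fun e => ∏ k ∈ Finset.range m, ENNReal.ofReal (h (s + arrivalTime e k))) e ∂expClock =
      ENNReal.ofReal (Real.exp (-(T - s)) * (∫ a in s..T, h a) ^ m / m.factorial) := by
  have hmeas : ∀ (m : ℕ) (s : ℝ), Measurable ((arrivalEvent T s m).indicator
      (fun e => ∏ k ∈ Finset.range m, ENNReal.ofReal (h (s + arrivalTime e k)))) := by
    intro m s
    refine Measurable.indicator ?_ (measurableSet_arrivalEvent T s m)
    refine Finset.measurable_prod _ fun k _ => ?_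
    exact (hc.measurable.comp ((measurable_arrivalTime k).const_add s)).ennreal_ofReal
  induction m with
  | zero =>
    intro s hs
    rw [lintegral_expClock (hmeas 0 s)]
    simp only [Set.indicator, seqCons_mem_arrivalEvent_zero, Finset.range_zero, Finset.prod_empty]
    simp only [lintegral_const, measure_univ, mul_one]
    rw [lintegral_expMeasure_one (Measurable.ite measurableSet_Ioi measurable_const measurable_const)]
    have : ∀ v, ENNReal.ofReal (Real.exp (-v)) * (if T - s < v then (1 : ℝ≥0∞) else 0) =
        (Set.Ioi (T - s)).indicator (fun v => ENNReal.ofReal (Real.exp (-v))) v := by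
      intro v; simp [Set.indicator]
    simp only [this]
    rw [lintegral_indicator measurableSet_Ioi, Measure.restrict_restrict measurableSet_Ioi,
      Set.inter_eq_left.2 (Set.Ioi_subset_Ici (sub_nonneg.2 hs)),
      ← ofReal_integral_eq_lintegral_ofReal, integral_exp_neg_Ioi]
    · simp
    · exact integrableOn_exp_neg_Ioi _
    · exact ae_of_all _ fun v => (Real.exp_pos _).le
  | succ m ih =>
    intro s hs
    rw [lintegral_expClock (hmeas (m + 1) s)]
    have key : ∀ v : ℝ, ∫⁻ e, (arrivalEvent T s (m + 1)).indicator
        (fun e => ∏ k ∈ Finset.range (m + 1), ENNReal.ofReal (h (s + arrivalTime e k)))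
          (seqCons v e) ∂expClock =
        if s + v ≤ T then ENNReal.ofReal (h (s + v)) * ENNReal.ofReal
          (Real.exp (-(T - (s + v))) * (∫ a in (s + v)..T, h a) ^ m / m.factorial) else 0 := by
      intro v
      split_ifs with hv
      · rw [← ih (s + v) hv, ← lintegral_const_mul _ (hmeas m (s + v))]
        refine lintegral_congr fun e => ?_
        by_cases he : e ∈ arrivalEvent T (s + v) m
        · rw [Set.indicator_of_mem (seqCons_mem_arrivalEvent_succ.2 ⟨hv, he⟩),
            Set.indicator_of_mem he, Finset.prod_range_succ', mul_comm]
          simp [arrivalTime_seqCons_succ, arrivalTime_seqCons_zero, add_assoc]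
        · rw [Set.indicator_of_notMem fun h => he (seqCons_mem_arrivalEvent_succ.1 h).2,
            Set.indicator_of_notMem he, mul_zero]
      · refine (lintegral_congr fun e => ?_).trans lintegral_zero
        exact Set.indicator_of_notMem (fun h => hv (seqCons_mem_arrivalEvent_succ.1 h).1) _
    simp only [key]
    have hder : ∀ v, HasDerivAt (fun v => ∫ a in (s + v)..T, h a) (-h (s + v)) v := by
      intro v
      have h1 := intervalIntegral.integral_hasDerivAt_left (hc.intervalIntegrable (s + v) T)
        (hc.stronglyMeasurableAtFilter _ _) hc.continuousAt
      exact h1.comp_const_add s v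
    have hcont : Continuous fun v => ∫ a in (s + v)..T, h a :=
      continuous_iff_continuousAt.2 fun v => (hder v).continuousAt
    rw [lintegral_expMeasure_one]
    swap
    · refine Measurable.ite (measurableSet_le (by fun_prop) (by fun_prop)) ?_ measurable_const
      exact ((hc.comp (continuous_const.add continuous_id)).measurable.ennreal_ofReal).mul
        (Continuous.measurable (by fun_prop)).ennreal_ofReal
    -- The density `exp (-v)` and the exponential of the induction hypothesis combine to `exp (-(T -
    -- s))`, which does not depend on `v`.
    set D : ℝ → ℝ := fun v =>
      Real.exp (-(T - s)) * (h (s + v) * (∫ a in (s + v)..T, h a) ^ m / m.factorial) with hD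
    have hDc : Continuous D := by
      have := hc.comp (continuous_const.add continuous_id : Continuous fun v : ℝ => s + v)
      simp only [Function.comp_def] at this
      fun_prop
    have e1 : ∀ v ∈ Set.Ici (0 : ℝ), ENNReal.ofReal (Real.exp (-v)) * (if s + v ≤ T then
        ENNReal.ofReal (h (s + v)) * ENNReal.ofReal
          (Real.exp (-(T - (s + v))) * (∫ a in (s + v)..T, h a) ^ m / m.factorial) else 0) =
        (Set.Icc 0 (T - s)).indicator (fun v => ENNReal.ofReal (D v)) v := by
      intro v hv
      by_cases hv' : s + v ≤ T
      · rw [if_pos hv', Set.indicator_of_mem (by exact ⟨hv, by linarith⟩),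
          ← ENNReal.ofReal_mul (h0 _ hv'), ← ENNReal.ofReal_mul (Real.exp_pos _).le]
        congr 1
        have : Real.exp (-(T - s)) = Real.exp (-v) * Real.exp (-(T - (s + v))) := by
          rw [← Real.exp_add]; ring_nf
        simp only [hD, this]
        ring
      · rw [if_neg hv', Set.indicator_of_notMem (fun h => hv' (by linarith [h.2])), mul_zero]
    rw [setLIntegral_congr_fun measurableSet_Ici e1, lintegral_indicator measurableSet_Icc,
      Measure.restrict_restrict measurableSet_Icc, Set.inter_eq_left.2 Set.Icc_subset_Ici_self,
      ← ofReal_integral_eq_lintegral_ofReal hDc.integrableOn_Icc]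
    · rw [integral_Icc_eq_integral_Ioc, ← intervalIntegral.integral_of_le (sub_nonneg.2 hs)]
      congr 1
      -- What is left is `h` times a power of its integral up to `T`, an exact derivative in `v`.
      have hF : ∀ v, HasDerivAt (fun v => -(Real.exp (-(T - s)) *
          ((∫ a in (s + v)..T, h a) ^ (m + 1) / (m + 1).factorial))) (D v) v := by
        intro v
        have h2 := ((((hder v).pow (m + 1)).div_const ((m + 1).factorial : ℝ)).const_mul
          (Real.exp (-(T - s)))).neg
        refine h2.congr_deriv ?_
        simp only [hD, Nat.factorial_succ, Nat.cast_mul, Nat.cast_add, Nat.cast_one,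
          Nat.add_sub_cancel]
        have : (m.factorial : ℝ) ≠ 0 := by positivity
        have : (m : ℝ) + 1 ≠ 0 := by positivity
        field_simp
      rw [intervalIntegral.integral_eq_sub_of_hasDerivAt (fun v _ => hF v)
        (hDc.intervalIntegrable _ _)]
      simp only [add_sub_cancel, intervalIntegral.integral_same, add_zero]
      simp
      ring
    · refine (ae_restrict_iff' measurableSet_Icc).2 (ae_of_all _ fun v hv => ?_)
      have h1 : 0 ≤ ∫ a in (s + v)..T, h a :=
        intervalIntegral.integral_nonneg (by linarith [hv.2]) fun a ha => h0 a ha.2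
      have h2 := h0 (s + v) (by linarith [hv.2])
      simp only [hD, Pi.zero_apply]
      positivity

lemma ae_expClock_pos : ∀ᵐ e ∂expClock, ∀ j, 0 < e j := by
  refine ae_all_iff.2 fun j => ?_
  have h1 : ∀ᵐ v ∂(expMeasure 1), 0 < v := by
    rw [ae_iff]
    have h2 := lintegral_expMeasure_one
      (measurable_const.indicator measurableSet_Iic : Measurable ((Set.Iic (0:ℝ)).indicator 1))
    rw [lintegral_indicator_one measurableSet_Iic] at h2
    simp only [not_lt]
    refine h2.trans ?_
    rw [setLIntegral_eq_zero_iff measurableSet_Ici]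
    · have : ∀ᵐ v : ℝ, v ≠ 0 := Measure.ae_ne volume 0
      filter_upwards [this] with v hv hv0
      have : v ∉ Set.Iic (0 : ℝ) := fun h => hv (le_antisymm h hv0)
      simp [Set.indicator_of_notMem this]
    · exact (by fun_prop : Measurable fun v : ℝ => ENNReal.ofReal (Real.exp (-v))).mul
        (measurable_const.indicator measurableSet_Iic)
  have h := Measure.infinitePi_map_eval (fun _ : ℕ => expMeasure 1) j
  rw [← h] at h1
  exact ae_of_ae_map (measurable_pi_apply j).aemeasurable h1

lemma arrivalTime_strictMono {e : ℕ → ℝ} (he : ∀ j, 0 < e j) : StrictMono (arrivalTime e) := by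
  refine strictMono_nat_of_lt_succ fun k => ?_
  rw [arrivalTime, arrivalTime, Finset.sum_range_succ _ (k + 1)]
  linarith [he (k + 1)]

lemma arrivals_eq_of_mem_arrivalEvent {e : ℕ → ℝ} (he : ∀ j, 0 < e j) {T : ℝ} {m : ℕ}
    (hm : e ∈ arrivalEvent T 0 m) (k : ℕ) : arrivalTime e k ≤ T ↔ k < m := by
  simp only [arrivalEvent, zero_add, Set.mem_ofPred_eq] at hm
  refine ⟨fun h => ?_, hm.1 k⟩
  by_contra hk
  exact absurd (hm.2.trans_le ((arrivalTime_strictMono he).monotone (not_lt.1 hk))) (not_lt.2 h)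

lemma arrivalCount_eq_of_mem_arrivalEvent {e : ℕ → ℝ} (he : ∀ j, 0 < e j) {T : ℝ} {m : ℕ}
    (hm : e ∈ arrivalEvent T 0 m) : arrivalCount e T = m := by
  have : {k | arrivalTime e k ≤ T} = (Finset.range m : Set ℕ) := by
    ext k; simp [arrivals_eq_of_mem_arrivalEvent he hm]
  rw [arrivalCount, this, Set.ncard_coe_finset, Finset.card_range]

lemma pairwise_disjoint_arrivalEvent (T : ℝ) :
    Pairwise (Function.onFun Disjoint (arrivalEvent T 0)) := by
  intro m n hmn
  refine Set.disjoint_left.2 fun e h1 h2 => ?_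
  simp only [arrivalEvent, zero_add, Set.mem_ofPred_eq] at h1 h2
  rcases lt_or_gt_of_ne hmn with h | h
  · exact absurd (h2.1 m h) (not_le.2 h1.2)
  · exact absurd (h1.1 n h) (not_le.2 h2.2)

lemma expClock_arrivalEvent {T : ℝ} (hT : 0 ≤ T) (m : ℕ) :
    expClock (arrivalEvent T 0 m) = ENNReal.ofReal (poissonWeight m T) := by
  have h := lintegral_arrivalEvent (h := fun _ => 1) continuous_const (fun _ _ => zero_le_one) m 0 hT
  simp only [ENNReal.ofReal_one, Finset.prod_const_one] at h
  rw [lintegral_indicator_const (measurableSet_arrivalEvent T 0 m), one_mul] at h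
  rw [h, poissonWeight]
  simp
  ring_nf

lemma hasSum_pow_div_factorial (x : ℝ) : HasSum (fun n : ℕ => x ^ n / n.factorial) (Real.exp x) := by
  rw [Real.exp_eq_exp_ℝ]
  exact NormedSpace.expSeries_div_hasSum_exp x

lemma hasSum_poissonWeight (s : ℝ) : HasSum (fun n => poissonWeight n s) 1 := by
  have := (hasSum_pow_div_factorial s).mul_right (Real.exp (-s))
  rwa [← Real.exp_add, add_neg_cancel, Real.exp_zero] at this

lemma poissonWeight_nonneg {s : ℝ} (hs : 0 ≤ s) (n : ℕ) : 0 ≤ poissonWeight n s := by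
  unfold poissonWeight; positivity

/-- The disjoint events have Poisson probabilities, which sum to one; this excludes infinitely many
arrivals before `T`. -/
lemma ae_exists_mem_arrivalEvent {T : ℝ} (hT : 0 ≤ T) :
    ∀ᵐ e ∂expClock, ∃ m, e ∈ arrivalEvent T 0 m := by
  have h : expClock (⋃ m, arrivalEvent T 0 m) = 1 := by
    rw [measure_iUnion (pairwise_disjoint_arrivalEvent T) (measurableSet_arrivalEvent T 0)]
    simp only [expClock_arrivalEvent hT]
    rw [← ENNReal.ofReal_tsum_of_nonneg (poissonWeight_nonneg hT) (hasSum_poissonWeight T).summable,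
      (hasSum_poissonWeight T).tsum_eq, ENNReal.ofReal_one]
  have := (prob_compl_eq_zero_iff (.iUnion (measurableSet_arrivalEvent T 0))).2 h
  rw [ae_iff]
  convert this using 2
  ext e; simp

/-- The exponential functional of a Poisson process of rate one on `[0, T]`. -/
lemma lintegral_prod_arrivals {h : ℝ → ℝ} (hc : Continuous h) {T : ℝ} (hT : 0 ≤ T)
    (h0 : ∀ a ≤ T, 0 ≤ h a) {Φ : (ℕ → ℝ) → ℝ≥0∞}
    (hΦ : ∀ e, (∀ j, 0 < e j) → ∀ m, e ∈ arrivalEvent T 0 m →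
      Φ e = ∏ k ∈ Finset.range m, ENNReal.ofReal (h (arrivalTime e k))) :
    ∫⁻ e, Φ e ∂expClock = ENNReal.ofReal (Real.exp (∫ a in (0:ℝ)..T, (h a - 1))) := by
  have h1 : ∫⁻ e, Φ e ∂expClock = ∫⁻ e, ∑' m, (arrivalEvent T 0 m).indicator
      (fun e => ∏ k ∈ Finset.range m, ENNReal.ofReal (h (0 + arrivalTime e k))) e ∂expClock := by
    refine lintegral_congr_ae ?_
    filter_upwards [ae_expClock_pos, ae_exists_mem_arrivalEvent hT] with e he ⟨m, hm⟩
    rw [tsum_eq_single m, Set.indicator_of_mem hm, hΦ e he m hm]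
    · simp
    · intro n hn
      exact Set.indicator_of_notMem
        (fun h => Set.disjoint_left.1 (pairwise_disjoint_arrivalEvent T hn) h hm) _
  have hI : 0 ≤ ∫ a in (0:ℝ)..T, h a :=
    intervalIntegral.integral_nonneg hT fun a ha => h0 a ha.2
  rw [h1, lintegral_tsum]
  · simp only [lintegral_arrivalEvent hc h0 _ 0 hT, sub_zero]
    -- Summing over the number of arrivals is the exponential series of the integral of `h`; the
    -- factor `exp (-T)` supplies the `-1` in the exponent.
    have h3 := (hasSum_pow_div_factorial (∫ a in (0:ℝ)..T, h a)).mul_left (Real.exp (-T))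
    rw [← Real.exp_add] at h3
    simp only [← mul_div_assoc] at h3
    rw [← ENNReal.ofReal_tsum_of_nonneg (fun n => by positivity) h3.summable, h3.tsum_eq,
      intervalIntegral.integral_sub (hc.intervalIntegrable _ _) (by simp)]
    simp [sub_eq_neg_add]
  · intro m
    refine (Measurable.indicator ?_ (measurableSet_arrivalEvent T 0 m)).aemeasurable
    refine Finset.measurable_prod _ fun k _ => ?_
    exact (hc.measurable.comp ((measurable_arrivalTime k).const_add 0)).ennreal_ofReal

lemma measurable_ncard_setOf {α ι : Type*} [MeasurableSpace α] [Countable ι] {s : α → Set ι}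
    (hs : ∀ i, MeasurableSet {a | i ∈ s a}) : Measurable fun a => (s a).ncard := by
  let _ : MeasurableSpace ι := ⊤
  have h1 : ∀ a, ((s a).encard : ℝ≥0∞) = ∑' i, ({a | i ∈ s a}.indicator 1 a : ℝ≥0∞) := by
    intro a
    rw [← Measure.count_apply (MeasurableSpace.measurableSet_top), Measure.count,
      Measure.sum_apply _ MeasurableSpace.measurableSet_top]
    refine tsum_congr fun i => ?_
    rw [Measure.dirac_apply' _ MeasurableSpace.measurableSet_top]
    by_cases hi : i ∈ s a <;> simp [hi]
  have h2 : Measurable fun a => ((s a).encard : ℝ≥0∞).toReal := by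
    simp only [h1]
    exact (Measurable.tsum fun i => measurable_one.indicator (hs i)).ennreal_toReal
  -- This holds for infinite sets too: both `ncard` and the real part of `∞` have the default value
  -- `0`.
  have h3 : (fun a => (s a).ncard) = fun a => ⌊((s a).encard : ℝ≥0∞).toReal⌋₊ := by
    ext a
    rcases (s a).finite_or_infinite with h | h
    · rw [← h.cast_ncard_eq]; simp
    · simp [h.encard_eq, h.ncard]
  rw [h3]
  exact Nat.measurable_floor.comp h2

lemma measurable_arrivalCount_left (T : ℝ) : Measurable fun e => arrivalCount e T :=
  measurable_ncard_setOf fun k => measurableSet_le (measurable_arrivalTime k) measurable_const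

lemma expClock_arrivalCount {T : ℝ} (hT : 0 ≤ T) (n : ℕ) :
    expClock {e | arrivalCount e T = n} = ENNReal.ofReal (poissonWeight n T) := by
  rw [← expClock_arrivalEvent hT]
  refine measure_congr ?_
  filter_upwards [ae_expClock_pos, ae_exists_mem_arrivalEvent hT] with e he ⟨m, hm⟩
  refine propext ⟨fun h => ?_, fun h => arrivalCount_eq_of_mem_arrivalEvent he h⟩
  have h' : arrivalCount e T = n := h
  rw [arrivalCount_eq_of_mem_arrivalEvent he hm] at h'
  exact h' ▸ hm

lemma expClock_map_arrivalCount {T : ℝ} (hT : 0 ≤ T) :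
    expClock.map (fun e => arrivalCount e T) = poissonMeasure T.toNNReal := by
  refine Measure.ext_of_singleton fun n => ?_
  rw [Measure.map_apply (measurable_arrivalCount_left T) (measurableSet_singleton n), poissonMeasure_singleton]
  have h := expClock_arrivalCount hT n
  rw [Set.preimage, Real.coe_toNNReal T hT, mul_comm (Real.exp _), mul_div_right_comm]
  simp only [Set.mem_singleton_iff]
  rw [h, poissonWeight]

lemma ae_arrivals_finite {T : ℝ} (hT : 0 ≤ T) :
    ∀ᵐ e ∂expClock, {k | arrivalTime e k ≤ T}.Finite := by
  filter_upwards [ae_expClock_pos, ae_exists_mem_arrivalEvent hT] with e he ⟨m, hm⟩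
  exact (Set.finite_lt_nat m).subset fun k hk => (arrivals_eq_of_mem_arrivalEvent he hm k).1 hk

/-- With the later waiting times frozen, an arrival time is a translate of the first waiting time,
whose law has no atoms. -/
lemma ae_arrivalTime_ne (s : ℝ) : ∀ᵐ e ∂expClock, ∀ k, arrivalTime e k ≠ s := by
  refine ae_all_iff.2 fun k => ?_
  have hms : MeasurableSet {e | arrivalTime e k = s} :=
    measurableSet_eq_fun (measurable_arrivalTime k) measurable_const
  have hac : expMeasure 1 ≪ volume := withDensity_absolutelyContinuous _ _
  have hno : NullSingletonClass (expMeasure 1) := ⟨fun x => hac (measure_singleton x)⟩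
  rw [ae_iff]
  simp only [ne_eq, not_not]
  rw [← lintegral_indicator_one hms, lintegral_expClock (measurable_one.indicator hms)]
  rw [lintegral_lintegral_swap]
  · refine (lintegral_congr fun e => ?_).trans lintegral_zero
    have : ∃ c, ∀ v, arrivalTime (seqCons v e) k = v + c := by
      cases k with
      | zero => exact ⟨0, fun v => by simp [arrivalTime_seqCons_zero]⟩
      | succ k => exact ⟨_, fun v => arrivalTime_seqCons_succ v e k⟩
    obtain ⟨c, hc⟩ := this
    have h1 : ∀ v, {e | arrivalTime e k = s}.indicator (1 : (ℕ → ℝ) → ℝ≥0∞) (seqCons v e) =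
        ({s - c} : Set ℝ).indicator 1 v := by
      intro v
      have : seqCons v e ∈ {e | arrivalTime e k = s} ↔ v ∈ ({s - c} : Set ℝ) := by
        simp [hc, eq_sub_iff_add_eq]
      by_cases hv : v ∈ ({s - c} : Set ℝ)
      · rw [Set.indicator_of_mem hv, Set.indicator_of_mem (this.2 hv)]; rfl
      · rw [Set.indicator_of_notMem hv, Set.indicator_of_notMem (mt this.1 hv)]
    simp only [h1]
    rw [lintegral_indicator_one (measurableSet_singleton _), measure_singleton]
  · exact ((measurable_one.indicator hms).comp measurable_seqCons).aemeasurable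

/-! ### The skeleton chain and its first-step decomposition -/

set_option linter.unusedSectionVars false

lemma measurable_seqCons_left {α : Type*} [MeasurableSpace α] (v : α) :
    Measurable (seqCons v : (ℕ → α) → ℕ → α) :=
  measurable_seqCons.comp measurable_prodMk_left

/-- Since `V` is countable, the law of the first coordinates is determined by its atoms, which are
cylinders; uniqueness of projective limits does the rest. -/
lemma measure_ext_of_cylinder {V : Type*} [Countable V] [MeasurableSpace V]
    [DiscreteMeasurableSpace V] {μ ν : Measure (ℕ → V)} [IsFiniteMeasure μ]
    (h : ∀ (n : ℕ) (v : ℕ → V), μ {w | ∀ i ≤ n, w i = v i} = ν {w | ∀ i ≤ n, w i = v i}) :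
    μ = ν := by
  have h1 : ∀ n, ν.map (Preorder.frestrictLe n) = μ.map (Preorder.frestrictLe n) := by
    intro n
    refine Measure.ext_of_singleton fun u => ?_
    -- The index `min i n` extends the finite tuple `u` to a sequence, constant after `n`, as the
    -- hypothesis on cylinders requires.
    have hpre : (Preorder.frestrictLe (π := fun _ : ℕ => V) n) ⁻¹' {u} =
        {w | ∀ i ≤ n, w i = u ⟨min i n, by simp⟩} := by
      ext w
      simp only [Set.mem_preimage, Set.mem_singleton_iff, Set.mem_ofPred_eq]
      constructor
      · rintro rfl i hi
        simp [Preorder.frestrictLe, hi]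
      · intro hw
        ext ⟨i, hi⟩
        have hi' : i ≤ n := Finset.mem_Iic.1 hi
        simpa [hi'] using hw i hi'
    rw [Measure.map_apply (by fun_prop) (measurableSet_singleton u),
      Measure.map_apply (by fun_prop) (measurableSet_singleton u), hpre, h]
  refine IsProjectiveLimit.unique (P := fun I : Finset ℕ => μ.map I.restrict) (fun I => rfl)
    fun I => ?_
  have hI := I.subset_Iic_sup_id
  have hc : (I.restrict : (ℕ → V) → (∀ _ : I, V)) =
      Finset.restrict₂ (π := fun _ => V) hI ∘ Preorder.frestrictLe (I.sup id) := rfl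
  change ν.map _ = μ.map _
  rw [hc, ← Measure.map_map (by fun_prop) (by fun_prop), h1,
    Measure.map_map (by fun_prop) (by fun_prop)]

namespace SymmRates
variable {V : Type*} [Countable V] [MeasurableSpace V] [DiscreteMeasurableSpace V]
  (R : SymmRates V)

instance (x : V) : IsProbabilityMeasure (R.skeletonLaw x) := by
  unfold skeletonLaw; infer_instance

instance (x : V) : IsProbabilityMeasure (R.walkLaw x) := by
  unfold walkLaw; infer_instance

lemma stepPMF_toMeasure_singleton (x y : V) :
    (R.stepPMF x).toMeasure {y} = ENNReal.ofReal (R.stepProb x y) := by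
  rw [PMF.toMeasure_apply_singleton _ _ (measurableSet_singleton y)]; rfl

lemma tsum_ofReal_stepProb (x : V) : ∑' y, ENNReal.ofReal (R.stepProb x y) = 1 := by
  rw [← ENNReal.ofReal_tsum_of_nonneg (R.stepProb_nonneg x) (R.hasSum_stepProb x).summable,
    (R.hasSum_stepProb x).tsum_eq, ENNReal.ofReal_one]

lemma frestrictLe_preimage_singleton (n : ℕ) (v : ℕ → V) :
    (Preorder.frestrictLe (π := fun _ : ℕ => V) n) ⁻¹' {Preorder.frestrictLe n v} =
      {w | ∀ i ≤ n, w i = v i} := by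
  ext w
  simp only [Set.mem_preimage, Set.mem_singleton_iff, Set.mem_ofPred_eq]
  refine ⟨fun h i hi => ?_, fun h => ?_⟩
  · exact congrFun h ⟨i, Finset.mem_Iic.2 hi⟩
  · ext ⟨i, hi⟩
    exact h i (Finset.mem_Iic.1 hi)

lemma skeletonLaw_cylinder_zero (x : V) (v : ℕ → V) :
    R.skeletonLaw x {w | ∀ i ≤ 0, w i = v i} = ({x} : Set V).indicator 1 (v 0) := by
  rw [← frestrictLe_preimage_singleton, ← Measure.map_apply (by fun_prop)
    (measurableSet_singleton _), skeletonLaw, Kernel.traj_map_frestrictLe_apply,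
    Kernel.partialTraj_self, Kernel.id_apply, Measure.dirac_apply' _ (measurableSet_singleton _)]
  have : (fun _ => x : (∀ _ : Finset.Iic 0, V)) ∈
      ({Preorder.frestrictLe (π := fun _ : ℕ => V) 0 v} : Set _) ↔ v 0 ∈ ({x} : Set V) := by
    simp only [Set.mem_singleton_iff]
    refine ⟨fun h => (congrFun h ⟨0, by simp⟩).symm, fun h => ?_⟩
    ext ⟨i, hi⟩
    obtain rfl : i = 0 := by simpa using hi
    exact h.symm
  by_cases h : v 0 ∈ ({x} : Set V)
  · rw [Set.indicator_of_mem h, Set.indicator_of_mem (this.2 h)]; rfl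
  · rw [Set.indicator_of_notMem h, Set.indicator_of_notMem (mt this.1 h)]

/-- The law of the first `n + 2` coordinates is that of the first `n + 1` followed by the step
kernel, and on atoms this composition is a product. -/
lemma skeletonLaw_cylinder_succ (x : V) (v : ℕ → V) (n : ℕ) :
    R.skeletonLaw x {w | ∀ i ≤ n + 1, w i = v i} =
      R.skeletonLaw x {w | ∀ i ≤ n, w i = v i} * ENNReal.ofReal (R.stepProb (v n) (v (n + 1))) := by
  rw [← frestrictLe_preimage_singleton, ← frestrictLe_preimage_singleton,
    ← Measure.map_apply (by fun_prop) (measurableSet_singleton _),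
    ← Measure.map_apply (by fun_prop) (measurableSet_singleton _), skeletonLaw,
    Kernel.traj_map_frestrictLe_apply, Kernel.traj_map_frestrictLe_apply,
    Kernel.partialTraj_succ_of_le (Nat.zero_le n), Kernel.map_apply' _ (by fun_prop) _
      (measurableSet_singleton _)]
  refine (Kernel.comp_apply' _ _ _ (measurable_IicProdIoc (X := fun _ => V)
    (measurableSet_singleton (Preorder.frestrictLe (π := fun _ : ℕ => V) (n + 1) v)))).trans ?_
  have key : ∀ b : (∀ _ : Finset.Iic n, V), (Kernel.id ×ₖ (R.stepKernel n).map
      (MeasurableEquiv.piSingleton (X := fun _ => V) n)) b (IicProdIoc (X := fun _ => V) n (n + 1) ⁻¹'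
        {Preorder.frestrictLe (π := fun _ : ℕ => V) (n + 1) v}) =
      ({Preorder.frestrictLe (π := fun _ : ℕ => V) n v} : Set _).indicator
        (fun _ => ENNReal.ofReal (R.stepProb (v n) (v (n + 1)))) b := by
    intro b
    have hpre : IicProdIoc (X := fun _ => V) n (n + 1) ⁻¹'
        {Preorder.frestrictLe (π := fun _ : ℕ => V) (n + 1) v} =
        {Preorder.frestrictLe (π := fun _ : ℕ => V) n v} ×ˢ {fun _ => v (n + 1)} := by
      ext ⟨b, d⟩
      simp only [Set.mem_preimage, Set.mem_singleton_iff, Set.mem_prod]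
      constructor
      · intro h
        refine ⟨funext fun i => ?_, funext fun i => ?_⟩
        · have hi := Finset.mem_Iic.1 i.2
          have := congrFun h ⟨i, Finset.mem_Iic.2 (hi.trans n.le_succ)⟩
          simpa [IicProdIoc, hi] using this
        · have hi := Finset.mem_Ioc.1 i.2
          have := congrFun h ⟨i, Finset.mem_Iic.2 hi.2⟩
          have hi' : (i : ℕ) = n + 1 := le_antisymm hi.2 hi.1
          obtain ⟨_, _⟩ := i
          subst hi'
          simpa [IicProdIoc] using this
      · rintro ⟨rfl, rfl⟩
        ext i
        by_cases hi : (i : ℕ) ≤ n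
        · simp [IicProdIoc, hi]
        · have hi' : (i : ℕ) = n + 1 := le_antisymm (Finset.mem_Iic.1 i.2) (not_le.1 hi)
          simp [IicProdIoc, hi']
    rw [hpre, Kernel.prod_apply, Measure.prod_prod, Kernel.id_apply,
      Measure.dirac_apply' _ (measurableSet_singleton _),
      Kernel.map_apply' _ (MeasurableEquiv.measurable _) _ (measurableSet_singleton _)]
    have h2 : (MeasurableEquiv.piSingleton (X := fun _ => V) n) ⁻¹' {fun _ => v (n + 1)} =
        {v (n + 1)} := by
      ext y
      simp only [Set.mem_preimage, Set.mem_singleton_iff]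
      refine ⟨fun h => (congrFun h ⟨n + 1, by simp⟩ :), ?_⟩
      rintro rfl
      ext i
      have hi : (i : ℕ) = n + 1 :=
        le_antisymm (Finset.mem_Ioc.1 i.2).2 (Finset.mem_Ioc.1 i.2).1
      obtain ⟨_, _⟩ := i
      subst hi
      rfl
    rw [h2]
    have h3 : R.stepKernel n b {v (n + 1)} =
      ENNReal.ofReal (R.stepProb (b ⟨n, Finset.mem_Iic.2 le_rfl⟩) (v (n + 1))) :=
      R.stepPMF_toMeasure_singleton _ _
    rw [h3]
    by_cases hb : b = Preorder.frestrictLe (π := fun _ : ℕ => V) n v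
    · subst hb
      simp
    · simp [hb]
  simp only [key]
  rw [lintegral_indicator_const (measurableSet_singleton _), mul_comm]

/-- The Ionescu-Tulcea construction appends a last step, whereas recursions for functionals of the
path need the first step to be split off. The two agree on cylinders: `hrec` moves the first
transition to the front by induction on the length. -/
lemma skeletonLaw_eq_sum (x : V) : R.skeletonLaw x = Measure.sum fun z =>
    ENNReal.ofReal (R.stepProb x z) • (R.skeletonLaw z).map (seqCons x) := by
  have hc : Measurable (seqCons x : (ℕ → V) → ℕ → V) :=
    measurable_seqCons_left x
  have hcyl : ∀ (n : ℕ) (v : ℕ → V), MeasurableSet {w : ℕ → V | ∀ i ≤ n, w i = v i} := by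
    intro n v
    rw [← frestrictLe_preimage_singleton]
    exact Preorder.measurable_frestrictLe n (measurableSet_singleton _)
  have hzero : ∀ (z : V) (v : ℕ → V) (n : ℕ), z ≠ v 0 →
      R.skeletonLaw z {w | ∀ i ≤ n, w i = v i} = 0 := by
    intro z v n hz
    refine measure_mono_null (t := {w | ∀ i ≤ 0, w i = v i})
      (fun w hw i hi => hw i (hi.trans (Nat.zero_le n))) ?_
    rw [skeletonLaw_cylinder_zero, Set.indicator_of_notMem (by simpa using hz.symm)]
  have hrec : ∀ (n : ℕ) (v : ℕ → V), R.skeletonLaw (v 0) {w | ∀ i ≤ n + 1, w i = v i} =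
      ENNReal.ofReal (R.stepProb (v 0) (v 1)) *
        R.skeletonLaw (v 1) {w | ∀ i ≤ n, w i = v (i + 1)} := by
    intro n v
    induction n with
    | zero =>
      rw [skeletonLaw_cylinder_succ, skeletonLaw_cylinder_zero,
        R.skeletonLaw_cylinder_zero (v 1) fun i => v (i + 1)]
      simp
    | succ n ih =>
      rw [skeletonLaw_cylinder_succ, ih, R.skeletonLaw_cylinder_succ (v 1) fun i => v (i + 1),
        mul_assoc]
  refine measure_ext_of_cylinder fun n v => ?_
  rw [Measure.sum_apply _ (hcyl n v)]
  simp only [Measure.smul_apply, smul_eq_mul, Measure.map_apply hc (hcyl n v)]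
  by_cases hx : x = v 0
  · subst hx
    cases n with
    | zero =>
      have : (seqCons (v 0) ⁻¹' {w : ℕ → V | ∀ i ≤ 0, w i = v i}) = Set.univ := by
        ext w; simp
      simp only [this, measure_univ, mul_one, tsum_ofReal_stepProb]
      rw [skeletonLaw_cylinder_zero]; simp
    | succ n =>
      have : (seqCons (v 0) ⁻¹' {w : ℕ → V | ∀ i ≤ n + 1, w i = v i}) =
          {w | ∀ i ≤ n, w i = v (i + 1)} := by
        ext w
        simp only [Set.mem_preimage, Set.mem_ofPred_eq]
        refine ⟨fun h i hi => h (i + 1) (Nat.succ_le_succ hi), fun h i hi => ?_⟩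
        cases i with
        | zero => rfl
        | succ i => exact h i (Nat.le_of_succ_le_succ hi)
      rw [this, hrec, tsum_eq_single (v 1)]
      intro z hz
      rw [hzero z (fun i => v (i + 1)) n hz, mul_zero]
  · rw [hzero x v n hx]
    have : (seqCons x ⁻¹' {w : ℕ → V | ∀ i ≤ n, w i = v i}) = ∅ := by
      ext w
      simp only [Set.mem_preimage, Set.mem_ofPred_eq, Set.mem_empty_iff_false, iff_false]
      exact fun h => hx (h 0 (Nat.zero_le n))
    simp [this]

lemma lintegral_skeletonLaw (x : V) {G : (ℕ → V) → ℝ≥0∞} (hG : Measurable G) :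
    ∫⁻ w, G w ∂(R.skeletonLaw x) =
      ∑' z, ENNReal.ofReal (R.stepProb x z) * ∫⁻ w, G (seqCons x w) ∂(R.skeletonLaw z) := by
  conv_lhs => rw [skeletonLaw_eq_sum]
  rw [lintegral_sum_measure]
  refine tsum_congr fun z => ?_
  rw [lintegral_smul_measure, lintegral_map hG (measurable_seqCons_left x),
    smul_eq_mul]

/-! ### Markov property, Green function and infinitely many visits -/

/-- The `n`-step transition probabilities of the skeleton chain. -/
noncomputable def stepPow (n : ℕ) (x y : V) : ℝ≥0∞ := R.skeletonLaw x {w | w n = y}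

lemma measurableSet_eval_eq (n : ℕ) (y : V) : MeasurableSet {w : ℕ → V | w n = y} :=
  measurableSet_eq_fun (measurable_pi_apply n) measurable_const

lemma measurableSet_eval_eq_shift {y : V} (n : ℕ) {A : Set (ℕ → V)} (hA : MeasurableSet A) :
    MeasurableSet {w : ℕ → V | w n = y ∧ (fun k => w (n + k)) ∈ A} :=
  (measurableSet_eval_eq n y).inter
    ((measurable_pi_lambda _ fun k => measurable_pi_apply (n + k)) hA)

lemma ae_skeletonLaw_zero (x : V) : ∀ᵐ w ∂(R.skeletonLaw x), w 0 = x := by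
  have h : R.skeletonLaw x {w | w 0 = x} = 1 := by
    have := R.skeletonLaw_cylinder_zero x (fun _ => x)
    simpa using this
  have := (prob_compl_eq_zero_iff (measurableSet_eval_eq 0 x)).2 h
  rwa [ae_iff]

lemma stepPow_zero (x y : V) : R.stepPow 0 x y = ({x} : Set V).indicator 1 y := by
  have := R.skeletonLaw_cylinder_zero x (fun _ => y)
  simpa [stepPow] using this

/-- The Markov property at a fixed time, by induction on `n` through the first-step decomposition.
-/
lemma skeletonLaw_shift (x y : V) (n : ℕ) {A : Set (ℕ → V)} (hA : MeasurableSet A) :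
    R.skeletonLaw x {w | w n = y ∧ (fun k => w (n + k)) ∈ A} =
      R.stepPow n x y * R.skeletonLaw y A := by
  have hm := fun n => measurableSet_eval_eq_shift (y := y) n hA
  induction n generalizing x with
  | zero =>
    simp only [zero_add, stepPow_zero]
    by_cases hy : y = x
    · subst hy
      simp only [Set.mem_singleton_iff, Set.indicator_of_mem, Pi.one_apply, one_mul]
      refine measure_congr ?_
      filter_upwards [R.ae_skeletonLaw_zero y] with w hw
      exact propext ⟨fun h => h.2, fun h => ⟨hw, h⟩⟩
    · rw [Set.indicator_of_notMem (by simpa using hy), zero_mul]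
      refine measure_mono_null (t := {w | ¬ w 0 = x}) (fun w hw h => hy ?_)
        (ae_iff.1 (R.ae_skeletonLaw_zero x))
      exact hw.1.symm.trans h
  | succ n ih =>
    have h : ∀ {B : Set (ℕ → V)}, MeasurableSet B → R.skeletonLaw x B =
        ∑' z, ENNReal.ofReal (R.stepProb x z) * R.skeletonLaw z (seqCons x ⁻¹' B) := by
      intro B hB
      rw [← lintegral_indicator_one hB, lintegral_skeletonLaw _ _ (measurable_one.indicator hB)]
      refine tsum_congr fun z => ?_
      have : ∀ w, B.indicator (1 : (ℕ → V) → ℝ≥0∞) (seqCons x w) =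
        (seqCons x ⁻¹' B).indicator 1 w := fun w => rfl
      simp only [this]
      rw [lintegral_indicator_one ((measurable_seqCons_left x) hB)]
    rw [h (hm (n + 1)), stepPow, h (measurableSet_eval_eq (n + 1) y), ← ENNReal.tsum_mul_right]
    refine tsum_congr fun z => ?_
    have e1 : seqCons x ⁻¹' {w : ℕ → V | w (n + 1) = y ∧ (fun k => w (n + 1 + k)) ∈ A} =
        {w | w n = y ∧ (fun k => w (n + k)) ∈ A} := by
      ext w
      simp [add_right_comm n 1]
    rw [e1, ih z, mul_assoc]
    rfl


lemma stepPow_add (m n : ℕ) (x y : V) :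
    R.stepPow (m + n) x y = ∑' z, R.stepPow m x z * R.stepPow n z y := by
  have h : {w : ℕ → V | w (m + n) = y} =
      ⋃ z, {w | w m = z ∧ (fun k => w (m + k)) ∈ {w' : ℕ → V | w' n = y}} := by
    ext w; simp
  rw [stepPow, h, measure_iUnion]
  · exact tsum_congr fun z => R.skeletonLaw_shift x z m (measurableSet_eval_eq n y)
  · intro z z' hz
    exact Set.disjoint_left.2 fun w hw hw' => hz (hw.1.symm.trans hw'.1)
  · exact fun z => measurableSet_eval_eq_shift m (measurableSet_eval_eq n y)

lemma stepPow_one (x y : V) : R.stepPow 1 x y = ENNReal.ofReal (R.stepProb x y) := by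
  have h : {w : ℕ → V | w 1 = y}.indicator (1 : (ℕ → V) → ℝ≥0∞) =
    fun w => {w : ℕ → V | w 1 = y}.indicator 1 w := rfl
  rw [stepPow, ← lintegral_indicator_one (measurableSet_eval_eq 1 y),
    lintegral_skeletonLaw _ _ (measurable_one.indicator (measurableSet_eval_eq 1 y)),
    tsum_eq_single y]
  · have : ∀ᵐ w ∂(R.skeletonLaw y),
        {w : ℕ → V | w 1 = y}.indicator (1 : (ℕ → V) → ℝ≥0∞) (seqCons x w) = 1 := by
      filter_upwards [R.ae_skeletonLaw_zero y] with w hw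
      exact Set.indicator_of_mem (by simpa using hw) _
    rw [lintegral_congr_ae this]; simp
  · intro z hz
    have : ∀ᵐ w ∂(R.skeletonLaw z),
        {w : ℕ → V | w 1 = y}.indicator (1 : (ℕ → V) → ℝ≥0∞) (seqCons x w) = 0 := by
      filter_upwards [R.ae_skeletonLaw_zero z] with w hw
      exact Set.indicator_of_notMem (by simpa [hw] using hz) _
    rw [lintegral_congr_ae this]; simp

lemma stepProb_symm (x y : V) : R.stepProb x y = R.stepProb y x := by
  unfold stepProb
  rw [R.symm x y]
  by_cases h : x = y
  · rw [h]
  · simp [kron, h, Ne.symm h]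

lemma stepPow_symm (n : ℕ) (x y : V) : R.stepPow n x y = R.stepPow n y x := by
  induction n generalizing x y with
  | zero =>
    rw [stepPow_zero, stepPow_zero]
    by_cases h : x = y
    · rw [h]
    · simp [h, Ne.symm h]
  | succ n ih =>
    rw [stepPow_add, add_comm n 1, stepPow_add]
    refine tsum_congr fun z => ?_
    rw [ih x z, stepPow_one, stepPow_one, R.stepProb_symm z y, mul_comm]

/-- The exponent provided by irreducibility works, because `stepProb` dominates `p / clockRate`. -/
lemma exists_stepPow_pos (x y : V) : ∃ n, 0 < R.stepPow n x y := by
  obtain ⟨n, hn⟩ := R.irreducible x y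
  refine ⟨n, ?_⟩
  induction n generalizing x with
  | zero =>
    rw [stepPow_zero]
    by_contra h
    have h' : y ∉ ({x} : Set V) := fun hy => h (by rw [Set.indicator_of_mem hy]; simp)
    have h0 : nStepRate R.p 0 x y = 0 := by
      simp only [nStepRate]
      exact Set.indicator_of_notMem h' _
    exact lt_irrefl _ (h0 ▸ hn)
  | succ n ih =>
    rw [nStepRate] at hn
    obtain ⟨z, hz⟩ : ∃ z, R.p x z * nStepRate R.p n z y ≠ 0 := by
      by_contra! h
      simp [h] at hn
    have hnn : ∀ n z, 0 ≤ nStepRate R.p n z y := by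
      intro n
      induction n with
      | zero => exact fun z => Set.indicator_nonneg (fun _ _ => zero_le_one) _
      | succ n ih => exact fun z => tsum_nonneg fun u => mul_nonneg (R.nonneg z u) (ih u)
    have h1 : 0 < R.p x z := (R.nonneg x z).lt_of_ne' (left_ne_zero_of_mul hz)
    have h2 : 0 < nStepRate R.p n z y := (hnn n z).lt_of_ne' (right_ne_zero_of_mul hz)
    rw [add_comm n 1, stepPow_add]
    refine lt_of_lt_of_le ?_ (ENNReal.le_tsum z)
    rw [stepPow_one]
    refine ENNReal.mul_pos (ENNReal.ofReal_pos.2 ?_).ne' (ih z h2).ne'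
    have hc := R.clockRate_pos x
    have h3 : R.total x / R.clockRate ≤ 1 := (div_le_one hc).2 (R.total_lt_clockRate x).le
    have h4 : 0 ≤ kron x z := Set.indicator_nonneg (fun _ _ => zero_le_one) _
    exact add_pos_of_pos_of_nonneg (div_pos h1 hc) (mul_nonneg h4 (by linarith))

/-- Expected number of visits of the skeleton chain to `y` from `x`. -/
noncomputable def green (x y : V) : ℝ≥0∞ := ∑' n, R.stepPow n x y

/-- Going from `x'` to `x` in `a` steps and from `y` to `y'` in `b` steps has positive probability,
so `green x' y'` is at least a positive multiple of `green x y`. -/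
lemma green_eq_top_of_green_eq_top {x y : V} (h : R.green x y = ∞) (x' y' : V) :
    R.green x' y' = ∞ := by
  obtain ⟨a, ha⟩ := R.exists_stepPow_pos x' x
  obtain ⟨b, hb⟩ := R.exists_stepPow_pos y y'
  have h1 : ∀ n, R.stepPow a x' x * R.stepPow b y y' * R.stepPow n x y ≤
      R.stepPow (a + n + b) x' y' := by
    intro n
    calc _ = (R.stepPow a x' x * R.stepPow n x y) * R.stepPow b y y' := by ring
      _ ≤ R.stepPow (a + n) x' y * R.stepPow b y y' := by
        gcongr
        rw [stepPow_add]
        exact ENNReal.le_tsum (f := fun z => R.stepPow a x' z * R.stepPow n z y) x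
      _ ≤ _ := by
        rw [stepPow_add (n := b)]
        exact ENNReal.le_tsum (f := fun z => R.stepPow (a + n) x' z * R.stepPow b z y') y
  refine top_le_iff.1 ?_
  calc ∞ = R.stepPow a x' x * R.stepPow b y y' * R.green x y := by
        rw [h, ENNReal.mul_top (mul_ne_zero ha.ne' hb.ne')]
    _ = ∑' n, R.stepPow a x' x * R.stepPow b y y' * R.stepPow n x y := by
        rw [green, ENNReal.tsum_mul_left]
    _ ≤ ∑' n, R.stepPow (a + n + b) x' y' := ENNReal.tsum_le_tsum h1
    _ ≤ R.green x' y' := by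
        refine ENNReal.tsum_comp_le_tsum_of_injective (f := fun n => a + n + b) ?_
          (fun n => R.stepPow n x' y')
        intro m n hmn
        simp only at hmn
        omega

/-- Borel–Cantelli: the Green function is the sum of the probabilities of the visits. -/
lemma ae_finite_visits {x : V} (h : R.green x x ≠ ∞) :
    ∀ᵐ w ∂(R.skeletonLaw x), {n | w n = x}.Finite :=
  ae_finite_setOfPred_mem h

/-- Last-visit decomposition. With `A` the event of no return to `x`, the events `B n` that the last
visit occurs at time `n` are disjoint with probabilities `stepPow n x x * P(A)`. Hence `green x x *
P(A) ≤ 1`, which forces `P(A) = 0`, and then almost surely there is no last visit. -/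
lemma ae_infinite_visits {x : V} (h : R.green x x = ∞) :
    ∀ᵐ w ∂(R.skeletonLaw x), {n | w n = x}.Infinite := by
  set A : Set (ℕ → V) := {w | ∀ k, 0 < k → w k ≠ x} with hA
  have hAm : MeasurableSet A := by
    have : A = ⋂ k, ⋂ _ : 0 < k, {w : ℕ → V | w k = x}ᶜ := by ext w; simp [hA]
    rw [this]
    exact .iInter fun k => .iInter fun _ => (measurableSet_eval_eq k x).compl
  set B : ℕ → Set (ℕ → V) := fun n => {w | w n = x ∧ (fun k => w (n + k)) ∈ A} with hB
  have hBm : ∀ n, MeasurableSet (B n) := fun n => measurableSet_eval_eq_shift n hAm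
  have hdisj : Pairwise (Function.onFun Disjoint B) := by
    have key : ∀ m n w, m < n → w ∈ B m → w ∈ B n → False := by
      intro m n w hmn hm hn
      refine hm.2 (n - m) (by omega) ?_
      have : m + (n - m) = n := by omega
      simp only [this]
      exact hn.1
    intro m n hmn
    refine Set.disjoint_left.2 fun w hw hw' => ?_
    rcases lt_or_gt_of_ne hmn with h | h
    · exact key m n w h hw hw'
    · exact key n m w h hw' hw
  have hsum : R.green x x * R.skeletonLaw x A ≤ 1 := by
    rw [green, ← ENNReal.tsum_mul_right]
    calc _ = ∑' n, R.skeletonLaw x (B n) :=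
          tsum_congr fun n => (R.skeletonLaw_shift x x n hAm).symm
      _ = R.skeletonLaw x (⋃ n, B n) := (measure_iUnion hdisj hBm).symm
      _ ≤ 1 := prob_le_one
  have hA0 : R.skeletonLaw x A = 0 := by
    by_contra h0
    rw [h, ENNReal.top_mul h0] at hsum
    exact absurd hsum (by simp)
  have hB0 : ∀ n, ∀ᵐ w ∂(R.skeletonLaw x), w ∉ B n := by
    intro n
    refine measure_eq_zero_iff_ae_notMem.1 ?_
    rw [hB, R.skeletonLaw_shift x x n hAm, hA0, mul_zero]
  filter_upwards [ae_all_iff.2 hB0, R.ae_skeletonLaw_zero x] with w hw hw0 hfin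
  obtain ⟨n, hn, hmax⟩ := hfin.exists_maximal ⟨0, hw0⟩
  refine hw n ⟨hn, fun k hk hkx => ?_⟩
  have := hmax (show n + k ∈ {n | w n = x} from hkx) (Nat.le_add_right n k)
  omega

/-! ### The continuous-time walk and its recurrence -/

lemma measurable_walk : Measurable fun q : ℝ × WalkSample V => R.walk q.1 q.2 := by
  have h1 : Measurable fun q : ℕ × (ℕ → V) => q.2 q.1 :=
    measurable_from_prod_countable_right fun n => measurable_pi_apply n
  have h2 : Measurable fun q : ℝ × WalkSample V => arrivalCount q.2.1 (R.clockRate * q.1) :=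
    measurable_ncard_setOf fun k => measurableSet_le
      ((measurable_arrivalTime k).comp (measurable_fst.comp measurable_snd))
      (measurable_fst.const_mul _)
  exact h1.comp (h2.prodMk (measurable_snd.comp measurable_snd))

lemma measurable_walk_right (t : ℝ) : Measurable (R.walk t) :=
  R.measurable_walk.comp measurable_prodMk_left

/-- Uniformisation: clock and skeleton are independent, and the number of ticks up to time `t` is
Poisson with parameter `clockRate * t`. -/
lemma lintegral_walk (x : V) {t : ℝ} (ht : 0 ≤ t) (φ : V → ℝ≥0∞) :
    ∫⁻ w, φ (R.walk t w) ∂(R.walkLaw x) = ∑' n, ENNReal.ofReal (poissonWeight n (R.clockRate * t)) *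
      ∑' y, R.stepPow n x y * φ y := by
  have hT : 0 ≤ R.clockRate * t := mul_nonneg (R.clockRate_pos x).le ht
  have h1 : ∀ n, ∫⁻ w, φ (w n) ∂(R.skeletonLaw x) = ∑' y, R.stepPow n x y * φ y := by
    intro n
    rw [← lintegral_map (f := φ) (g := fun w : ℕ → V => w n) .of_discrete (measurable_pi_apply n),
      lintegral_countable']
    refine tsum_congr fun y => ?_
    rw [Measure.map_apply (measurable_pi_apply n) (measurableSet_singleton y), mul_comm]
    rfl
  have h2 : ∀ e : ℕ → ℝ, ∫⁻ w, φ (w (arrivalCount e (R.clockRate * t))) ∂(R.skeletonLaw x) =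
      (fun n => ∑' y, R.stepPow n x y * φ y) (arrivalCount e (R.clockRate * t)) :=
    fun e => h1 _
  have h3 : ∀ n, expClock.map (fun e => arrivalCount e (R.clockRate * t)) {n} =
      ENNReal.ofReal (poissonWeight n (R.clockRate * t)) := fun n => by
    rw [Measure.map_apply (measurable_arrivalCount_left _) (measurableSet_singleton n)]
    exact expClock_arrivalCount hT n
  rw [walkLaw]
  refine (lintegral_prod _
    ((Measurable.of_discrete (f := φ)).comp (R.measurable_walk_right t)).aemeasurable).trans ?_
  simp only [Function.comp_apply]
  simp only [walk, h2]
  rw [← lintegral_map (f := fun n => ∑' y, R.stepPow n x y * φ y) .of_discrete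
    (measurable_arrivalCount_left _), lintegral_countable']
  exact tsum_congr fun n => by rw [h3, mul_comm]

lemma arrivalCount_arrivalTime {e : ℕ → ℝ} (he : ∀ j, 0 < e j) (n : ℕ) :
    arrivalCount e (arrivalTime e n) = n + 1 := by
  have : {k | arrivalTime e k ≤ arrivalTime e n} = (Finset.range (n + 1) : Set ℕ) := by
    ext k
    simp [(arrivalTime_strictMono he).le_iff_le]
  rw [arrivalCount, this, Set.ncard_coe_finset, Finset.card_range]

lemma ae_clock : ∀ᵐ e ∂expClock, (∀ j, 0 < e j) ∧ ∀ T, {k | arrivalTime e k ≤ T}.Finite := by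
  filter_upwards [ae_expClock_pos, ae_all_iff.2 fun N : ℕ => ae_arrivals_finite N.cast_nonneg]
    with e he hf
  refine ⟨he, fun T => ?_⟩
  obtain ⟨N, hN⟩ := exists_nat_ge T
  exact (hf N).subset fun k hk => le_trans hk hN

lemma not_bddAbove_visits {x : V} {w : WalkSample V} (he : ∀ j, 0 < w.1 j)
    (hf : ∀ T, {k | arrivalTime w.1 k ≤ T}.Finite) (hw : {n | w.2 n = x}.Infinite) :
    ¬ BddAbove {t : ℝ | 0 ≤ t ∧ R.walk t w = x} := by
  have hc := R.clockRate_pos x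
  rintro ⟨M, hM⟩
  obtain ⟨K, hK⟩ := (hf (R.clockRate * M)).bddAbove
  -- Arrivals are numbered from `0`, so at the `m`-th arrival the count is `m + 1`. The visit with
  -- index `n = m + 1` therefore happens at time `arrivalTime m / clockRate`, and `n > K + 1` is
  -- what leaves `m > K`.
  obtain ⟨n, hn, hnK⟩ := hw.exists_gt (K + 1)
  obtain ⟨m, rfl⟩ : ∃ m, n = m + 1 := ⟨n - 1, by omega⟩
  have hpos : 0 < arrivalTime w.1 m := Finset.sum_pos (fun j _ => he j) (by simp)
  have h1 : arrivalTime w.1 m / R.clockRate ∈ {t : ℝ | 0 ≤ t ∧ R.walk t w = x} := by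
    refine ⟨by positivity, ?_⟩
    rw [walk, mul_div_cancel₀ _ hc.ne', arrivalCount_arrivalTime he]
    exact hn
  have h2 := hM h1
  rw [div_le_iff₀' hc] at h2
  have := hK h2
  omega

lemma bddAbove_visits {x : V} {w : WalkSample V} (he : ∀ j, 0 < w.1 j)
    (hf : ∀ T, {k | arrivalTime w.1 k ≤ T}.Finite) (hw : {n | w.2 n = x}.Finite) :
    BddAbove {t : ℝ | 0 ≤ t ∧ R.walk t w = x} := by
  have hc := R.clockRate_pos x
  obtain ⟨K, hK⟩ := hw.bddAbove
  refine ⟨arrivalTime w.1 K / R.clockRate, fun t ht => ?_⟩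
  have h1 : arrivalCount w.1 (R.clockRate * t) ≤ K := hK ht.2
  rw [le_div_iff₀' hc]
  by_contra h
  have h2 : (Finset.range (K + 1) : Set ℕ) ⊆ {k | arrivalTime w.1 k ≤ R.clockRate * t} := by
    intro k hk
    refine le_trans ((arrivalTime_strictMono he).monotone ?_) (not_le.1 h).le
    simpa [Nat.lt_succ_iff] using hk
  have h3 := Set.ncard_le_ncard h2 (hf _)
  rw [Set.ncard_coe_finset, Finset.card_range] at h3
  exact absurd (h3.trans h1) (by simp)

lemma ae_walkLaw {x : V} {P : (ℕ → V) → Prop} (hP : ∀ᵐ w ∂(R.skeletonLaw x), P w) :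
    ∀ᵐ w ∂(R.walkLaw x), (∀ j, 0 < w.1 j) ∧ (∀ T, {k | arrivalTime w.1 k ≤ T}.Finite) ∧ P w.2 := by
  have h1 := (Measure.quasiMeasurePreserving_fst (μ := expClock) (ν := R.skeletonLaw x)).ae ae_clock
  have h2 := (Measure.quasiMeasurePreserving_snd (μ := expClock) (ν := R.skeletonLaw x)).ae hP
  filter_upwards [h1, h2] with w hw hw'
  exact ⟨hw.1, hw.2, hw'⟩

/-- Almost surely the ticks are positive and locally finite, so the set of visit times is unbounded
exactly when the skeleton visits infinitely often. Because infinity of the Green function does not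
depend on the pair, any single pair `x`, `y` decides recurrence. -/
lemma isRecurrent_iff_green (x y : V) : R.IsRecurrent ↔ R.green x y = ∞ := by
  constructor
  · intro h
    by_contra hg
    have hg' : R.green x x ≠ ∞ := fun h' => hg (R.green_eq_top_of_green_eq_top h' x y)
    have := (h x).and (R.ae_walkLaw (R.ae_finite_visits hg'))
    obtain ⟨w, hw, he, hf, hfin⟩ := this.exists
    exact hw (R.bddAbove_visits he hf hfin)
  · intro h z
    filter_upwards [R.ae_walkLaw (R.ae_infinite_visits (R.green_eq_top_of_green_eq_top h z z))]
      with w hw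
    exact R.not_bddAbove_visits hw.1 hw.2.1 hw.2.2

lemma green_ne_top_of_isTransient (h : R.IsTransient) (x y : V) : R.green x y ≠ ∞ := by
  intro hg
  obtain ⟨w, hw, hw'⟩ := ((h x).and ((R.isRecurrent_iff_green x y).2 hg x)).exists
  exact hw' hw

end SymmRates

/-! ### Poisson mixtures of a sequence -/

/-- The exponential generating series of `a` converges everywhere. -/
def EntireSeq (a : ℕ → ℝ) : Prop := ∀ s, 0 ≤ s → Summable fun n => s ^ n / n.factorial * |a n|

/-- The mean of `a` under the Poisson weights with parameter `s`. -/
noncomputable def poissonMix (a : ℕ → ℝ) (s : ℝ) : ℝ := ∑' n, poissonWeight n s * a n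

lemma EntireSeq.succ {a : ℕ → ℝ} (ha : EntireSeq a) : EntireSeq fun n => a (n + 1) := by
  intro s hs
  -- The shift costs a factor `n + 1 ≤ 2 ^ (n + 1)`, absorbed by doubling the argument; `s + 1 ≥ 1`
  -- allows the exponent to be raised by one.
  have h1 := (summable_nat_add_iff 1).2 (ha (2 * (s + 1)) (by positivity))
  refine Summable.of_nonneg_of_le (fun n => by positivity) (fun n => ?_) h1
  refine mul_le_mul_of_nonneg_right ?_ (abs_nonneg _)
  rw [div_le_div_iff₀ (by positivity) (by positivity), Nat.factorial_succ]
  have h2 : ((n + 1 : ℕ) : ℝ) ≤ 2 ^ (n + 1) := by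
    exact_mod_cast (Nat.lt_two_pow_self (n := n + 1)).le
  have h3 : s ^ n ≤ (s + 1) ^ (n + 1) := by
    calc s ^ n ≤ (s + 1) ^ n := by gcongr; linarith
      _ ≤ (s + 1) ^ (n + 1) := pow_le_pow_right₀ (by linarith) n.le_succ
  push_cast at h2 ⊢
  calc s ^ n * (((n : ℝ) + 1) * n.factorial) ≤
      (s + 1) ^ (n + 1) * (2 ^ (n + 1) * n.factorial) := by gcongr
    _ = (2 * (s + 1)) ^ (n + 1) * n.factorial := by rw [mul_pow]; ring

lemma EntireSeq.summable {a : ℕ → ℝ} (ha : EntireSeq a) (s : ℝ) :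
    Summable fun n => s ^ n / n.factorial * a n := by
  refine Summable.of_norm ((ha |s| (abs_nonneg s)).congr fun n => ?_)
  rw [norm_mul, norm_div, norm_pow, Real.norm_natCast, Real.norm_eq_abs, Real.norm_eq_abs]

lemma EntireSeq.summable_poissonWeight {a : ℕ → ℝ} (ha : EntireSeq a) (s : ℝ) :
    Summable fun n => poissonWeight n s * a n :=
  ((ha.summable s).mul_right (Real.exp (-s))).congr fun n => by rw [poissonWeight]; ring

lemma poissonMix_eq (a : ℕ → ℝ) (s : ℝ) :
    poissonMix a s = (∑' n, s ^ n / n.factorial * a n) * Real.exp (-s) := by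
  rw [poissonMix, ← tsum_mul_right]
  exact tsum_congr fun n => by rw [poissonWeight]; ring

lemma poissonMix_zero (a : ℕ → ℝ) : poissonMix a 0 = a 0 := by
  rw [poissonMix, tsum_eq_single 0]
  · simp [poissonWeight]
  · intro n hn; simp [poissonWeight, hn]

/-- Termwise differentiation on the ball of radius `|s| + 1`, dominated by the series of the shifted
sequence. -/
lemma EntireSeq.hasDerivAt_series {a : ℕ → ℝ} (ha : EntireSeq a) (s : ℝ) :
    HasDerivAt (fun s => ∑' n : ℕ, s ^ n / n.factorial * a n)
      (∑' n : ℕ, s ^ n / n.factorial * a (n + 1)) s := by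
  set r := |s| + 1
  have hr : 0 ≤ r := by positivity
  have hu : Summable fun n : ℕ => (n : ℝ) * r ^ (n - 1) / n.factorial * |a n| := by
    refine (summable_nat_add_iff 1).1 ((ha.succ r hr).congr fun n => ?_)
    rw [Nat.factorial_succ]
    push_cast
    field_simp
  have hb : ∀ (n : ℕ) (y : ℝ), |y| ≤ r → ‖(n : ℝ) * y ^ (n - 1) / n.factorial * a n‖ ≤
      (n : ℝ) * r ^ (n - 1) / n.factorial * |a n| := by
    intro n y hy
    rw [norm_mul, norm_div, norm_mul, norm_pow, Real.norm_natCast, Real.norm_natCast,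
      Real.norm_eq_abs, Real.norm_eq_abs]
    gcongr
  have h := hasDerivAt_tsum_of_isPreconnected
    (g := fun (n : ℕ) (s : ℝ) => s ^ n / n.factorial * a n)
    (g' := fun (n : ℕ) (s : ℝ) => (n : ℝ) * s ^ (n - 1) / n.factorial * a n)
    (t := Metric.ball 0 r) (y₀ := 0) (y := s) hu Metric.isOpen_ball
    (convex_ball _ _).isPreconnected
    (fun n y _ => ((hasDerivAt_pow n y).div_const _).mul_const _) ?_
    (Metric.mem_ball_self (by positivity)) (ha.summable 0) (by simp [r])
  · refine h.congr_deriv ?_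
    rw [(Summable.of_norm_bounded hu fun n => hb n s (by simp [r])).tsum_eq_zero_add]
    simp only [Nat.cast_zero, zero_mul, zero_div, zero_add]
    refine tsum_congr fun n => ?_
    rw [Nat.factorial_succ]
    push_cast
    field_simp
  · exact fun n y hy => hb n y (by simpa using (mem_ball_zero_iff.1 hy).le)

/-- The derivative of a Poisson mixture is the mixture of forward differences. Applied to `n`-step
means this becomes Kolmogorov's equation. -/
lemma EntireSeq.hasDerivAt {a : ℕ → ℝ} (ha : EntireSeq a) (s : ℝ) :
    HasDerivAt (poissonMix a) (poissonMix (fun n => a (n + 1)) s - poissonMix a s) s := by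
  have h1 := (ha.hasDerivAt_series s).mul ((hasDerivAt_neg s).exp)
  have h2 : poissonMix a = fun s => (∑' n : ℕ, s ^ n / n.factorial * a n) * Real.exp (-s) :=
    funext fun s => poissonMix_eq a s
  rw [poissonMix_eq _ s, h2]
  refine h1.congr_deriv ?_
  simp only
  ring

lemma EntireSeq.continuous {a : ℕ → ℝ} (ha : EntireSeq a) : Continuous (poissonMix a) :=
  continuous_iff_continuousAt.2 fun s => (ha.hasDerivAt s).continuousAt

/-! ### The semigroup and Kolmogorov's equation -/

namespace SymmRates
variable {V : Type*} (R : SymmRates V)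

/-- The relation `L = clockRate * (P - I)`. The diagonal correction in `stepProb` multiplies `φ x -
φ x` and disappears; so does `p x x`. -/
lemma hasSum_genRW {φ : V → ℝ} {x : V} {S : ℝ} (h : HasSum (fun y => R.stepProb x y * φ y) S) :
    HasSum (fun y => R.p x y * (φ y - φ x)) (R.clockRate * (S - φ x)) := by
  have h1 := (h.sub ((R.hasSum_stepProb x).mul_right (φ x))).mul_left R.clockRate
  rw [one_mul] at h1
  refine h1.congr_fun fun y => ?_
  have hc := (R.clockRate_pos x).ne'
  have h2 : kron x y * (φ y - φ x) = 0 := by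
    by_cases hy : y = x
    · simp [hy]
    · simp [kron, hy]
  have h3 : R.clockRate * (R.stepProb x y * φ y - R.stepProb x y * φ x) =
      R.p x y * (φ y - φ x) * (R.clockRate / R.clockRate) +
        R.clockRate * (1 - R.total x / R.clockRate) * (kron x y * (φ y - φ x)) := by
    rw [stepProb]; ring
  rw [h3, h2, div_self hc]; ring

variable [Countable V] [MeasurableSpace V] [DiscreteMeasurableSpace V]

/-- Mean of `ρ` after `n` steps of the skeleton chain, as an extended real. -/
noncomputable def stepLMean (ρ : V → ℝ) (n : ℕ) (x : V) : ℝ≥0∞ :=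
  ∑' y, R.stepPow n x y * ENNReal.ofReal (ρ y)

/-- Mean of `ρ` after `n` steps of the skeleton chain. -/
noncomputable def stepMean (ρ : V → ℝ) (n : ℕ) (x : V) : ℝ := (R.stepLMean ρ n x).toReal

/-- The semigroup of the walk, `E_x ρ(X_t)`. -/
noncomputable def mean (ρ : V → ℝ) (t : ℝ) (x : V) : ℝ := ∫ w, ρ (R.walk t w) ∂(R.walkLaw x)

lemma stepLMean_zero (ρ : V → ℝ) (x : V) : R.stepLMean ρ 0 x = ENNReal.ofReal (ρ x) := by
  rw [stepLMean, tsum_eq_single x]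
  · simp [stepPow_zero]
  · intro y hy; simp [stepPow_zero, hy]

lemma stepLMean_succ (ρ : V → ℝ) (n : ℕ) (x : V) :
    R.stepLMean ρ (n + 1) x = ∑' z, ENNReal.ofReal (R.stepProb x z) * R.stepLMean ρ n z := by
  simp only [stepLMean, add_comm n 1, stepPow_add, ← ENNReal.tsum_mul_right, ← ENNReal.tsum_mul_left,
    stepPow_one]
  rw [ENNReal.tsum_comm]
  simp only [mul_assoc]

namespace Admissible
variable {R} {ρ : V → ℝ}

lemma lintegral_eq (h : R.Admissible ρ) {t : ℝ} (ht : 0 ≤ t) (x : V) :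
    ENNReal.ofReal (R.mean ρ t x) =
      ∑' n, ENNReal.ofReal (poissonWeight n (R.clockRate * t)) * R.stepLMean ρ n x := by
  rw [mean, ofReal_integral_eq_lintegral_ofReal (h.2 t ht x) (ae_of_all _ fun w => h.1 _)]
  exact R.lintegral_walk x ht fun y => ENNReal.ofReal (ρ y)

/-- At time `1` every Poisson weight is strictly positive, so one infinite term would make `E_x
ρ(X_1)` infinite. -/
lemma stepLMean_ne_top (h : R.Admissible ρ) (n : ℕ) (x : V) : R.stepLMean ρ n x ≠ ∞ := by
  intro hn
  have h1 := h.lintegral_eq zero_le_one x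
  have h2 : 0 < poissonWeight n (R.clockRate * 1) := by
    have := R.clockRate_pos x
    unfold poissonWeight; positivity
  have h3 := ENNReal.le_tsum (f := fun n => ENNReal.ofReal (poissonWeight n (R.clockRate * 1)) *
    R.stepLMean ρ n x) n
  rw [← h1, hn, ENNReal.mul_top (ENNReal.ofReal_pos.2 h2).ne'] at h3
  exact ENNReal.ofReal_ne_top (top_le_iff.1 h3)

lemma stepMean_zero (h : R.Admissible ρ) (x : V) : R.stepMean ρ 0 x = ρ x := by
  rw [stepMean, stepLMean_zero, ENNReal.toReal_ofReal (h.1 x)]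

lemma stepMean_nonneg (n : ℕ) (x : V) : 0 ≤ R.stepMean ρ n x := ENNReal.toReal_nonneg

lemma hasSum_stepMean (h : R.Admissible ρ) (n : ℕ) (x : V) :
    HasSum (fun z => R.stepProb x z * R.stepMean ρ n z) (R.stepMean ρ (n + 1) x) := by
  have h1 := R.stepLMean_succ ρ n x
  have hne := h1 ▸ h.stepLMean_ne_top (n + 1) x
  have h2 := ENNReal.hasSum_toReal hne
  rw [← ENNReal.tsum_toReal_eq (ENNReal.ne_top_of_tsum_ne_top hne), ← h1] at h2
  refine h2.congr_fun fun z => ?_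
  rw [ENNReal.toReal_mul, ENNReal.toReal_ofReal (R.stepProb_nonneg x z)]
  rfl

lemma hasSum_mean (h : R.Admissible ρ) {t : ℝ} (ht : 0 ≤ t) (x : V) :
    HasSum (fun n => poissonWeight n (R.clockRate * t) * R.stepMean ρ n x) (R.mean ρ t x) := by
  have h1 := h.lintegral_eq ht x
  have hne := h1 ▸ ENNReal.ofReal_ne_top
  have h2 := ENNReal.hasSum_toReal hne
  rw [← ENNReal.tsum_toReal_eq (ENNReal.ne_top_of_tsum_ne_top hne), ← h1, ENNReal.toReal_ofReal (by exact integral_nonneg fun w => h.1 _)] at h2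
  refine h2.congr_fun fun n => ?_
  rw [ENNReal.toReal_mul, ENNReal.toReal_ofReal
    (poissonWeight_nonneg (mul_nonneg (R.clockRate_pos x).le ht) n)]
  rfl

lemma mean_eq (h : R.Admissible ρ) {t : ℝ} (ht : 0 ≤ t) (x : V) :
    R.mean ρ t x = poissonMix (fun n => R.stepMean ρ n x) (R.clockRate * t) :=
  (h.hasSum_mean ht x).tsum_eq.symm

/-- Here finiteness of `E_x ρ(X_t)` at all times enters: the series at `s` is, up to the factor `exp
s`, the mean at time `s / clockRate`. -/
lemma entireSeq (h : R.Admissible ρ) (x : V) : EntireSeq fun n => R.stepMean ρ n x := by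
  intro s hs
  have hc := R.clockRate_pos x
  have h1 := (h.hasSum_mean (t := s / R.clockRate) (by positivity) x).summable.mul_right (Real.exp s)
  refine h1.congr fun n => ?_
  rw [mul_div_cancel₀ _ hc.ne', poissonWeight, abs_of_nonneg (stepMean_nonneg n x), Real.exp_neg]
  field_simp

/-- All terms are nonnegative, so one step of the chain may be exchanged with the Poisson mixture;
it raises each number of steps by one. -/
lemma hasSum_stepProb_mean (h : R.Admissible ρ) {t : ℝ} (ht : 0 ≤ t) (x : V) :
    HasSum (fun z => R.stepProb x z * R.mean ρ t z)
      (poissonMix (fun n => R.stepMean ρ (n + 1) x) (R.clockRate * t)) := by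
  have hw := poissonWeight_nonneg (mul_nonneg (R.clockRate_pos x).le ht)
  have h0 : ∀ n, HasSum (fun z => poissonWeight n (R.clockRate * t) *
      (R.stepProb x z * R.stepMean ρ n z))
      (poissonWeight n (R.clockRate * t) * R.stepMean ρ (n + 1) x) :=
    fun n => (h.hasSum_stepMean n x).mul_left _
  have h1 : Summable fun q : ℕ × V =>
      poissonWeight q.1 (R.clockRate * t) * (R.stepProb x q.2 * R.stepMean ρ q.1 q.2) := by
    refine (summable_prod_of_nonneg fun q =>
      mul_nonneg (hw _) (mul_nonneg (R.stepProb_nonneg _ _) (stepMean_nonneg _ _))).2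
      ⟨fun n => (h0 n).summable, ?_⟩
    simp only [(h0 _).tsum_eq]
    exact (h.entireSeq x).succ.summable_poissonWeight _
  have h2 : ∑' q : ℕ × V, poissonWeight q.1 (R.clockRate * t) *
      (R.stepProb x q.2 * R.stepMean ρ q.1 q.2) =
      poissonMix (fun n => R.stepMean ρ (n + 1) x) (R.clockRate * t) := by
    rw [h1.tsum_prod]
    simp only [(h0 _).tsum_eq]
    rfl
  rw [← h2]
  have h3 := (Equiv.prodComm V ℕ).hasSum_iff (f := fun q : ℕ × V =>
    poissonWeight q.1 (R.clockRate * t) * (R.stepProb x q.2 * R.stepMean ρ q.1 q.2)) |>.2 h1.hasSum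
  refine h3.prod_fiberwise fun z => ?_
  refine ((h.hasSum_mean ht z).mul_left (R.stepProb x z)).congr_fun fun n => ?_
  simp only [Function.comp_apply, Equiv.prodComm_apply, Prod.swap_prod_mk]
  ring

/-- The time derivative of `E_x ρ(X_t)`. -/
lemma hasSum_genRW_mean (h : R.Admissible ρ) {t : ℝ} (ht : 0 ≤ t) (x : V) :
    HasSum (fun y => R.p x y * (R.mean ρ t y - R.mean ρ t x))
      (R.clockRate * (poissonMix (fun n => R.stepMean ρ (n + 1) x) (R.clockRate * t) -
        poissonMix (fun n => R.stepMean ρ n x) (R.clockRate * t))) := by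
  rw [← h.mean_eq ht]
  exact R.hasSum_genRW (φ := R.mean ρ t) (h.hasSum_stepProb_mean ht x)

lemma hasDerivAt_poissonMix (h : R.Admissible ρ) (t : ℝ) (x : V) :
    HasDerivAt (fun t => poissonMix (fun n => R.stepMean ρ n x) (R.clockRate * t))
      (R.clockRate * (poissonMix (fun n => R.stepMean ρ (n + 1) x) (R.clockRate * t) -
        poissonMix (fun n => R.stepMean ρ n x) (R.clockRate * t))) t := by
  have h1 := ((h.entireSeq x).hasDerivAt (R.clockRate * t)).comp t
    ((hasDerivAt_id t).const_mul R.clockRate)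
  refine h1.congr_deriv ?_
  ring

/-- The mixture is differentiable on all of `ℝ`, but is identified with `mean` only for nonnegative
times; hence a derivative within `Set.Ici 0`. -/
lemma hasDerivWithinAt_mean (h : R.Admissible ρ) {t : ℝ} (ht : 0 ≤ t) (x : V) :
    HasDerivWithinAt (fun t => R.mean ρ t x) (R.genRW (R.mean ρ t) x) (Set.Ici 0) t := by
  rw [genRW, (h.hasSum_genRW_mean ht x).tsum_eq]
  exact (h.hasDerivAt_poissonMix t x).hasDerivWithinAt.congr (fun s hs => h.mean_eq hs x)
    (h.mean_eq ht x)

lemma of_bounded {M : ℝ} (h0 : ∀ x, 0 ≤ ρ x) (hM : ∀ x, ρ x ≤ M) : R.Admissible ρ := by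
  refine ⟨h0, fun t _ x => Integrable.of_bound (C := M) ?_ (ae_of_all _ fun w => ?_)⟩
  · exact (Measurable.of_discrete.comp (R.measurable_walk_right t)).aestronglyMeasurable
  · rw [Real.norm_of_nonneg (h0 _)]
    exact hM _

end Admissible

end SymmRates

/-! ### Hitting probabilities and the density -/

lemma kron_nonneg {V : Type*} (x y : V) : 0 ≤ kron x y :=
  Set.indicator_nonneg (fun _ _ => zero_le_one) _

lemma kron_le_one {V : Type*} (x y : V) : kron x y ≤ 1 :=
  Set.indicator_le' (fun _ _ => le_rfl) (fun _ _ => zero_le_one) _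

lemma kron_self {V : Type*} (x : V) : kron x x = 1 := by simp [kron]

lemma kron_of_ne {V : Type*} {x y : V} (h : y ≠ x) : kron x y = 0 := by simp [kron, h]

namespace SymmRates
variable {V : Type*} [Countable V] [MeasurableSpace V] [DiscreteMeasurableSpace V]
  (R : SymmRates V)

lemma admissible_kron (o : V) : R.Admissible (kron o) :=
  Admissible.of_bounded (kron_nonneg o) (kron_le_one o)

lemma hitProb_eq_mean (o x : V) (s : ℝ) : R.hitProb o x s = R.mean (kron o) s x := by
  have hm : MeasurableSet {w | R.walk s w = o} :=
    R.measurable_walk_right s (measurableSet_singleton o)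
  rw [mean, hitProb, ← integral_indicator_one hm]
  rfl

lemma hitProb_nonneg (o x : V) (s : ℝ) : 0 ≤ R.hitProb o x s := measureReal_nonneg

lemma hitProb_le_one (o x : V) (s : ℝ) : R.hitProb o x s ≤ 1 := measureReal_le_one

/-- The series defining `P_x(X_s = o)`, continuous in `s ∈ ℝ`. -/
noncomputable def hitSeries (o x : V) (s : ℝ) : ℝ :=
  poissonMix (fun n => R.stepMean (kron o) n x) (R.clockRate * s)

lemma hitProb_eq_hitSeries (o x : V) {s : ℝ} (hs : 0 ≤ s) :
    R.hitProb o x s = R.hitSeries o x s := by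
  rw [hitProb_eq_mean, (R.admissible_kron o).mean_eq hs, hitSeries]

lemma continuous_hitSeries (o x : V) : Continuous (R.hitSeries o x) :=
  ((R.admissible_kron o).entireSeq x).continuous.comp (continuous_const.mul continuous_id)

lemma hitSeries_zero (o x : V) : R.hitSeries o x 0 = kron o x := by
  rw [hitSeries, mul_zero, poissonMix_zero, (R.admissible_kron o).stepMean_zero]

lemma integral_hitProb_eq (o x : V) {t : ℝ} (ht : 0 ≤ t) :
    ∫ s in (0 : ℝ)..t, R.hitProb o x s = ∫ s in (0 : ℝ)..t, R.hitSeries o x s := by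
  refine intervalIntegral.integral_congr fun s hs => ?_
  rw [Set.uIcc_of_le ht] at hs
  exact R.hitProb_eq_hitSeries o x hs.1

lemma hasDerivWithinAt_integral_hitProb (o x : V) {t : ℝ} (ht : 0 ≤ t) :
    HasDerivWithinAt (fun t => ∫ s in (0 : ℝ)..t, R.hitProb o x s) (R.hitSeries o x t)
      (Set.Ici 0) t := by
  have hc := R.continuous_hitSeries o x
  have h1 := intervalIntegral.integral_hasDerivAt_right (hc.intervalIntegrable 0 t)
    (hc.stronglyMeasurableAtFilter _ _) hc.continuousAt
  exact h1.hasDerivWithinAt.congr (fun s hs => R.integral_hitProb_eq o x hs)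
    (R.integral_hitProb_eq o x ht)

/-- Kolmogorov's equation for `P_x(X_s = o)` integrated over `[0, t]`. The sum over `y` passes
through the time integral because probabilities are at most one and `stepProb x` is summable. -/
lemma hasSum_genRW_integral_hitProb (o x : V) {t : ℝ} (ht : 0 ≤ t) :
    HasSum (fun y => R.p x y * ((∫ s in (0 : ℝ)..t, R.hitProb o y s) -
      ∫ s in (0 : ℝ)..t, R.hitProb o x s)) (R.hitSeries o x t - kron o x) := by
  have hk := R.admissible_kron o
  set D : ℝ → ℝ := fun s => poissonMix (fun n => R.stepMean (kron o) (n + 1) x) (R.clockRate * s)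
  have hD : Continuous D :=
    (hk.entireSeq x).succ.continuous.comp (continuous_const.mul continuous_id)
  have h1 : HasSum (fun y => ∫ s in (0 : ℝ)..t, R.stepProb x y * R.hitSeries o y s)
      (∫ s in (0 : ℝ)..t, D s) := by
    refine intervalIntegral.hasSum_integral_of_dominated_convergence
      (fun y _ => R.stepProb x y) (fun y =>
        ((R.continuous_hitSeries o y).const_mul _).aestronglyMeasurable) ?_ ?_ ?_ ?_
    · refine fun y => ae_of_all _ fun s hs => ?_
      rw [Set.uIoc_of_le ht] at hs
      rw [← R.hitProb_eq_hitSeries o y hs.1.le, Real.norm_of_nonneg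
        (mul_nonneg (R.stepProb_nonneg _ _) (R.hitProb_nonneg _ _ _))]
      exact mul_le_of_le_one_right (R.stepProb_nonneg _ _) (R.hitProb_le_one _ _ _)
    · exact ae_of_all _ fun s _ => (R.hasSum_stepProb x).summable
    · exact intervalIntegrable_const
    · refine ae_of_all _ fun s hs => ?_
      rw [Set.uIoc_of_le ht] at hs
      refine (hk.hasSum_stepProb_mean hs.1.le x).congr_fun fun y => ?_
      rw [← R.hitProb_eq_hitSeries o y hs.1.le, hitProb_eq_mean]
  simp only [intervalIntegral.integral_const_mul, ← R.integral_hitProb_eq o _ ht] at h1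
  convert R.hasSum_genRW (φ := fun y => ∫ s in (0 : ℝ)..t, R.hitProb o y s) h1 using 1
  have h2 := intervalIntegral.integral_eq_sub_of_hasDerivAt (a := 0) (b := t)
    (fun s _ => hk.hasDerivAt_poissonMix s x)
    ((continuous_const.mul (hD.sub (R.continuous_hitSeries o x))).intervalIntegrable 0 t)
  rw [← R.hitSeries_zero o x, R.integral_hitProb_eq o x ht, ← intervalIntegral.integral_sub
    (hD.intervalIntegrable _ _) ((R.continuous_hitSeries o x).intervalIntegrable _ _),
    ← intervalIntegral.integral_const_mul]
  exact h2.symm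

variable {R} {ρ : V → ℝ} (o : V) (lam : ℝ)

lemma density_eq (t : ℝ) (x : V) : R.density o lam ρ t x =
    R.mean ρ t x + lam * ∫ s in (0 : ℝ)..t, R.hitProb o x s := rfl

lemma Admissible.density_zero (h : R.Admissible ρ) : R.density o lam ρ 0 = ρ := by
  ext x
  rw [density_eq, intervalIntegral.integral_same, mul_zero, add_zero, h.mean_eq le_rfl, mul_zero,
    poissonMix_zero, h.stepMean_zero]

lemma Admissible.hasSum_genRW_density (h : R.Admissible ρ) {t : ℝ} (ht : 0 ≤ t) (x : V) :
    HasSum (fun y => R.p x y * (R.density o lam ρ t y - R.density o lam ρ t x))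
      (R.genRW (R.mean ρ t) x + lam * (R.hitSeries o x t - kron o x)) := by
  have h1 := h.hasSum_genRW_mean ht x
  rw [← h1.tsum_eq] at h1
  refine (h1.add ((R.hasSum_genRW_integral_hitProb o x ht).mul_left lam)).congr_fun fun y => ?_
  rw [density_eq, density_eq]
  ring

/-- Duhamel: the time integral has derivative `P_x(X_t = o)`, which exceeds `L` of the integral by
exactly `kron o x`. -/
lemma Admissible.hasDerivWithinAt_density (h : R.Admissible ρ) {t : ℝ} (ht : 0 ≤ t) (x : V) :
    HasDerivWithinAt (fun s => R.density o lam ρ s x)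
      (R.genRW (R.density o lam ρ t) x + lam * kron o x) (Set.Ici 0) t := by
  have h1 := (h.hasDerivWithinAt_mean ht x).add
    ((R.hasDerivWithinAt_integral_hitProb o x ht).const_mul lam)
  refine h1.congr_deriv ?_
  rw [genRW.eq_1 R (R.density o lam ρ t), (h.hasSum_genRW_density o lam ht x).tsum_eq]
  ring

lemma integral_hitProb_nonneg (x : V) {t : ℝ} (ht : 0 ≤ t) :
    0 ≤ ∫ s in (0 : ℝ)..t, R.hitProb o x s :=
  intervalIntegral.integral_nonneg ht fun s _ => R.hitProb_nonneg o x s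

lemma Admissible.mean_nonneg (h : R.Admissible ρ) (t : ℝ) (x : V) : 0 ≤ R.mean ρ t x :=
  integral_nonneg fun _ => h.1 _

variable {lam} in
lemma Admissible.density_nonneg (h : R.Admissible ρ) (hlam : 0 ≤ lam) {t : ℝ} (ht : 0 ≤ t) (x : V) :
    0 ≤ R.density o lam ρ t x :=
  add_nonneg (h.mean_nonneg t x) (mul_nonneg hlam (integral_hitProb_nonneg o x ht))

lemma mean_le {M : ℝ} (h0 : ∀ x, 0 ≤ ρ x) (hM : ∀ x, ρ x ≤ M) {t : ℝ} (ht : 0 ≤ t) (x : V) :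
    R.mean ρ t x ≤ M := by
  have := integral_mono ((Admissible.of_bounded (R := R) h0 hM).2 t ht x) (integrable_const M)
    fun w => hM (R.walk t w)
  simpa [mean] using this

lemma integral_hitProb_le (x : V) {t : ℝ} (ht : 0 ≤ t) :
    ∫ s in (0 : ℝ)..t, R.hitProb o x s ≤ t := by
  rw [integral_hitProb_eq _ _ _ ht]
  have := intervalIntegral.integral_mono_on (μ := volume) ht ((R.continuous_hitSeries o x).intervalIntegrable 0 t)
    (intervalIntegrable_const (c := (1 : ℝ)))
    fun s hs => (R.hitProb_eq_hitSeries o x hs.1) ▸ R.hitProb_le_one o x s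
  simpa using this

/-! ### Uniqueness among bounded solutions -/

lemma summable_stepProb_mul {φ : V → ℝ} {K : ℝ} (hφ : ∀ y, |φ y| ≤ K) (x : V) :
    Summable fun y => R.stepProb x y * φ y := by
  refine Summable.of_norm_bounded ((R.hasSum_stepProb x).summable.mul_right K) fun y => ?_
  rw [norm_mul, Real.norm_of_nonneg (R.stepProb_nonneg x y)]
  exact mul_le_mul_of_nonneg_left (hφ y) (R.stepProb_nonneg x y)

lemma abs_tsum_stepProb_le {φ : V → ℝ} {K : ℝ} (hφ : ∀ y, |φ y| ≤ K) (x : V) :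
    |∑' y, R.stepProb x y * φ y| ≤ K := by
  have h := tsum_of_norm_bounded (f := fun y => R.stepProb x y * φ y)
    ((R.hasSum_stepProb x).mul_right K) fun y => by
      rw [norm_mul, Real.norm_of_nonneg (R.stepProb_nonneg x y)]
      exact mul_le_mul_of_nonneg_left (hφ y) (R.stepProb_nonneg x y)
  simpa using h

lemma abs_genRW_le {φ : V → ℝ} {K : ℝ} (hφ : ∀ y, |φ y| ≤ K) (x : V) :
    |R.genRW φ x| ≤ 2 * R.clockRate * K := by
  have hc := R.clockRate_pos x
  rw [genRW, (R.hasSum_genRW (summable_stepProb_mul hφ x).hasSum).tsum_eq, abs_mul, abs_of_pos hc]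
  have h1 := abs_tsum_stepProb_le (R := R) hφ x
  have h2 := (abs_sub (∑' y, R.stepProb x y * φ y) (φ x)).trans (add_le_add h1 (hφ x))
  nlinarith

/-- A solution of the homogeneous system that is bounded and vanishes at time zero vanishes. -/
lemma eq_zero_of_hasDerivWithinAt_genRW {z : ℝ → V → ℝ} {T M : ℝ}
    (hb : ∀ t, 0 ≤ t → t ≤ T → ∀ x, |z t x| ≤ M) (h0 : ∀ x, z 0 x = 0)
    (hd : ∀ t, 0 ≤ t → ∀ x, HasDerivWithinAt (fun s => z s x) (R.genRW (z t) x) (Set.Ici 0) t)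
    {t : ℝ} (ht : 0 ≤ t) (htT : t ≤ T) (x : V) : z t x = 0 := by
  set C := 2 * R.clockRate with hC
  -- Picard iteration: `L` has norm at most `C` on bounded functions, so integrating a bound once
  -- gains a factor `C * t / (n + 1)`. The bounds tend to zero as `n` grows.
  have key : ∀ (n : ℕ) (t : ℝ), t ∈ Set.Icc 0 T → ∀ x, |z t x| ≤ (C * t) ^ n / n.factorial * M := by
    intro n
    induction n with
    | zero => intro t ht x; simpa using hb t ht.1 ht.2 x
    | succ n ih =>
      intro t ht x
      refine image_norm_le_of_norm_deriv_right_le_deriv_boundary (f := fun s => z s x)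
        (f' := fun s => R.genRW (z s) x) (a := 0) (b := T)
        (B := fun t => (C * t) ^ (n + 1) / (n + 1).factorial * M)
        (B' := fun t => C * ((C * t) ^ n / n.factorial * M)) ?_ ?_ ?_ ?_ ?_ ht
      · exact fun s hs => ((hd s hs.1 x).continuousWithinAt).mono Set.Icc_subset_Ici_self
      · exact fun s hs => (hd s hs.1 x).mono (Set.Ici_subset_Ici.2 hs.1)
      · simp [h0]
      · intro s
        have h1 := ((((hasDerivAt_id s).const_mul C).pow (n + 1)).div_const
          ((n + 1).factorial : ℝ)).mul_const M
        refine h1.congr_deriv ?_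
        rw [Nat.factorial_succ]
        push_cast
        simp only [id]
        field_simp
      · exact fun s hs => abs_genRW_le (fun y => ih s ⟨hs.1, hs.2.le⟩ y) x
  have hlim : Tendsto (fun n : ℕ => (C * t) ^ n / n.factorial * M) atTop (𝓝 0) := by
    simpa using (FloorSemiring.tendsto_pow_div_factorial_atTop (C * t)).mul_const M
  have := ge_of_tendsto' hlim fun n => key n t ⟨ht, htT⟩ x
  exact abs_nonpos_iff.1 this

/-- The density is itself bounded by `M + lam * t` on `[0, t]`, so its difference from `z` is a
bounded solution of the homogeneous system starting from zero. -/
lemma eq_density_of_bounded (h0 : ∀ x, 0 ≤ ρ x) {M : ℝ} (hM : ∀ x, ρ x ≤ M) (hlam : 0 ≤ lam)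
    {z : ℝ → V → ℝ} (hb : ∀ T, ∃ M, ∀ t, 0 ≤ t → t ≤ T → ∀ x, |z t x| ≤ M) (hz : z 0 = ρ)
    (hd : ∀ t, 0 ≤ t → ∀ x, HasDerivWithinAt (fun s => z s x)
      (R.genRW (z t) x + lam * kron o x) (Set.Ici 0) t) {t : ℝ} (ht : 0 ≤ t) :
    z t = R.density o lam ρ t := by
  have h : R.Admissible ρ := .of_bounded h0 hM
  obtain ⟨K, hK⟩ := hb t
  have hdb : ∀ s, 0 ≤ s → s ≤ t → ∀ x, |R.density o lam ρ s x| ≤ M + lam * t := by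
    intro s hs hst x
    rw [abs_of_nonneg (h.density_nonneg o hlam hs x), density_eq]
    exact add_le_add (mean_le h0 hM hs x)
      (mul_le_mul_of_nonneg_left ((integral_hitProb_le o x hs).trans hst) hlam)
  ext x
  refine sub_eq_zero.1 (eq_zero_of_hasDerivWithinAt_genRW (R := R) (T := t)
    (M := K + (M + lam * t)) (z := fun t x => z t x - R.density o lam ρ t x)
    (fun s hs hst x => (abs_sub _ _).trans (add_le_add (hK s hs hst x) (hdb s hs hst x)))
    (fun x => by rw [hz, h.density_zero, sub_self]) ?_ ht le_rfl x)
  intro s hs x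
  obtain ⟨Ks, hKs⟩ := hb s
  refine ((hd s hs x).sub (h.hasDerivWithinAt_density o lam hs x)).congr_deriv ?_
  have h1 := R.hasSum_genRW (summable_stepProb_mul (R := R) (hKs s hs le_rfl) x).hasSum
  have h2 := h.hasSum_genRW_density o lam hs x
  have h3 := (h1.sub h2).congr_fun (g := fun y => R.p x y * ((z s y - R.density o lam ρ s y) -
    (z s x - R.density o lam ρ s x))) fun y => by ring
  rw [genRW.eq_1 R fun x => z s x - R.density o lam ρ s x, h3.tsum_eq,
    genRW.eq_1 R (z s), h1.tsum_eq, genRW.eq_1 R (R.density o lam ρ s), h2.tsum_eq]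
  ring


/-! ### Occupation times, divergence and the limit density -/

lemma stepLMean_kron (o x : V) (n : ℕ) : R.stepLMean (kron o) n x = R.stepPow n x o := by
  rw [stepLMean, tsum_eq_single o]
  · simp [kron_self]
  · intro y hy; simp [kron_of_ne hy]

/-- As a function of time, `c` times the Poisson weight is the Gamma density of shape `n + 1` and
rate `c`. -/
lemma lintegral_Ioi_poissonWeight {c : ℝ} (hc : 0 < c) (n : ℕ) :
    ENNReal.ofReal c * ∫⁻ s in Set.Ioi (0 : ℝ), ENNReal.ofReal (poissonWeight n (c * s)) = 1 := by
  rw [← lintegral_gammaPDF_eq_one (a := n + 1) (by positivity) hc, ← lintegral_const_mul' _ _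
    ENNReal.ofReal_ne_top, ← lintegral_indicator measurableSet_Ioi]
  refine lintegral_congr_ae ?_
  filter_upwards [Measure.ae_ne volume (0 : ℝ)] with s hs
  rcases lt_or_gt_of_ne hs with h | h
  · rw [gammaPDF_of_neg h, Set.indicator_of_notMem (by simpa using h.le)]
  · rw [gammaPDF_of_nonneg h.le, Set.indicator_of_mem (by simpa using h), ← ENNReal.ofReal_mul hc.le]
    congr 1
    rw [poissonWeight, Real.Gamma_nat_eq_factorial, add_sub_cancel_right, Real.rpow_natCast,
      ← Nat.cast_add_one, Real.rpow_natCast]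
    ring

/-- Every step of the skeleton spent at `o` lasts on average `1 / clockRate`. -/
lemma lintegral_hitProb (o x : V) :
    ENNReal.ofReal R.clockRate * ∫⁻ s in Set.Ioi (0 : ℝ), ENNReal.ofReal (R.hitProb o x s) =
      R.green x o := by
  have h1 : ∀ s ∈ Set.Ioi (0 : ℝ), ENNReal.ofReal (R.hitProb o x s) =
      ∑' n, ENNReal.ofReal (poissonWeight n (R.clockRate * s)) * R.stepPow n x o := by
    intro s hs
    rw [hitProb_eq_mean, (R.admissible_kron o).lintegral_eq (le_of_lt hs)]
    simp only [stepLMean_kron]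
  have hm : ∀ n, Measurable fun s => ENNReal.ofReal (poissonWeight n (R.clockRate * s)) := by
    intro n; unfold poissonWeight; fun_prop
  rw [setLIntegral_congr_fun measurableSet_Ioi h1, lintegral_tsum fun n =>
    ((hm n).mul_const _).aemeasurable, ← ENNReal.tsum_mul_left, green]
  refine tsum_congr fun n => ?_
  rw [lintegral_mul_const _ (hm n), ← mul_assoc, lintegral_Ioi_poissonWeight (R.clockRate_pos x),
    one_mul]

lemma measurable_hitProb (o x : V) : Measurable (R.hitProb o x) := by
  have hm : MeasurableSet {q : ℝ × WalkSample V | R.walk q.1 q.2 = o} :=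
    R.measurable_walk (measurableSet_singleton o)
  exact (measurable_measure_prodMk_left (ν := R.walkLaw x) hm).ennreal_toReal

lemma integrableOn_hitProb_iff (o x : V) :
    IntegrableOn (R.hitProb o x) (Set.Ioi 0) ↔ R.green x o ≠ ∞ := by
  have hc := ENNReal.ofReal_pos.2 (R.clockRate_pos x)
  rw [← lintegral_hitProb, IntegrableOn, ← lt_top_iff_ne_top, ENNReal.mul_lt_top_iff]
  have h0 : 0 ≤ᵐ[volume.restrict (Set.Ioi 0)] R.hitProb o x :=
    ae_of_all _ fun s => R.hitProb_nonneg o x s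
  constructor
  · intro h
    refine Or.inl ⟨ENNReal.ofReal_lt_top, ?_⟩
    exact (hasFiniteIntegral_iff_ofReal h0).1 h.2
  · rintro (h | h | h)
    · exact ⟨(measurable_hitProb o x).aestronglyMeasurable, (hasFiniteIntegral_iff_ofReal h0).2 h.2⟩
    · exact absurd h hc.ne'
    · exact ⟨(measurable_hitProb o x).aestronglyMeasurable,
        (hasFiniteIntegral_iff_ofReal h0).2 (by rw [h]; exact ENNReal.zero_lt_top)⟩

lemma integral_Ioi_hitProb (o x : V) :
    ∫ s in Set.Ioi (0 : ℝ), R.hitProb o x s = (R.green x o).toReal / R.clockRate := by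
  have hc := R.clockRate_pos x
  rw [← lintegral_hitProb, ENNReal.toReal_mul, ENNReal.toReal_ofReal hc.le,
    mul_div_cancel_left₀ _ hc.ne', integral_eq_lintegral_of_nonneg_ae
      (ae_of_all _ fun s => R.hitProb_nonneg o x s) (measurable_hitProb o x).aestronglyMeasurable]

/-- The integral is monotone in `t`; a finite limit would make the hitting probability integrable
and hence the Green function finite. -/
lemma tendsto_integral_hitProb_atTop (x : V) (h : R.green x o = ∞) :
    Tendsto (fun t => ∫ s in (0 : ℝ)..t, R.hitProb o x s) atTop atTop := by
  have hint : ∀ a b : ℝ, IntervalIntegrable (R.hitProb o x) volume a b := fun a b =>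
    (intervalIntegrable_const (c := (1 : ℝ))).mono_fun
      (measurable_hitProb o x).aestronglyMeasurable (ae_of_all _ fun s => by
        simpa [abs_of_nonneg (R.hitProb_nonneg o x s)] using R.hitProb_le_one o x s)
  have hmono : Monotone fun t => ∫ s in (0 : ℝ)..t, R.hitProb o x s := by
    intro a b hab
    have h1 := intervalIntegral.integral_add_adjacent_intervals (hint 0 a) (hint a b)
    have h2 := intervalIntegral.integral_nonneg (μ := volume) hab
      fun s _ => R.hitProb_nonneg o x s
    simp only
    linarith
  rcases tendsto_atTop_of_monotone hmono with h1 | ⟨l, hl⟩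
  · exact h1
  · exfalso
    refine (integrableOn_hitProb_iff o x).1 ?_ h
    refine integrableOn_Ioi_of_intervalIntegral_norm_tendsto (l := atTop) (b := id) l 0
      (fun t => ?_) tendsto_id (hl.congr fun t => ?_)
    · exact ((hint 0 (max 0 t)).1).mono_set (Set.Ioc_subset_Ioc_right (le_max_right _ _))
    · refine intervalIntegral.integral_congr fun s _ => ?_
      simp [abs_of_nonneg (R.hitProb_nonneg o x s)]

lemma Admissible.tendsto_density_atTop (h : R.Admissible ρ) (hlam : 0 < lam) (hr : R.IsRecurrent)
    (x : V) : Tendsto (fun t => R.density o lam ρ t x) atTop atTop :=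
  tendsto_atTop_mono (fun t => le_add_of_nonneg_left (h.mean_nonneg t x))
    ((tendsto_integral_hitProb_atTop o x ((R.isRecurrent_iff_green x o).1 hr)).const_mul_atTop hlam)

lemma integral_hitProb_le_of_integrableOn (x : V) (h : IntegrableOn (R.hitProb o x) (Set.Ioi 0))
    {t : ℝ} (ht : 0 ≤ t) :
    ∫ s in (0 : ℝ)..t, R.hitProb o x s ≤ ∫ s in Set.Ioi (0 : ℝ), R.hitProb o x s := by
  rw [intervalIntegral.integral_of_le ht]
  exact setIntegral_mono_set h (ae_of_all _ fun s => R.hitProb_nonneg o x s)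
    (Set.Ioc_subset_Ioi_self.eventuallyLE)

/-- If the walk is not recurrent, the density stays below `M` plus `lam` times the finite total
occupation time. -/
lemma tendsto_density_atTop_iff (hlam : 0 < lam) (h0 : ∀ x, 0 ≤ ρ x) {M : ℝ} (hM : ∀ x, ρ x ≤ M)
    (x : V) : Tendsto (fun t => R.density o lam ρ t x) atTop atTop ↔ R.IsRecurrent := by
  refine ⟨fun h => ?_, fun h => (Admissible.of_bounded h0 hM).tendsto_density_atTop o lam hlam h x⟩
  rw [R.isRecurrent_iff_green x o]
  by_contra hg
  have hi := (integrableOn_hitProb_iff o x).2 hg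
  obtain ⟨t, ht, ht0⟩ := ((h.eventually_gt_atTop
    (M + lam * ∫ s in Set.Ioi (0 : ℝ), R.hitProb o x s)).and (eventually_ge_atTop 0)).exists
  refine absurd ht (not_lt.2 (add_le_add (mean_le h0 hM ht0 x)
    (mul_le_mul_of_nonneg_left ?_ hlam.le)))
  exact integral_hitProb_le_of_integrableOn o x hi ht0

/-- The limit density in the transient case. -/
noncomputable def limitDensity (R : SymmRates V) (o : V) (lam r : ℝ) (x : V) : ℝ :=
  r + lam * ∫ s in Set.Ioi (0 : ℝ), R.hitProb o x s

/-- First-step analysis `G = δ + P G` of the Green function, rescaled by `lam / clockRate`; the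
constant `r` is harmonic. -/
lemma hasSum_genRW_limitDensity (r : ℝ) (h : ∀ x, R.green x o ≠ ∞) (x : V) :
    HasSum (fun y => R.p x y * (limitDensity R o lam r y - limitDensity R o lam r x))
      (-(lam * kron o x)) := by
  have hc := R.clockRate_pos x
  have h1 : R.green x o = ENNReal.ofReal (kron o x) + ∑' y, ENNReal.ofReal (R.stepProb x y) *
      R.green y o := by
    rw [green, tsum_eq_zero_add' ENNReal.summable]
    congr 1
    · rw [← stepLMean_kron, stepLMean_zero]
    · simp only [green, ← ENNReal.tsum_mul_left]
      rw [ENNReal.tsum_comm]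
      refine tsum_congr fun n => ?_
      rw [add_comm n 1, stepPow_add]
      simp only [stepPow_one]
  have hne : ∑' y, ENNReal.ofReal (R.stepProb x y) * R.green y o ≠ ∞ := fun h' =>
    h x (by rw [h1, h', add_top])
  have h2 := ENNReal.hasSum_toReal hne
  have h3 : ∑' y, (ENNReal.ofReal (R.stepProb x y) * R.green y o).toReal =
      (R.green x o).toReal - kron o x := by
    rw [← ENNReal.tsum_toReal_eq (ENNReal.ne_top_of_tsum_ne_top hne), h1,
      ENNReal.toReal_add ENNReal.ofReal_ne_top hne, ENNReal.toReal_ofReal (kron_nonneg o x)]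
    ring
  rw [h3] at h2
  simp only [ENNReal.toReal_mul, ENNReal.toReal_ofReal (R.stepProb_nonneg _ _)] at h2
  have h4 := (R.hasSum_genRW (φ := fun y => (R.green y o).toReal) h2).mul_left
    (lam / R.clockRate)
  have h5 : lam / R.clockRate * (R.clockRate * ((R.green x o).toReal - kron o x -
      (R.green x o).toReal)) = -(lam * kron o x) := by
    field_simp
    ring
  rw [h5] at h4
  refine h4.congr_fun fun y => ?_
  rw [limitDensity, limitDensity, integral_Ioi_hitProb, integral_Ioi_hitProb]
  ring

lemma density_const_eq {r : ℝ} (t : ℝ) (x : V) : R.density o lam (fun _ => r) t x =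
    r + lam * ∫ s in (0 : ℝ)..t, R.hitProb o x s := by
  simp [density_eq, mean]

end SymmRates

/-! ### Differentiation of multivariate Poisson series -/

/-- The derivative of the Poisson weight. -/
noncomputable def poissonWeightDeriv (n : ℕ) (s : ℝ) : ℝ :=
  (if n = 0 then 0 else poissonWeight (n - 1) s) - poissonWeight n s

lemma hasDerivAt_poissonWeight (n : ℕ) (s : ℝ) :
    HasDerivAt (poissonWeight n) (poissonWeightDeriv n s) s := by
  have h := ((hasDerivAt_pow n s).div_const (n.factorial : ℝ)).mul ((hasDerivAt_neg s).exp)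
  refine h.congr_deriv ?_
  rw [poissonWeightDeriv, poissonWeight, poissonWeight]
  cases n with
  | zero => simp
  | succ n =>
    rw [if_neg (Nat.succ_ne_zero n), Nat.factorial_succ]
    simp only [Nat.add_sub_cancel]
    push_cast
    field_simp
    ring

lemma succ_mul_poissonWeight (n : ℕ) (s : ℝ) :
    ((n + 1 : ℕ) : ℝ) * poissonWeight (n + 1) s = s * poissonWeight n s := by
  rw [poissonWeight, poissonWeight, Nat.factorial_succ]
  push_cast
  field_simp
  ring

lemma abs_poissonWeight_le {s r : ℝ} (h : |s| ≤ r) (n : ℕ) :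
    |poissonWeight n s| ≤ Real.exp r * (r ^ n / n.factorial) := by
  rw [poissonWeight, abs_mul, abs_div, abs_pow, Nat.abs_cast, Real.abs_exp, mul_comm]
  have : -s ≤ r := (neg_le_abs s).trans h
  gcongr

/-- Differentiation costs a factor `n / r`, compensated by enlarging the radius: `n * (r / R) ^ n`
is bounded. -/
lemma exists_abs_poissonWeightDeriv_le {r R : ℝ} (hr : 0 < r) (h : r < R) :
    ∃ K, 0 ≤ K ∧ ∀ n s, |s| ≤ r → |poissonWeightDeriv n s| ≤ K * (R ^ n / n.factorial) := by
  have hR := hr.trans h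
  have h1 : Tendsto (fun n : ℕ => (n : ℝ) * (r / R) ^ n) atTop (𝓝 0) :=
    tendsto_self_mul_const_pow_of_lt_one (by positivity) ((div_lt_one hR).2 h)
  obtain ⟨B, hB⟩ := h1.bddAbove_range
  have hB' : ∀ n : ℕ, (n : ℝ) * r ^ n ≤ B * R ^ n := by
    intro n
    have : (n : ℝ) * (r / R) ^ n ≤ B := hB ⟨n, rfl⟩
    rwa [div_pow, ← mul_div_assoc, div_le_iff₀ (by positivity)] at this
  have hB0 : 0 ≤ B := by simpa using hB' 0
  refine ⟨Real.exp r * (B / r + 1), by positivity, fun n s hs => ?_⟩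
  rw [poissonWeightDeriv]
  refine (abs_sub _ _).trans ?_
  have h2 : |poissonWeight n s| ≤ Real.exp r * (R ^ n / n.factorial) :=
    (abs_poissonWeight_le hs n).trans (by gcongr)
  have h3 : |if n = 0 then 0 else poissonWeight (n - 1) s| ≤
      Real.exp r * (B / r * (R ^ n / n.factorial)) := by
    cases n with
    | zero => simp; positivity
    | succ n =>
      rw [if_neg (Nat.succ_ne_zero n), Nat.add_sub_cancel]
      refine (abs_poissonWeight_le hs n).trans ?_
      have h4 := hB' (n + 1)
      rw [pow_succ r n] at h4
      gcongr
      rw [Nat.factorial_succ, div_mul_div_comm, div_le_div_iff₀ (by positivity) (by positivity)]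
      push_cast at h4 ⊢
      nlinarith [mul_le_mul_of_nonneg_right h4 (by positivity : 0 ≤ (n.factorial : ℝ))]
  calc _ ≤ _ := add_le_add h3 h2
    _ = _ := by ring

section PowerSeries
variable {ι : Type*} [Fintype ι] [DecidableEq ι]

/-- The product of Poisson weights. -/
noncomputable def prodWeight (k : ι → ℕ) (v : ι → ℝ) : ℝ := ∏ i, poissonWeight (k i) (v i)

/-- The partial derivative of `prodWeight` in the coordinate `i`. -/
noncomputable def prodWeightDeriv (k : ι → ℕ) (i : ι) (v : ι → ℝ) : ℝ :=
  (∏ j ∈ Finset.univ.erase i, poissonWeight (k j) (v j)) * poissonWeightDeriv (k i) (v i)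

/-- The multi-index `k` with one more unit at `x`. -/
def bump (x : ι) (k : ι → ℕ) : ι → ℕ := Function.update k x (k x + 1)

lemma bump_injective (x : ι) : Function.Injective (bump x) := by
  intro k l h
  ext i
  have := congrFun h i
  by_cases hi : i = x
  · subst hi; simpa [bump] using this
  · simpa [bump, hi] using this

lemma mem_range_bump {x : ι} {k : ι → ℕ} (h : k x ≠ 0) : k ∈ Set.range (bump x) := by
  refine ⟨Function.update k x (k x - 1), ?_⟩
  ext i
  by_cases hi : i = x
  · subst hi; simp [bump]; omega
  · simp [bump, hi]

lemma prod_erase_bump (x : ι) (k : ι → ℕ) (v : ι → ℝ) :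
    ∏ j ∈ Finset.univ.erase x, poissonWeight (bump x k j) (v j) =
      ∏ j ∈ Finset.univ.erase x, poissonWeight (k j) (v j) :=
  Finset.prod_congr rfl fun j hj => by rw [bump, Function.update_of_ne (Finset.ne_of_mem_erase hj)]

lemma prodWeight_eq (x : ι) (k : ι → ℕ) (v : ι → ℝ) :
    prodWeight k v = (∏ j ∈ Finset.univ.erase x, poissonWeight (k j) (v j)) *
      poissonWeight (k x) (v x) :=
  (Finset.prod_erase_mul _ _ (Finset.mem_univ x)).symm

lemma bump_mul_prodWeight (x : ι) (k : ι → ℕ) (v : ι → ℝ) :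
    (bump x k x : ℝ) * prodWeight (bump x k) v = v x * prodWeight k v := by
  rw [prodWeight_eq x, prod_erase_bump, prodWeight_eq x k, bump, Function.update_self,
    mul_left_comm, succ_mul_poissonWeight]
  ring

/-- The Mecke identity for Poisson weights, valid for real parameters of either sign. Multi-indices
outside the range of `bump x` have `k x = 0` and contribute nothing. -/
lemma hasSum_mul_prodWeight {a : (ι → ℕ) → ℝ} (x : ι) {v : ι → ℝ} {S : ℝ}
    (h : HasSum (fun k => prodWeight k v * a (bump x k)) S) :
    HasSum (fun k => prodWeight k v * ((k x : ℝ) * a k)) (v x * S) := by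
  rw [← (bump_injective x).hasSum_iff]
  · refine (h.mul_left (v x)).congr_fun fun k => ?_
    rw [Function.comp_apply, ← mul_assoc, ← mul_assoc, ← bump_mul_prodWeight]
    ring
  · intro k hk
    have : k x = 0 := by_contra fun h => hk (mem_range_bump h)
    simp [this]

lemma hasFDerivAt_prodWeight (k : ι → ℕ) (v : ι → ℝ) :
    HasFDerivAt (prodWeight k)
      (∑ i, prodWeightDeriv k i v • (ContinuousLinearMap.proj i : (ι → ℝ) →L[ℝ] ℝ)) v := by
  have h := HasFDerivAt.finsetProd (u := Finset.univ) (x := v)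
    (g := fun i (v : ι → ℝ) => poissonWeight (k i) (v i))
    (g' := fun i => poissonWeightDeriv (k i) (v i) • (ContinuousLinearMap.proj i : (ι → ℝ) →L[ℝ] ℝ))
    fun i _ => HasDerivAt.comp_hasFDerivAt (h₂ := poissonWeight (k i))
      (f := fun v : ι → ℝ => v i) v (hasDerivAt_poissonWeight (k i) (v i))
      (ContinuousLinearMap.proj i : (ι → ℝ) →L[ℝ] ℝ).hasFDerivAt
  refine (h.congr_fderiv ?_).congr_of_eventuallyEq (Eventually.of_forall fun v => ?_)
  · refine Finset.sum_congr rfl fun i _ => ?_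
    rw [smul_smul]; rfl
  · simp [prodWeight]

/-- The power series with coefficients `a` converges absolutely beyond `z`. -/
def ConvergesBeyond (a : (ι → ℕ) → ℝ) (z : ι → ℝ) : Prop :=
  ∃ R : ι → ℝ, (∀ i, |z i| < R i) ∧
    Summable fun k : ι → ℕ => |a k| * ∏ i, R i ^ k i / (k i).factorial

variable {a : (ι → ℕ) → ℝ} {z : ι → ℝ}

/-- One summable majorant serves the series and all its first partial derivatives on a whole box
around `z`. The radii `r` lie strictly between `|z|` and the radii of convergence, which leaves room
for the loss under differentiation. -/
lemma ConvergesBeyond.exists_bound (h : ConvergesBeyond a z) :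
    ∃ r : ι → ℝ, (∀ i, |z i| < r i) ∧ ∃ u : (ι → ℕ) → ℝ, Summable u ∧
      ∀ v : ι → ℝ, (∀ i, |v i| ≤ r i) → ∀ k, |prodWeight k v * a k| ≤ u k ∧
        ∀ i, |prodWeightDeriv k i v * a k| ≤ u k := by
  obtain ⟨R, hR, hs⟩ := h
  have hr : ∀ i, ∃ r, |z i| < r ∧ r < R i := fun i => exists_between (hR i)
  choose r hzr hrR using hr
  have hr0 : ∀ i, 0 < r i := fun i => (abs_nonneg _).trans_lt (hzr i)
  have hR0 : ∀ i, 0 < R i := fun i => (hr0 i).trans (hrR i)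
  choose K hK0 hK using fun i => exists_abs_poissonWeightDeriv_le (hr0 i) (hrR i)
  set E : ℝ := ∏ i, Real.exp (R i) with hE
  have hE1 : ∀ i, 1 ≤ Real.exp (R i) := fun i => Real.one_le_exp (hR0 i).le
  have hT : 0 ≤ ∑ i, K i := Finset.sum_nonneg fun i _ => hK0 i
  refine ⟨r, hzr, fun k => (E * (1 + ∑ i, K i)) * (|a k| * ∏ i, R i ^ k i / (k i).factorial),
    hs.mul_left _, fun v hv k => ?_⟩
  have hw : ∀ j, |poissonWeight (k j) (v j)| ≤ Real.exp (R j) * (R j ^ k j / (k j).factorial) :=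
    fun j => abs_poissonWeight_le ((hv j).trans (hrR j).le) _
  have hp : 0 ≤ ∏ i, R i ^ k i / (k i).factorial :=
    Finset.prod_nonneg fun i _ => by have := hR0 i; positivity
  have hE0 : 0 ≤ E := Finset.prod_nonneg fun i _ => (Real.exp_pos _).le
  refine ⟨?_, fun i => ?_⟩
  · rw [abs_mul, prodWeight, Finset.abs_prod]
    calc _ ≤ (∏ j, Real.exp (R j) * (R j ^ k j / (k j).factorial)) * |a k| := by
          exact mul_le_mul_of_nonneg_right
            (Finset.prod_le_prod (fun j _ => abs_nonneg _) fun j _ => hw j) (abs_nonneg _)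
      _ = E * 1 * (|a k| * ∏ i, R i ^ k i / (k i).factorial) := by
          rw [Finset.prod_mul_distrib]; ring
      _ ≤ _ := mul_le_mul_of_nonneg_right (mul_le_mul_of_nonneg_left (by linarith) hE0)
          (mul_nonneg (abs_nonneg _) hp)
  · rw [abs_mul, prodWeightDeriv, abs_mul, Finset.abs_prod]
    calc _ ≤ (∏ j ∈ Finset.univ.erase i, Real.exp (R j) * (R j ^ k j / (k j).factorial)) *
          (Real.exp (R i) * (K i * (R i ^ k i / (k i).factorial))) * |a k| := by
          have h1 : |poissonWeightDeriv (k i) (v i)| ≤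
              Real.exp (R i) * (K i * (R i ^ k i / (k i).factorial)) := by
            have hi := hR0 i
            have hk := hK0 i
            exact (hK i (k i) (v i) (hv i)).trans
              (le_mul_of_one_le_left (by positivity) (hE1 i))
          have h2 : ∏ j ∈ Finset.univ.erase i, |poissonWeight (k j) (v j)| ≤
              ∏ j ∈ Finset.univ.erase i, Real.exp (R j) * (R j ^ k j / (k j).factorial) :=
            Finset.prod_le_prod (fun j _ => abs_nonneg _) fun j _ => hw j
          have h3 : 0 ≤ ∏ j ∈ Finset.univ.erase i, Real.exp (R j) * (R j ^ k j / (k j).factorial) :=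
            Finset.prod_nonneg fun j _ => by have := hR0 j; positivity
          exact mul_le_mul_of_nonneg_right (mul_le_mul h2 h1 (abs_nonneg _) h3) (abs_nonneg _)
      _ = K i * ((∏ j, Real.exp (R j) * (R j ^ k j / (k j).factorial)) * |a k|) := by
          rw [← Finset.prod_erase_mul _ _ (Finset.mem_univ i)]; ring
      _ = E * K i * (|a k| * ∏ i, R i ^ k i / (k i).factorial) := by
          rw [Finset.prod_mul_distrib]; ring
      _ ≤ _ := by
          have : K i ≤ ∑ i, K i := Finset.single_le_sum (fun i _ => hK0 i) (Finset.mem_univ i)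
          exact mul_le_mul_of_nonneg_right (mul_le_mul_of_nonneg_left (by linarith) hE0)
            (mul_nonneg (abs_nonneg _) hp)

lemma ConvergesBeyond.summable (h : ConvergesBeyond a z) :
    Summable fun k => prodWeight k z * a k := by
  obtain ⟨r, hr, u, hu, hb⟩ := h.exists_bound
  exact Summable.of_norm_bounded hu fun k => (hb z (fun i => (hr i).le) k).1

lemma ConvergesBeyond.summable_bump (h : ConvergesBeyond a z) (x : ι) :
    Summable fun k => prodWeight k z * a (bump x k) := by
  obtain ⟨r, hr, u, hu, hb⟩ := h.exists_bound
  have h1 : Summable fun k => prodWeightDeriv k x z * a k :=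
    Summable.of_norm_bounded hu fun k => (hb z (fun i => (hr i).le) k).2 x
  have h2 := (h1.add h.summable).comp_injective (bump_injective x)
  refine h2.congr fun k => ?_
  rw [Function.comp_apply, ← add_mul, prodWeightDeriv, prodWeight_eq x, prod_erase_bump, ← mul_add,
    poissonWeightDeriv, sub_add_cancel, bump, Function.update_self, if_neg (Nat.succ_ne_zero _),
    Nat.add_sub_cancel, prodWeight_eq x k]

/-- The derivative of a Poisson weight is a backward difference in the index; summation by parts
moves it onto `a` as the increment under adding a unit at `x`. -/
lemma ConvergesBeyond.tsum_deriv (h : ConvergesBeyond a z) (x : ι) :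
    ∑' k, prodWeightDeriv k x z * a k =
      ∑' k, prodWeight k z * a (bump x k) - ∑' k, prodWeight k z * a k := by
  obtain ⟨r, hr, u, hu, hb⟩ := h.exists_bound
  have h1 : Summable fun k => prodWeightDeriv k x z * a k :=
    Summable.of_norm_bounded hu fun k => (hb z (fun i => (hr i).le) k).2 x
  rw [eq_sub_iff_add_eq, ← h1.tsum_add h.summable, ← (bump_injective x).tsum_eq]
  · refine tsum_congr fun k => ?_
    rw [← add_mul, prodWeightDeriv, prodWeight_eq x, prod_erase_bump, ← mul_add,
      poissonWeightDeriv, sub_add_cancel, bump, Function.update_self, if_neg (Nat.succ_ne_zero _),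
      Nat.add_sub_cancel, prodWeight_eq x k]
  · intro k hk
    by_contra hk'
    have : k x = 0 := by_contra fun h => hk' (mem_range_bump h)
    refine hk ?_
    change prodWeightDeriv k x z * a k + prodWeight k z * a k = 0
    rw [← add_mul, prodWeightDeriv, prodWeight_eq x, ← mul_add, poissonWeightDeriv, sub_add_cancel,
      if_pos this, mul_zero, zero_mul]

/-- Termwise differentiation on the open box with radii `r`, with the majorant multiplied by the
number of coordinates. -/
lemma ConvergesBeyond.hasFDerivAt (h : ConvergesBeyond a z) :
    HasFDerivAt (fun v => ∑' k, prodWeight k v * a k)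
      (∑ i, (∑' k, prodWeight k z * a (bump i k) - ∑' k, prodWeight k z * a k) •
        (ContinuousLinearMap.proj i : (ι → ℝ) →L[ℝ] ℝ)) z := by
  obtain ⟨r, hr, u, hu, hb⟩ := h.exists_bound
  set B : Set (ι → ℝ) := Set.pi Set.univ fun i => Set.Ioo (-(r i)) (r i) with hB
  have hBo : IsOpen B := isOpen_set_pi Set.finite_univ fun i _ => isOpen_Ioo
  have hBc : IsPreconnected B := (convex_pi fun i _ => convex_Ioo _ _).isPreconnected
  have hmem : ∀ v ∈ B, ∀ i, |v i| ≤ r i := fun v hv i => (abs_lt.2 (hv i trivial)).le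
  have hzB : z ∈ B := fun i _ => abs_lt.1 (hr i)
  have hD : ∀ k v, HasFDerivAt (fun v => prodWeight k v * a k)
      (∑ i, (prodWeightDeriv k i v * a k) • (ContinuousLinearMap.proj i : (ι → ℝ) →L[ℝ] ℝ)) v := by
    intro k v
    refine ((hasFDerivAt_prodWeight k v).mul_const (a k)).congr_fderiv ?_
    rw [Finset.smul_sum]
    exact Finset.sum_congr rfl fun i _ => by rw [smul_smul, mul_comm]
  have hproj : ∀ i, ‖(ContinuousLinearMap.proj i : (ι → ℝ) →L[ℝ] ℝ)‖ ≤ 1 := fun i =>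
    ContinuousLinearMap.opNorm_le_bound _ zero_le_one fun v => by
      simpa using norm_le_pi_norm v i
  have h1 := hasFDerivAt_tsum_of_isPreconnected (hu.mul_left (Fintype.card ι : ℝ)) hBo hBc
    (fun k v _ => hD k v) (fun k v hv => ?_) hzB h.summable hzB
  · refine h1.congr_fderiv ?_
    have hs : ∀ i, Summable fun k => prodWeightDeriv k i z * a k := fun i =>
      Summable.of_norm_bounded hu fun k => (hb z (fun i => (hr i).le) k).2 i
    rw [Summable.tsum_finsetSum fun i _ => (hs i).smul_const _]
    refine Finset.sum_congr rfl fun i _ => ?_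
    rw [(hs i).tsum_smul_const, h.tsum_deriv]
  · refine (norm_sum_le _ _).trans ?_
    refine (Finset.sum_le_card_nsmul _ _ (u k) fun i _ => ?_).trans (by simp [nsmul_eq_mul])
    rw [norm_smul]
    have h2 := (hb v (hmem v hv) k).2 i
    calc _ ≤ u k * 1 := mul_le_mul h2 (hproj i) (norm_nonneg _) ((abs_nonneg _).trans h2)
      _ = u k := mul_one _

end PowerSeries

/-! ### Configurations and generating functions of local functions -/

section Configurations
variable {V : Type*}

lemma addParticle_apply_self (η : V → ℕ) (x : V) : addParticle η x x = η x + 1 := by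
  simp [addParticle]

lemma addParticle_apply_of_ne (η : V → ℕ) {x y : V} (h : y ≠ x) : addParticle η x y = η y := by
  simp [addParticle, h]

lemma moveParticle_addParticle (η : V → ℕ) (x y : V) :
    moveParticle (addParticle η x) x y = addParticle η y := by
  rw [moveParticle, if_neg (by rw [addParticle_apply_self]; exact Nat.succ_ne_zero _)]
  congr 1
  rw [addParticle_apply_self, Nat.add_sub_cancel, addParticle]
  simp

lemma moveParticle_apply_of_ne (η : V → ℕ) {x y u : V} (hx : u ≠ x) (hy : u ≠ y) :
    moveParticle η x y u = η u := by
  classical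
  rw [moveParticle]
  split_ifs with h
  · rfl
  · simp [addParticle_apply_of_ne _ hy, hx]

lemma DependsOn.addParticle_eq {β : Type*} {f : (V → ℕ) → β} {Λ : Finset V}
    (hf : DependsOn f (Λ : Set V)) {y : V} (hy : y ∉ Λ) (η : V → ℕ) :
    f (addParticle η y) = f η :=
  hf fun _ hi => addParticle_apply_of_ne η fun h => hy (h ▸ hi)

lemma DependsOn.comp_addParticle {β : Type*} {f : (V → ℕ) → β} {Λ : Finset V}
    (hf : DependsOn f (Λ : Set V)) (y : V) :
    DependsOn (fun η => f (addParticle η y)) (Λ : Set V) := by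
  intro η ξ h
  refine hf fun i hi => ?_
  by_cases hiy : i = y
  · subst hiy; rw [addParticle_apply_self, addParticle_apply_self, h i hi]
  · rw [addParticle_apply_of_ne _ hiy, addParticle_apply_of_ne _ hiy, h i hi]

lemma DependsOn.edgeJump_eq_zero {f : (V → ℕ) → ℝ} {Λ : Finset V}
    (hf : DependsOn f (Λ : Set V)) {x y : V} (hx : x ∉ Λ) (hy : y ∉ Λ) (η : V → ℕ) :
    edgeJump f η x y = 0 := by
  have h1 : f (moveParticle η x y) = f η := hf fun i hi =>
    moveParticle_apply_of_ne η (fun h => hx (h ▸ hi)) (fun h => hy (h ▸ hi))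
  have h2 : f (moveParticle η y x) = f η := hf fun i hi =>
    moveParticle_apply_of_ne η (fun h => hy (h ▸ hi)) (fun h => hx (h ▸ hi))
  rw [edgeJump, h1, h2]
  ring

lemma extendZero_of_mem {Λ : Finset V} (k : Λ → ℕ) {x : V} (h : x ∈ Λ) :
    extendZero Λ k x = k ⟨x, h⟩ := by simp [extendZero, h]

lemma extendZero_of_notMem {Λ : Finset V} (k : Λ → ℕ) {x : V} (h : x ∉ Λ) :
    extendZero Λ k x = 0 := by simp [extendZero, h]

open scoped Classical in
lemma extendZero_bump {Λ : Finset V} (k : Λ → ℕ) (x : Λ) :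
    extendZero Λ (bump x k) = addParticle (extendZero Λ k) x := by
  ext y
  by_cases hy : y ∈ Λ
  · rw [extendZero_of_mem _ hy]
    by_cases hyx : y = x
    · subst hyx
      rw [addParticle_apply_self, extendZero_of_mem _ hy, bump, Function.update_self]
    · rw [addParticle_apply_of_ne _ hyx, extendZero_of_mem _ hy, bump,
        Function.update_of_ne fun h => hyx (congrArg Subtype.val h)]
  · have hyx : y ≠ x := fun h => hy (h ▸ x.2)
    rw [addParticle_apply_of_ne _ hyx, extendZero_of_notMem _ hy, extendZero_of_notMem _ hy]

lemma genFunTerm_eq (Λ : Finset V) (g : (V → ℕ) → ℝ) (z : V → ℝ) (k : Λ → ℕ) :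
    genFunTerm Λ g z k = prodWeight k (fun i => z i) * g (extendZero Λ k) := rfl

lemma hasSum_genFunTerm_mul {Λ : Finset V} {g : (V → ℕ) → ℝ} {z : V → ℝ} {x : V} (hx : x ∈ Λ)
    {S : ℝ} (h : HasSum (genFunTerm Λ (fun η => g (addParticle η x)) z) S) :
    HasSum (genFunTerm Λ (fun η => (η x : ℝ) * g η) z) (z x * S) := by
  classical
  have h1 := hasSum_mul_prodWeight (a := fun k => g (extendZero Λ k)) (⟨x, hx⟩ : Λ)
    (v := fun i => z i) (S := S) (by
      refine h.congr_fun fun k => ?_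
      rw [genFunTerm_eq, extendZero_bump])
  refine h1.congr_fun fun k => ?_
  rw [genFunTerm_eq, extendZero_of_mem _ hx]

lemma hasSum_genFunTerm_mul_of_notMem {Λ : Finset V} (g : (V → ℕ) → ℝ) (z : V → ℝ) {x : V}
    (hx : x ∉ Λ) : HasSum (genFunTerm Λ (fun η => (η x : ℝ) * g η) z) 0 := by
  refine hasSum_zero.congr_fun fun k => ?_
  rw [genFunTerm_eq, extendZero_of_notMem _ hx]
  simp

open scoped Classical in
/-- Splitting off the coordinate `x` of a multi-index. -/
noncomputable def insertEquiv {Λ : Finset V} {x : V} (hx : x ∉ Λ) :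
    (↥(insert x Λ : Finset V) → ℕ) ≃ ℕ × (Λ → ℕ) where
  toFun k := (k ⟨x, Finset.mem_insert_self x Λ⟩, fun i => k ⟨i, Finset.mem_insert_of_mem i.2⟩)
  invFun q i := if h : (i : V) ∈ Λ then q.2 ⟨i, h⟩ else q.1
  left_inv k := by
    ext i
    by_cases h : (i : V) ∈ Λ
    · simp [h]
    · have hi : (i : V) = x := (Finset.mem_insert.1 i.2).resolve_right h
      simp only [h, dite_false]
      exact congrArg k (Subtype.ext hi.symm)
  right_inv q := by
    ext i
    · simp [hx]
    · simp [i.2]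

open scoped Classical in
lemma genFunTerm_insert {Λ : Finset V} {x : V} (hx : x ∉ Λ) {g : (V → ℕ) → ℝ}
    (hg : DependsOn g (Λ : Set V)) (z : V → ℝ) (k : ↥(insert x Λ : Finset V) → ℕ) :
    genFunTerm (insert x Λ) g z k = poissonWeight (insertEquiv hx k).1 (z x) *
      genFunTerm Λ g z (insertEquiv hx k).2 := by
  have h1 : g (extendZero (insert x Λ) k) = g (extendZero Λ (insertEquiv hx k).2) := by
    refine hg fun i hi => ?_
    rw [extendZero_of_mem _ (Finset.mem_insert_of_mem hi), extendZero_of_mem _ hi]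
    rfl
  have h2 : prodWeight k (fun i => z i) = poissonWeight (insertEquiv hx k).1 (z x) *
      prodWeight (insertEquiv hx k).2 (fun i => z i) := by
    set F : V → ℝ := fun i => if h : i ∈ insert x Λ then poissonWeight (k ⟨i, h⟩) (z i) else 0
    have e1 : prodWeight k (fun i => z i) = ∏ i : ↥(insert x Λ : Finset V), F i :=
      Finset.prod_congr rfl fun i _ => by simp only [F, dif_pos i.2]
    have e2 : prodWeight (insertEquiv hx k).2 (fun i => z i) = ∏ i : Λ, F i :=
      Finset.prod_congr rfl fun i _ => by
        simp only [F, dif_pos (Finset.mem_insert_of_mem i.2)]; rfl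
    rw [e1, e2, Finset.prod_coe_sort (insert x Λ) F, Finset.prod_coe_sort Λ F,
      Finset.prod_insert hx]
    congr 1
    simp only [F, dif_pos (Finset.mem_insert_self x Λ)]
    rfl
  rw [genFunTerm_eq, genFunTerm_eq, h1, h2, mul_assoc]

/-- Each coordinate on which `g` does not depend contributes the sum of the Poisson weights, which
is one for every real parameter. -/
lemma hasSum_genFunTerm_of_subset {Λ Λ' : Finset V} (h : Λ ⊆ Λ') {g : (V → ℕ) → ℝ}
    (hg : DependsOn g (Λ : Set V)) {z : V → ℝ} {S : ℝ} (hS : HasSum (genFunTerm Λ g z) S) :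
    HasSum (genFunTerm Λ' g z) S := by
  classical
  have key : ∀ Δ : Finset V, HasSum (genFunTerm (Λ ∪ Δ) g z) S := by
    intro Δ
    induction Δ using Finset.induction_on with
    | empty => rwa [Finset.union_empty]
    | insert x Δ _ ih =>
      by_cases hx : x ∈ Λ ∪ Δ
      · rwa [Finset.union_insert, Finset.insert_eq_of_mem hx]
      · have hd : DependsOn g ((Λ ∪ Δ : Finset V) : Set V) :=
          hg.mono (by exact_mod_cast Finset.subset_union_left)
        have h1 := (hasSum_poissonWeight (z x)).mul ih (summable_mul_of_summable_norm
          (hasSum_poissonWeight (z x)).summable.norm ih.summable.norm)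
        rw [one_mul] at h1
        rw [Finset.union_insert]
        refine ((insertEquiv hx).hasSum_iff.2 h1).congr_fun fun k => ?_
        rw [genFunTerm_insert hx hd]
        rfl
  have := key Λ'
  rwa [Finset.union_eq_right.2 h] at this

/-- Moving the coordinates in `Λ` away from zero by `ε`, each in the direction of its sign, gives a
nearby point with absolute values `|z i| + ε`; absolute convergence there is convergence beyond `z`.
-/
lemma convergesBeyond_of_eventually {Λ : Finset V} {f : (V → ℕ) → ℝ} {z : V → ℝ}
    (h : ∀ᶠ w in 𝓝 z, Summable (genFunTerm Λ f w)) :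
    ConvergesBeyond (fun k : Λ → ℕ => f (extendZero Λ k)) (fun i => z i) := by
  classical
  set w : ℝ → V → ℝ := fun ε x => if x ∈ Λ then (if 0 ≤ z x then z x + ε else z x - ε) else z x
    with hw
  have hwc : Continuous w := by
    refine continuous_pi fun x => ?_
    simp only [hw]
    split_ifs <;> fun_prop
  have hw0 : w 0 = z := by ext x; simp [hw]
  have h1 : ∀ᶠ ε in 𝓝[>] (0 : ℝ), Summable (genFunTerm Λ f (w ε)) := by
    have := hwc.tendsto 0
    rw [hw0] at this
    exact (this.eventually h).filter_mono nhdsWithin_le_nhds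
  obtain ⟨ε, hε, hε0⟩ := (h1.and self_mem_nhdsWithin).exists
  have hε0' : 0 < ε := hε0
  have habs : ∀ i : Λ, |w ε i| = |z i| + ε := by
    intro i
    simp only [hw, i.2, if_true]
    split_ifs with hz
    · rw [abs_of_nonneg hz, abs_of_nonneg (by linarith)]
    · rw [abs_of_neg (not_le.1 hz), abs_of_neg (by linarith)]; ring
  refine ⟨fun i => |z i| + ε, fun i => by linarith, ?_⟩
  have h2 := hε.norm.mul_right (∏ i : Λ, Real.exp (w ε i))
  refine h2.congr fun k => ?_
  rw [genFunTerm_eq, norm_mul, prodWeight, norm_prod]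
  simp only [poissonWeight, norm_mul, norm_div, norm_pow, Real.norm_eq_abs, habs, Real.abs_exp,
    Nat.abs_cast]
  rw [Finset.prod_mul_distrib, mul_right_comm, mul_assoc (∏ i : Λ, (|z i| + ε) ^ k i / _),
    ← Finset.prod_mul_distrib]
  simp only [← Real.exp_add, neg_add_cancel, Real.exp_zero, Finset.prod_const_one, mul_one]
  rw [mul_comm]

/-- The increment of the generating function of `f` when a particle is added at `y`. -/
noncomputable def genFunDiff (Λ : Finset V) (f : (V → ℕ) → ℝ) (z : V → ℝ) (y : V) : ℝ :=
  genFun Λ (fun η => f (addParticle η y)) z - genFun Λ f z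

lemma genFunDiff_of_notMem {Λ : Finset V} {f : (V → ℕ) → ℝ} (hf : DependsOn f (Λ : Set V))
    (z : V → ℝ) {y : V} (hy : y ∉ Λ) : genFunDiff Λ f z y = 0 := by
  simp [genFunDiff, hf.addParticle_eq hy]

lemma summable_genFunTerm_addParticle {Λ : Finset V} {f : (V → ℕ) → ℝ} {z : V → ℝ}
    (hf : DependsOn f (Λ : Set V))
    (h : ConvergesBeyond (fun k : Λ → ℕ => f (extendZero Λ k)) (fun i => z i)) (y : V) :
    Summable (genFunTerm Λ (fun η => f (addParticle η y)) z) := by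
  classical
  by_cases hy : y ∈ Λ
  · refine (h.summable_bump ⟨y, hy⟩).congr fun k => ?_
    rw [genFunTerm_eq, extendZero_bump]
  · simp only [hf.addParticle_eq hy]
    exact h.summable

open scoped Classical in
lemma hasFDerivAt_genFun {Λ : Finset V} {f : (V → ℕ) → ℝ} {z : V → ℝ}
    (h : ConvergesBeyond (fun k : Λ → ℕ => f (extendZero Λ k)) (fun i => z i)) :
    HasFDerivAt (fun v : Λ → ℝ => ∑' k, prodWeight k v * f (extendZero Λ k))
      (∑ i : Λ, genFunDiff Λ f z i • (ContinuousLinearMap.proj i : (Λ → ℝ) →L[ℝ] ℝ))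
      (fun i => z i) := by
  refine h.hasFDerivAt.congr_fderiv (Finset.sum_congr rfl fun i _ => ?_)
  simp only [extendZero_bump]
  rfl

/-- The chain rule for the generating function along a curve. -/
lemma hasDerivWithinAt_genFun {Λ : Finset V} {f : (V → ℕ) → ℝ} {c : ℝ → V → ℝ} {c' : V → ℝ}
    {s : Set ℝ} {t : ℝ}
    (h : ConvergesBeyond (fun k : Λ → ℕ => f (extendZero Λ k)) (fun i => c t i))
    (hc : ∀ x ∈ Λ, HasDerivWithinAt (fun t => c t x) (c' x) s t) :
    HasDerivWithinAt (fun t => genFun Λ f (c t)) (∑ x ∈ Λ, genFunDiff Λ f (c t) x * c' x) s t := by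
  classical
  have h1 : HasDerivWithinAt (fun t => fun i : Λ => c t i) (fun i : Λ => c' i) s t :=
    hasDerivWithinAt_pi.2 fun i => hc i i.2
  have h2 := (hasFDerivAt_genFun h).comp_hasDerivWithinAt t h1
  refine h2.congr_deriv ?_
  rw [← Finset.sum_coe_sort Λ]
  simp

lemma hasDerivAt_genFun_kron {Λ : Finset V} {f : (V → ℕ) → ℝ} {z : V → ℝ}
    (hf : DependsOn f (Λ : Set V))
    (h : ConvergesBeyond (fun k : Λ → ℕ => f (extendZero Λ k)) (fun i => z i)) (x : V) :
    HasDerivAt (fun s : ℝ => genFun Λ f (fun y => z y + s * kron x y)) (genFunDiff Λ f z x) 0 := by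
  classical
  rw [← hasDerivWithinAt_univ]
  have hz : (fun y => z y + (0 : ℝ) * kron x y) = z := by ext y; simp
  have h1 := hasDerivWithinAt_genFun (c := fun s y => z y + s * kron x y) (c' := kron x)
    (s := Set.univ) (t := 0) (f := f) (Λ := Λ) (by simpa using h) fun y _ => by
      have := ((hasDerivAt_id (0 : ℝ)).mul_const (kron x y)).const_add (z y)
      rw [one_mul] at this
      exact this.hasDerivWithinAt
  refine h1.congr_deriv ?_
  simp only [hz]
  by_cases hx : x ∈ Λ
  · rw [Finset.sum_eq_single_of_mem x hx, kron_self, mul_one]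
    intro y _ hy
    rw [kron_of_ne hy, mul_zero]
  · rw [genFunDiff_of_notMem hf z hx]
    refine Finset.sum_eq_zero fun y hy => ?_
    rw [kron_of_ne fun h => hx (by rw [← h]; exact hy), mul_zero]

end Configurations

/-! ### The intertwining relation -/

section Intertwining
variable {V : Type*} {Λ Λ' : Finset V} {f : (V → ℕ) → ℝ} {z : V → ℝ}

lemma genFunTerm_add (g₁ g₂ : (V → ℕ) → ℝ) (z : V → ℝ) (k : Λ → ℕ) :
    genFunTerm Λ (fun η => g₁ η + g₂ η) z k = genFunTerm Λ g₁ z k + genFunTerm Λ g₂ z k := by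
  simp only [genFunTerm_eq]; ring

lemma genFunTerm_const_mul (c : ℝ) (g : (V → ℕ) → ℝ) (z : V → ℝ) (k : Λ → ℕ) :
    genFunTerm Λ (fun η => c * g η) z k = c * genFunTerm Λ g z k := by
  simp only [genFunTerm_eq]; ring

/-- Mecke identity at the site of departure: a particle added at `x` and moved to `y` is a particle
added at `y`. The indicator appears since configurations vanish off `Λ'`. The value `β = -1` gives
increments, `β = 1` gives the majorant used for Fubini. -/
lemma hasSum_jumpOut (hΛ : Λ ⊆ Λ') (hf : DependsOn f (Λ : Set V))
    (h : ConvergesBeyond (fun k : Λ → ℕ => f (extendZero Λ k)) (fun i => z i)) (x y : V) (β : ℝ) :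
    HasSum (genFunTerm Λ' (fun η => (η x : ℝ) * (f (moveParticle η x y) + β * f η)) z)
      ((Λ' : Set V).indicator z x *
        (genFun Λ (fun η => f (addParticle η y)) z +
          β * genFun Λ (fun η => f (addParticle η x)) z)) := by
  by_cases hx : x ∈ Λ'
  · rw [Set.indicator_of_mem (by exact_mod_cast hx)]
    refine hasSum_genFunTerm_mul (g := fun η => f (moveParticle η x y) + β * f η) hx ?_
    simp only [moveParticle_addParticle]
    have h1 := hasSum_genFunTerm_of_subset hΛ (hf.comp_addParticle y)
      (summable_genFunTerm_addParticle hf h y).hasSum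
    have h2 := hasSum_genFunTerm_of_subset hΛ (hf.comp_addParticle x)
      (summable_genFunTerm_addParticle hf h x).hasSum
    refine (h1.add (h2.mul_left β)).congr_fun fun k => ?_
    rw [genFunTerm_add, genFunTerm_const_mul]
  · rw [Set.indicator_of_notMem (by exact_mod_cast hx), zero_mul]
    exact hasSum_genFunTerm_mul_of_notMem _ z hx

/-- Opposite jumps see opposite differences `D y - D x`, so their coefficients, the truncated `z x`
and `z y`, are subtracted. -/
lemma hasSum_edgeJump (hΛ : Λ ⊆ Λ') (hf : DependsOn f (Λ : Set V))
    (h : ConvergesBeyond (fun k : Λ → ℕ => f (extendZero Λ k)) (fun i => z i)) (x y : V) :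
    HasSum (genFunTerm Λ' (fun η => edgeJump f η x y) z)
      (((Λ' : Set V).indicator z x - (Λ' : Set V).indicator z y) *
        (genFunDiff Λ f z y - genFunDiff Λ f z x)) := by
  have h1 := (hasSum_jumpOut hΛ hf h x y (-1)).add (hasSum_jumpOut hΛ hf h y x (-1))
  convert h1.congr_fun fun k => ?_ using 1
  · simp only [genFunDiff]; ring
  · rw [← genFunTerm_add]
    congr 1
    ext η
    rw [edgeJump]; ring

/-- The two jumps across an edge, with increments replaced by the sum of the absolute values. -/
noncomputable def edgeAbs (f : (V → ℕ) → ℝ) (η : V → ℕ) (x y : V) : ℝ :=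
  (η x : ℝ) * (|f (moveParticle η x y)| + 1 * |f η|) +
    (η y : ℝ) * (|f (moveParticle η y x)| + 1 * |f η|)

lemma abs_edgeJump_le (f : (V → ℕ) → ℝ) (η : V → ℕ) (x y : V) :
    |edgeJump f η x y| ≤ edgeAbs f η x y := by
  refine (abs_add_le _ _).trans (add_le_add ?_ ?_) <;>
  · rw [abs_mul, Nat.abs_cast, one_mul]
    exact mul_le_mul_of_nonneg_left (abs_sub _ _) (Nat.cast_nonneg _)

/-- A bound of the generating functions of `|f|` with at most one particle added. -/
noncomputable def genFunAbsBound (Λ : Finset V) (f : (V → ℕ) → ℝ) (z : V → ℝ) : ℝ :=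
  genFun Λ (fun η => |f η|) (fun x => |z x|) +
    ∑ y ∈ Λ, genFun Λ (fun η => |f (addParticle η y)|) (fun x => |z x|)

lemma genFun_nonneg {g : (V → ℕ) → ℝ} (hg : ∀ η, 0 ≤ g η) (hz : ∀ x, 0 ≤ z x) :
    0 ≤ genFun Λ g z :=
  tsum_nonneg fun _ => mul_nonneg (Finset.prod_nonneg fun i _ => poissonWeight_nonneg (hz i) _)
    (hg _)

lemma genFun_addParticle_le_genFunAbsBound (hf : DependsOn f (Λ : Set V)) (y : V) :
    genFun Λ (fun η => |f (addParticle η y)|) (fun x => |z x|) ≤ genFunAbsBound Λ f z := by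
  have h0 : ∀ y, 0 ≤ genFun Λ (fun η => |f (addParticle η y)|) (fun x => |z x|) := fun y =>
    genFun_nonneg (fun _ => abs_nonneg _) fun _ => abs_nonneg _
  have h1 : 0 ≤ genFun Λ (fun η => |f η|) (fun x => |z x|) :=
    genFun_nonneg (fun _ => abs_nonneg _) fun _ => abs_nonneg _
  by_cases hy : y ∈ Λ
  · have := Finset.single_le_sum (f := fun y =>
      genFun Λ (fun η => |f (addParticle η y)|) (fun x => |z x|)) (fun y _ => h0 y) hy
    simp only [genFunAbsBound]
    linarith
  · simp only [hf.addParticle_eq hy, genFunAbsBound]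
    have := Finset.sum_nonneg (s := Λ) fun y _ => h0 y
    linarith

lemma ConvergesBeyond.abs {ι : Type*} [Fintype ι] [DecidableEq ι] {a : (ι → ℕ) → ℝ} {z : ι → ℝ}
    (h : ConvergesBeyond a z) : ConvergesBeyond (fun k => |a k|) (fun i => |z i|) := by
  obtain ⟨R, hR, hs⟩ := h
  exact ⟨R, by simpa using hR, by simpa using hs⟩

lemma DependsOn.abs (hf : DependsOn f (Λ : Set V)) : DependsOn (fun η => |f η|) (Λ : Set V) :=
  fun _ _ h => congrArg _ (hf h)

/-- The bound does not depend on `Λ'` and depends on the edge only through `|z x| + |z y|`, which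
the hypothesis on the rates makes summable. -/
lemma exists_hasSum_edgeAbs (hΛ : Λ ⊆ Λ') (hf : DependsOn f (Λ : Set V))
    (h : ConvergesBeyond (fun k : Λ → ℕ => f (extendZero Λ k)) (fun i => z i)) (x y : V) :
    ∃ S, HasSum (genFunTerm Λ' (fun η => edgeAbs f η x y) (fun x => |z x|)) S ∧
      S ≤ 2 * genFunAbsBound Λ f z * (|z x| + |z y|) := by
  classical
  have h1 := (hasSum_jumpOut (f := fun η => |f η|) (z := fun x => |z x|) hΛ hf.abs h.abs x y 1).add
    (hasSum_jumpOut (f := fun η => |f η|) (z := fun x => |z x|) hΛ hf.abs h.abs y x 1)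
  refine ⟨_, h1.congr_fun fun k => by rw [← genFunTerm_add]; rfl, ?_⟩
  have hi : ∀ u, (Λ' : Set V).indicator (fun x => |z x|) u ≤ |z u| := fun u =>
    Set.indicator_le_self' (fun _ _ => abs_nonneg _) u
  have hs : ∀ u v, (Λ' : Set V).indicator (fun x => |z x|) u *
      (genFun Λ (fun η => |f (addParticle η v)|) (fun x => |z x|) +
        1 * genFun Λ (fun η => |f (addParticle η u)|) (fun x => |z x|)) ≤
      |z u| * (2 * genFunAbsBound Λ f z) := fun u v =>
    mul_le_mul (hi u) (by
      have hu := genFun_addParticle_le_genFunAbsBound (z := z) hf u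
      have hv := genFun_addParticle_le_genFunAbsBound (z := z) hf v
      linarith) (by
      rw [one_mul]
      exact add_nonneg (genFun_nonneg (fun _ => abs_nonneg _) fun _ => abs_nonneg _)
        (genFun_nonneg (fun _ => abs_nonneg _) fun _ => abs_nonneg _)) (abs_nonneg _)
  have := hs x y
  have := hs y x
  linarith

/-- Negative coordinates of `z` are handled by passing to `|z|`, at the price of a factor
independent of `k`. -/
lemma abs_prodWeight {ι : Type*} [Fintype ι] (k : ι → ℕ) (z : ι → ℝ) :
    |prodWeight k z| =
      (∏ i, Real.exp (|z i| - z i)) * prodWeight k (fun i => |z i|) := by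
  rw [prodWeight, prodWeight, Finset.abs_prod, ← Finset.prod_mul_distrib]
  refine Finset.prod_congr rfl fun i _ => ?_
  rw [poissonWeight, poissonWeight, abs_mul, abs_div, abs_pow, Nat.abs_cast, Real.abs_exp,
    sub_eq_add_neg, Real.exp_add, Real.exp_neg (|z i|)]
  field_simp

lemma genFunDiff_sub_eq_zero (hf : DependsOn f (Λ : Set V)) {e : V × V}
    (he : ¬(e.1 ∈ Λ ∨ e.2 ∈ Λ)) : genFunDiff Λ f z e.2 - genFunDiff Λ f z e.1 = 0 := by
  push Not at he
  rw [genFunDiff_of_notMem hf z he.1, genFunDiff_of_notMem hf z he.2, sub_zero]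

end Intertwining

namespace SymmRates
variable {V : Type*} (R : SymmRates V) {Λ Λ' : Finset V} {f : (V → ℕ) → ℝ} {z : V → ℝ}

lemma summable_row_prod {x : V} {g : V × V → ℝ} (h : Summable fun y => g (x, y)) :
    Summable ((Prod.fst ⁻¹' {x} : Set (V × V)).indicator g) := by
  rw [← (Prod.mk_right_injective x).summable_iff]
  · refine h.congr fun y => ?_
    simp
  · rintro ⟨a, b⟩ hab
    refine Set.indicator_of_notMem ?_ _
    rintro rfl
    exact hab ⟨b, rfl⟩

lemma summable_column_prod {x : V} {g : V × V → ℝ} (h : Summable fun y => g (y, x)) :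
    Summable ((Prod.snd ⁻¹' {x} : Set (V × V)).indicator g) := by
  rw [← (Prod.mk_left_injective x).summable_iff]
  · refine h.congr fun y => ?_
    simp
  · rintro ⟨a, b⟩ hab
    refine Set.indicator_of_notMem ?_ _
    rintro rfl
    exact hab ⟨a, rfl⟩

/-- The ordered pairs with an end in `Λ`. -/
def touching (Λ : Finset V) : Set (V × V) := {e | e.1 ∈ Λ ∨ e.2 ∈ Λ}

/-- The weight `p x y (|z x| + |z y|)` of the pairs `(x, y)` with an end in `Λ`. -/
noncomputable def touchWeight (Λ : Finset V) (z : V → ℝ) : V × V → ℝ :=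
  (touching Λ).indicator fun e => R.p e.1 e.2 * (|z e.1| + |z e.2|)

lemma touchWeight_nonneg (e : V × V) : 0 ≤ R.touchWeight Λ z e :=
  Set.indicator_nonneg (fun _ _ => mul_nonneg (R.nonneg _ _) (by positivity)) _

/-- The pairs that touch `Λ` are covered by finitely many rows and columns, and the columns equal
the rows by symmetry of `p`. -/
lemma summable_touchWeight (hz : ∀ x ∈ Λ, Summable fun y => R.p x y * |z y|) :
    Summable (R.touchWeight Λ z) := by
  set g : V × V → ℝ := fun e => R.p e.1 e.2 * (|z e.1| + |z e.2|) with hg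
  have hg0 : ∀ e, 0 ≤ g e := fun e => mul_nonneg (R.nonneg _ _) (by positivity)
  have hr : ∀ x ∈ Λ, Summable fun y => g (x, y) := by
    intro x hx
    refine (((R.summable_row x).mul_right |z x|).add (hz x hx)).congr fun y => ?_
    simp only [hg]; ring
  have hc : ∀ x ∈ Λ, Summable fun y => g (y, x) := by
    intro x hx
    refine (hr x hx).congr fun y => ?_
    simp only [hg, R.symm y x]; ring
  have hs : Summable fun e => ∑ x ∈ Λ, ((Prod.fst ⁻¹' {x} : Set (V × V)).indicator g e +
      (Prod.snd ⁻¹' {x} : Set (V × V)).indicator g e) :=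
    summable_sum fun x hx => (summable_row_prod (hr x hx)).add (summable_column_prod (hc x hx))
  have h0 : ∀ (s : Set (V × V)) e, 0 ≤ s.indicator g e := fun s e =>
    Set.indicator_nonneg (fun e _ => hg0 e) e
  refine Summable.of_nonneg_of_le R.touchWeight_nonneg (fun e => ?_) hs
  by_cases he : e ∈ touching Λ
  · rw [touchWeight, Set.indicator_of_mem he]
    rcases he with he | he
    · refine le_trans ?_ (Finset.single_le_sum (fun x _ => add_nonneg (h0 _ e) (h0 _ e)) he)
      rw [Set.indicator_of_mem (show e ∈ Prod.fst ⁻¹' {e.1} from rfl)]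
      exact le_add_of_nonneg_right (h0 _ e)
    · refine le_trans ?_ (Finset.single_le_sum (fun x _ => add_nonneg (h0 _ e) (h0 _ e)) he)
      rw [Set.indicator_of_mem (show e ∈ Prod.snd ⁻¹' {e.2} from rfl)]
      exact le_add_of_nonneg_left (h0 _ e)
  · rw [touchWeight, Set.indicator_of_notMem he]
    exact Finset.sum_nonneg fun x _ => add_nonneg (h0 _ e) (h0 _ e)

/-- Absolute summability over edges and multi-indices jointly, which licenses the exchange of the
two sums. Edges not touching `Λ` do not change `f`. -/
lemma summable_edge_prod (hΛ : Λ ⊆ Λ') (hf : DependsOn f (Λ : Set V))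
    (h : ConvergesBeyond (fun k : Λ → ℕ => f (extendZero Λ k)) (fun i => z i))
    (hz : ∀ x ∈ Λ, Summable fun y => R.p x y * |z y|) :
    Summable fun q : (V × V) × (Λ' → ℕ) =>
      R.p q.1.1 q.1.2 * genFunTerm Λ' (fun η => edgeJump f η q.1.1 q.1.2) z q.2 := by
  rw [← summable_norm_iff]
  set C : ℝ := ∏ i : Λ', Real.exp (|z i| - z i)
  have hC : 0 ≤ C := Finset.prod_nonneg fun i _ => (Real.exp_pos _).le
  choose S hS hSle using fun x y => exists_hasSum_edgeAbs hΛ hf h x y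
  have hS0 : ∀ x y, HasSum (fun k : Λ' → ℕ =>
      R.p x y * (C * genFunTerm Λ' (fun η => edgeAbs f η x y) (fun x => |z x|) k))
      (R.p x y * (C * S x y)) := fun x y => ((hS x y).mul_left C).mul_left _
  have hle : ∀ e : V × V, ∀ k : Λ' → ℕ,
      ‖R.p e.1 e.2 * genFunTerm Λ' (fun η => edgeJump f η e.1 e.2) z k‖ ≤
      R.p e.1 e.2 * (C * genFunTerm Λ' (fun η => edgeAbs f η e.1 e.2) (fun x => |z x|) k) := by
    intro e k
    rw [norm_mul, Real.norm_of_nonneg (R.nonneg _ _), Real.norm_eq_abs]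
    refine mul_le_mul_of_nonneg_left ?_ (R.nonneg _ _)
    rw [genFunTerm_eq, genFunTerm_eq, abs_mul, abs_prodWeight, ← mul_assoc]
    exact mul_le_mul_of_nonneg_left (abs_edgeJump_le _ _ _ _) (mul_nonneg hC
      (Finset.prod_nonneg fun i _ => poissonWeight_nonneg (abs_nonneg _) _))
  have hrow : ∀ e : V × V, Summable fun k : Λ' → ℕ =>
      ‖R.p e.1 e.2 * genFunTerm Λ' (fun η => edgeJump f η e.1 e.2) z k‖ := fun e =>
    Summable.of_nonneg_of_le (fun _ => norm_nonneg _) (hle e) (hS0 e.1 e.2).summable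
  rw [summable_prod_of_nonneg fun _ => norm_nonneg _]
  refine ⟨hrow, ?_⟩
  refine Summable.of_nonneg_of_le (fun e => tsum_nonneg fun _ => norm_nonneg _) (fun e => ?_)
    ((R.summable_touchWeight hz).mul_left (C * (2 * genFunAbsBound Λ f z)))
  by_cases he : e ∈ touching Λ
  · refine ((hrow e).tsum_le_tsum (hle e) (hS0 e.1 e.2).summable).trans ?_
    rw [(hS0 e.1 e.2).tsum_eq, touchWeight, Set.indicator_of_mem he]
    calc R.p e.1 e.2 * (C * S e.1 e.2)
        ≤ R.p e.1 e.2 * (C * (2 * genFunAbsBound Λ f z * (|z e.1| + |z e.2|))) :=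
          mul_le_mul_of_nonneg_left (mul_le_mul_of_nonneg_left (hSle _ _) hC) (R.nonneg _ _)
      _ = _ := by ring
  · rw [touchWeight, Set.indicator_of_notMem he, mul_zero]
    simp only [touching, Set.mem_ofPred_eq, not_or] at he
    refine le_of_eq ?_
    simp [hf.edgeJump_eq_zero he.1 he.2, genFunTerm]

/-- For a finite `Λ'` the result is the flow with velocities computed from `z` truncated to `Λ'`;
only the limit over `Λ'` restores `z`. -/
lemma hasSum_genIRW (hΛ : Λ ⊆ Λ') (hf : DependsOn f (Λ : Set V))
    (h : ConvergesBeyond (fun k : Λ → ℕ => f (extendZero Λ k)) (fun i => z i))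
    (hz : ∀ x ∈ Λ, Summable fun y => R.p x y * |z y|) (o : V) (lam : ℝ) :
    HasSum (genFunTerm Λ' (R.genIRW o lam f) z)
      (1 / 2 * (∑' e : V × V, R.p e.1 e.2 *
        (((Λ' : Set V).indicator z e.1 - (Λ' : Set V).indicator z e.2) *
          (genFunDiff Λ f z e.2 - genFunDiff Λ f z e.1))) + lam * genFunDiff Λ f z o) := by
  classical
  have h1 := R.summable_edge_prod hΛ hf h hz
  set F : V × V → (Λ' → ℕ) → ℝ := fun e k =>
    R.p e.1 e.2 * genFunTerm Λ' (fun η => edgeJump f η e.1 e.2) z k with hF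
  have h3 : HasSum (fun k : Λ' → ℕ => ∑' e : V × V, F e k)
      (∑' e : V × V, R.p e.1 e.2 *
        (((Λ' : Set V).indicator z e.1 - (Λ' : Set V).indicator z e.2) *
          (genFunDiff Λ f z e.2 - genFunDiff Λ f z e.1))) := by
    have h4 : Summable fun k : Λ' → ℕ => ∑' e : V × V, F e k :=
      Summable.prod (f := fun q : (Λ' → ℕ) × (V × V) => F q.2 q.1) h1.prod_symm
    have h5 : ∑' k, ∑' e, F e k = ∑' e, ∑' k, F e k := Summable.tsum_comm (f := F) h1
    have h6 : ∀ e : V × V, ∑' k, F e k = R.p e.1 e.2 *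
        (((Λ' : Set V).indicator z e.1 - (Λ' : Set V).indicator z e.2) *
          (genFunDiff Λ f z e.2 - genFunDiff Λ f z e.1)) := fun e =>
      ((hasSum_edgeJump hΛ hf h e.1 e.2).mul_left _).tsum_eq
    simp only [h6] at h5
    rw [← h5]
    exact h4.hasSum
  have h6 := (hasSum_genFunTerm_of_subset hΛ (hf.comp_addParticle o)
      (summable_genFunTerm_addParticle hf h o).hasSum).sub
      (hasSum_genFunTerm_of_subset hΛ hf (S := genFun Λ f z) h.summable.hasSum)
  refine ((h3.mul_left (1 / 2)).add (h6.mul_left lam)).congr_fun fun k => ?_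
  have h7 : ∑' e : V × V, F e k =
      prodWeight k (fun i => z i) *
        ∑' e : V × V, R.p e.1 e.2 * edgeJump f (extendZero Λ' k) e.1 e.2 := by
    rw [← tsum_mul_left]
    exact tsum_congr fun e => by simp only [hF, genFunTerm_eq]; ring
  rw [h7]
  simp only [genFunTerm_eq, genIRW]
  ring

/-- Allowing any `u` dominated by `z` covers both `z` itself and all its truncations with the same
constant. -/
lemma exists_abs_flow_le (hf : DependsOn f (Λ : Set V)) (z : V → ℝ) :
    ∃ C, ∀ u : V → ℝ, (∀ x, |u x| ≤ |z x|) → ∀ e : V × V, |R.p e.1 e.2 * ((u e.1 - u e.2) *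
      (genFunDiff Λ f z e.2 - genFunDiff Λ f z e.1))| ≤ C * R.touchWeight Λ z e := by
  have hD : ∀ y, |genFunDiff Λ f z y| ≤ ∑ x ∈ Λ, |genFunDiff Λ f z x| := by
    intro y
    by_cases hy : y ∈ Λ
    · exact Finset.single_le_sum (f := fun x => |genFunDiff Λ f z x|) (fun _ _ => abs_nonneg _) hy
    · rw [genFunDiff_of_notMem hf z hy, abs_zero]
      exact Finset.sum_nonneg fun _ _ => abs_nonneg _
  set D := ∑ x ∈ Λ, |genFunDiff Λ f z x|
  refine ⟨2 * D, fun u hu e => ?_⟩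
  by_cases he : e ∈ touching Λ
  · rw [touchWeight, Set.indicator_of_mem he, abs_mul, abs_mul, abs_of_nonneg (R.nonneg _ _)]
    have h1 : |u e.1 - u e.2| ≤ |z e.1| + |z e.2| :=
      (abs_sub _ _).trans (add_le_add (hu _) (hu _))
    have h2 : |genFunDiff Λ f z e.2 - genFunDiff Λ f z e.1| ≤ 2 * D :=
      (abs_sub _ _).trans (by linarith [hD e.1, hD e.2])
    calc R.p e.1 e.2 * (|u e.1 - u e.2| * |genFunDiff Λ f z e.2 - genFunDiff Λ f z e.1|)
        ≤ R.p e.1 e.2 * ((|z e.1| + |z e.2|) * (2 * D)) :=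
          mul_le_mul_of_nonneg_left (mul_le_mul h1 h2 (abs_nonneg _) (by positivity))
            (R.nonneg _ _)
      _ = _ := by ring
  · rw [genFunDiff_sub_eq_zero hf he, touchWeight, Set.indicator_of_notMem he]
    simp

lemma flowTerm_genFun (hf : DependsOn f (Λ : Set V))
    (h : ConvergesBeyond (fun k : Λ → ℕ => f (extendZero Λ k)) (fun i => z i)) (e : V × V) :
    R.flowTerm (genFun Λ f) z e = R.p e.1 e.2 * ((z e.1 - z e.2) *
      (genFunDiff Λ f z e.2 - genFunDiff Λ f z e.1)) := by
  rw [flowTerm, partialDeriv, partialDeriv, (hasDerivAt_genFun_kron hf h _).deriv,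
    (hasDerivAt_genFun_kron hf h _).deriv]
  ring

lemma summable_flowTerm (hf : DependsOn f (Λ : Set V))
    (h : ConvergesBeyond (fun k : Λ → ℕ => f (extendZero Λ k)) (fun i => z i))
    (hz : ∀ x ∈ Λ, Summable fun y => R.p x y * |z y|) :
    Summable (R.flowTerm (genFun Λ f) z) := by
  obtain ⟨C, hC⟩ := R.exists_abs_flow_le hf z
  refine Summable.of_norm_bounded ((R.summable_touchWeight hz).mul_left C) fun e => ?_
  rw [R.flowTerm_genFun hf h, Real.norm_eq_abs]
  exact hC z (fun _ => le_rfl) e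

/-- The generating-function map intertwines the particle system and the flow. -/
theorem hasGenFun_genIRW (hf : DependsOn f (Λ : Set V))
    (h : ConvergesBeyond (fun k : Λ → ℕ => f (extendZero Λ k)) (fun i => z i))
    (hz : ∀ x ∈ Λ, Summable fun y => R.p x y * |z y|) (o : V) (lam : ℝ) :
    HasGenFun (R.genIRW o lam f) z (R.genFlow o lam (genFun Λ f) z) := by
  have hsum : ∀ᶠ Λ' : Finset V in atTop, HasSum (genFunTerm Λ' (R.genIRW o lam f) z) _ :=
    (eventually_ge_atTop Λ).mono fun Λ' hΛ => R.hasSum_genIRW hΛ hf h hz o lam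
  refine ⟨hsum.mono fun _ h => h.summable, ?_⟩
  refine Tendsto.congr' (hsum.mono fun _ h => h.tsum_eq.symm) ?_
  rw [genFlow, partialDeriv, (hasDerivAt_genFun_kron hf h _).deriv]
  refine (Tendsto.const_mul _ ?_).add_const _
  obtain ⟨C, hC⟩ := R.exists_abs_flow_le hf z
  -- For a fixed edge the truncation has no effect once `Λ'` contains both ends, and the bound by
  -- `touchWeight` is uniform in `Λ'`.
  refine tendsto_tsum_of_dominated_convergence ((R.summable_touchWeight hz).mul_left C)
    (fun e => ?_) (Eventually.of_forall fun Λ' e => ?_)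
  · rw [R.flowTerm_genFun hf h]
    refine Tendsto.const_mul _ (Tendsto.mul_const _ (Tendsto.sub ?_ ?_)) <;>
    · refine tendsto_const_nhds.congr' ?_
      filter_upwards [Filter.eventually_ge_atTop {_}] with Λ' hΛ
      exact (Set.indicator_of_mem (by exact_mod_cast Finset.singleton_subset_iff.1 hΛ) z).symm
  · rw [Real.norm_eq_abs]
    exact hC _ (fun x => by
      simpa only [Real.norm_eq_abs] using norm_indicator_le_norm_self z x) e

end SymmRates

/-! ### Integration against Poisson product measures -/

lemma integrable_tsum_of_summable_integral_norm {ι α : Type*} [Countable ι] {m : MeasurableSpace α}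
    {μ : Measure α} {F : ι → α → ℝ} (hF : ∀ i, Integrable (F i) μ)
    (hs : Summable fun i => ∫ a, ‖F i a‖ ∂μ) : Integrable (fun a => ∑' i, F i a) μ := by
  have h1 : ∑' i, ∫⁻ a, ‖F i a‖ₑ ∂μ ≠ ∞ := by
    have h2 : ∀ i, ∫⁻ a, ‖F i a‖ₑ ∂μ = ENNReal.ofReal (∫ a, ‖F i a‖ ∂μ) := fun i =>
      (ofReal_integral_norm_eq_lintegral_enorm (hF i)).symm
    simp only [h2]
    rw [← ENNReal.ofReal_tsum_of_nonneg (fun i => integral_nonneg fun _ => norm_nonneg _) hs]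
    exact ENNReal.ofReal_ne_top
  have hae : ∀ i, AEMeasurable (fun a => ‖F i a‖ₑ) μ := fun i => (hF i).1.enorm
  have h3 : ∫⁻ a, ∑' i, ‖F i a‖ₑ ∂μ ≠ ∞ := by rwa [lintegral_tsum hae]
  have h4 : ∀ᵐ a ∂μ, Summable fun i => F i a := by
    filter_upwards [ae_lt_top' (AEMeasurable.tsum hae) h3] with a ha
    exact Summable.of_enorm ha.ne
  refine ⟨?_, ?_⟩
  · refine aestronglyMeasurable_of_tendsto_ae (u := (atTop : Filter (Finset ι)))
      (f := fun s a => ∑ i ∈ s, F i a)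
      (fun s => Finset.aestronglyMeasurable_fun_sum s fun i _ => (hF i).1) ?_
    filter_upwards [h4] with a ha
    exact ha.hasSum
  · refine lt_of_le_of_lt (lintegral_mono fun a => ?_) h3.lt_top
    exact enorm_tsum_le_tsum_enorm

section PoissonProduct
variable {V : Type*}

instance (ρ : V → ℝ) : IsProbabilityMeasure (poissonProduct ρ) := by
  rw [poissonProduct]; infer_instance

lemma DependsOn.eq_comp_restrict {β : Type*} {Λ : Finset V} {g : (V → ℕ) → β}
    (hg : DependsOn g (Λ : Set V)) : g = (fun k : Λ → ℕ => g (extendZero Λ k)) ∘ Λ.restrict := by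
  ext η
  refine hg fun i hi => ?_
  rw [extendZero_of_mem _ hi]
  rfl

lemma DependsOn.measurable {β : Type*} [MeasurableSpace β] {Λ : Finset V} {g : (V → ℕ) → β}
    (hg : DependsOn g (Λ : Set V)) : Measurable g := by
  rw [hg.eq_comp_restrict]
  exact Measurable.of_discrete.comp (Finset.measurable_restrict Λ)

lemma poissonProduct_map_restrict (ρ : V → ℝ) (Λ : Finset V) :
    (poissonProduct ρ).map Λ.restrict =
      Measure.pi fun i : Λ => poissonMeasure (ρ i).toNNReal :=
  Measure.infinitePi_map_restrict _

lemma pi_poissonMeasure_singleton {Λ : Finset V} {ρ : V → ℝ} (hρ : ∀ x, 0 ≤ ρ x) (k : Λ → ℕ) :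
    (Measure.pi fun i : Λ => poissonMeasure (ρ i).toNNReal) {k} =
      ENNReal.ofReal (prodWeight k fun i => ρ i) := by
  rw [Measure.pi_singleton, prodWeight,
    ENNReal.ofReal_prod_of_nonneg (s := Finset.univ) (f := fun i : Λ => poissonWeight (k i) (ρ i))
      fun i _ => poissonWeight_nonneg (hρ i) _]
  refine Finset.prod_congr rfl fun i _ => ?_
  rw [poissonMeasure_singleton, Real.coe_toNNReal _ (hρ i), poissonWeight]
  congr 1
  ring

lemma lintegral_poissonProduct {Λ : Finset V} {ρ : V → ℝ} (hρ : ∀ x, 0 ≤ ρ x)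
    {g : (V → ℕ) → ℝ≥0∞} (hg : DependsOn g (Λ : Set V)) :
    ∫⁻ η, g η ∂(poissonProduct ρ) =
      ∑' k : Λ → ℕ, g (extendZero Λ k) * ENNReal.ofReal (prodWeight k fun i => ρ i) := by
  conv_lhs => rw [hg.eq_comp_restrict]
  have := lintegral_map (μ := poissonProduct ρ) (f := fun k : Λ → ℕ => g (extendZero Λ k))
    Measurable.of_discrete (Finset.measurable_restrict Λ)
  refine this.symm.trans ?_
  rw [poissonProduct_map_restrict, lintegral_countable']
  simp only [pi_poissonMeasure_singleton hρ]

lemma DependsOn.comp_right {β γ : Type*} {Λ : Finset V} {g : (V → ℕ) → β}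
    (hg : DependsOn g (Λ : Set V)) (φ : β → γ) : DependsOn (fun η => φ (g η)) (Λ : Set V) :=
  fun _ _ h => congrArg φ (hg h)

lemma integrable_poissonProduct {Λ : Finset V} {ρ : V → ℝ} (hρ : ∀ x, 0 ≤ ρ x)
    {g : (V → ℕ) → ℝ} (hg : DependsOn g (Λ : Set V)) (hs : Summable (genFunTerm Λ g ρ)) :
    Integrable g (poissonProduct ρ) := by
  refine ⟨hg.measurable.aestronglyMeasurable, ?_⟩
  rw [HasFiniteIntegral, lintegral_poissonProduct hρ (hg.comp_right fun a => ‖a‖ₑ)]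
  have h1 : ∀ k : Λ → ℕ, ‖g (extendZero Λ k)‖ₑ * ENNReal.ofReal (prodWeight k fun i => ρ i) =
      ENNReal.ofReal |genFunTerm Λ g ρ k| := by
    intro k
    have h0 : 0 ≤ prodWeight k fun i : Λ => ρ i :=
      Finset.prod_nonneg fun i _ => poissonWeight_nonneg (hρ i) _
    rw [genFunTerm_eq, abs_mul, abs_of_nonneg h0, ENNReal.ofReal_mul h0, mul_comm,
      Real.enorm_eq_ofReal_abs]
  simp only [h1]
  rw [← ENNReal.ofReal_tsum_of_nonneg (fun _ => abs_nonneg _) hs.abs]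
  exact ENNReal.ofReal_lt_top

/-- For nonnegative parameters the weights are probabilities; this is how series identities become
statements on expectations. -/
lemma integral_poissonProduct {Λ : Finset V} {ρ : V → ℝ} (hρ : ∀ x, 0 ≤ ρ x)
    {g : (V → ℕ) → ℝ} (hg : DependsOn g (Λ : Set V)) (hs : Summable (genFunTerm Λ g ρ)) :
    ∫ η, g η ∂(poissonProduct ρ) = genFun Λ g ρ := by
  have hi := integrable_poissonProduct hρ hg hs
  have h1 := hg.eq_comp_restrict
  rw [h1] at hi
  have hi' := (integrable_map_measure (Measurable.of_discrete.aestronglyMeasurable)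
    (Finset.measurable_restrict Λ).aemeasurable).2 hi
  have h2 := integral_map (μ := poissonProduct ρ) (Finset.measurable_restrict Λ).aemeasurable
    hi'.1
  conv_lhs => rw [h1]
  refine h2.symm.trans ?_
  rw [integral_countable hi', genFun]
  refine tsum_congr fun k => ?_
  rw [poissonProduct_map_restrict, measureReal_def, pi_poissonMeasure_singleton hρ,
    ENNReal.toReal_ofReal (show 0 ≤ prodWeight k fun i : Λ => ρ i from
      Finset.prod_nonneg fun i _ => poissonWeight_nonneg (hρ i) _)]
  rfl

lemma hasSum_genFunTerm_one (Λ : Finset V) (z : V → ℝ) :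
    HasSum (genFunTerm Λ (fun _ => (1 : ℝ)) z) 1 := by
  have h1 : HasSum (genFunTerm ∅ (fun _ : V → ℕ => (1 : ℝ)) z) 1 := by
    have := hasSum_unique (genFunTerm ∅ (fun _ : V → ℕ => (1 : ℝ)) z)
    simpa [genFunTerm] using this
  exact hasSum_genFunTerm_of_subset (Finset.empty_subset Λ) (fun _ _ _ => rfl) h1

/-- The series of a bounded function converges for all radii; `|z i| + 1` is an arbitrary choice. -/
lemma convergesBeyond_of_bounded {Λ : Finset V} {f : (V → ℕ) → ℝ} {C : ℝ} (hC : ∀ ξ, |f ξ| ≤ C)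
    (z : V → ℝ) : ConvergesBeyond (fun k : Λ → ℕ => f (extendZero Λ k)) (fun i => z i) := by
  have h2 := hasSum_genFunTerm_one Λ fun x => |z x| + 1
  refine ⟨fun i => |z i| + 1, fun i => by linarith, ?_⟩
  have h3 := h2.summable.mul_left (C * ∏ i : Λ, Real.exp (|z i| + 1))
  have h0 : ∀ k : Λ → ℕ, 0 ≤ ∏ i : Λ, (|z i| + 1) ^ k i / ((k i).factorial : ℝ) := fun k =>
    Finset.prod_nonneg fun i _ => by positivity
  refine Summable.of_nonneg_of_le (fun k => mul_nonneg (abs_nonneg _) (h0 k)) (fun k => ?_) h3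
  have h4 : C * (∏ i : Λ, Real.exp (|z i| + 1)) *
      genFunTerm Λ (fun _ => (1 : ℝ)) (fun x => |z x| + 1) k =
      C * ∏ i : Λ, (|z i| + 1) ^ k i / ((k i).factorial : ℝ) := by
    rw [genFunTerm, mul_one, mul_assoc, ← Finset.prod_mul_distrib]
    congr 1
    refine Finset.prod_congr rfl fun i _ => ?_
    rw [Real.exp_neg]
    field_simp
  rw [h4]
  exact mul_le_mul_of_nonneg_right (hC _) (h0 k)

open scoped Classical in
lemma dependsOn_edgeJump {Λ : Finset V} {f : (V → ℕ) → ℝ} (hf : DependsOn f (Λ : Set V))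
    (x y : V) : DependsOn (fun η => edgeJump f η x y) ((Λ ∪ {x, y} : Finset V) : Set V) := by
  have hmove : ∀ η ξ : V → ℕ, (∀ i ∈ Λ ∪ {x, y}, η i = ξ i) → ∀ a ∈ Λ ∪ {x, y},
      ∀ b, ∀ i ∈ Λ ∪ {x, y}, moveParticle η a b i = moveParticle ξ a b i := by
    intro η ξ h a ha b i hi
    simp only [moveParticle, h a ha]
    split_ifs
    · exact h i hi
    · by_cases hib : i = b
      · subst hib
        rw [addParticle_apply_self, addParticle_apply_self]
        simp only [Function.update_apply, h i hi]
      · rw [addParticle_apply_of_ne _ hib, addParticle_apply_of_ne _ hib]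
        simp only [Function.update_apply, h i hi]
  intro η ξ h
  replace h : ∀ i ∈ Λ ∪ {x, y}, η i = ξ i := fun i hi => h i (by exact_mod_cast hi)
  have hsub : ∀ i ∈ (Λ : Set V), i ∈ Λ ∪ {x, y} := fun i hi =>
    Finset.mem_union_left _ (by exact_mod_cast hi)
  have hx : x ∈ Λ ∪ {x, y} := by simp
  have hy : y ∈ Λ ∪ {x, y} := by simp
  simp only [edgeJump, h x hx, h y hy]
  rw [hf (fun i hi => h i (hsub i hi)), hf (fun i hi => hmove η ξ h x hx y i (hsub i hi)),
    hf (fun i hi => hmove η ξ h y hy x i (hsub i hi))]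

end PoissonProduct

namespace SymmRates
variable {V : Type*} [Countable V] (R : SymmRates V) {Λ : Finset V} {f : (V → ℕ) → ℝ} {z : V → ℝ}

/-- A single edge jump is a local function on `Λ ∪ {x, y}`. Over this set the truncation of `z` is
invisible at `x` and `y`, so no limit is needed. -/
lemma integrable_edgeJump (hz0 : ∀ x, 0 ≤ z x) (hf : DependsOn f (Λ : Set V))
    (h : ConvergesBeyond (fun k : Λ → ℕ => f (extendZero Λ k)) (fun i => z i)) (x y : V) :
    Integrable (fun η => edgeJump f η x y) (poissonProduct z) ∧
    ∫ η, edgeJump f η x y ∂(poissonProduct z) =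
      (z x - z y) * (genFunDiff Λ f z y - genFunDiff Λ f z x) ∧
    ∫ η, ‖edgeJump f η x y‖ ∂(poissonProduct z) ≤
      2 * genFunAbsBound Λ f z * (|z x| + |z y|) := by
  classical
  have hd := dependsOn_edgeJump hf x y
  have hs := hasSum_edgeJump (Λ' := Λ ∪ {x, y}) Finset.subset_union_left hf h x y
  rw [Set.indicator_of_mem (by simp), Set.indicator_of_mem (by simp)] at hs
  refine ⟨integrable_poissonProduct hz0 hd hs.summable, ?_, ?_⟩
  · rw [integral_poissonProduct hz0 hd hs.summable]
    exact hs.tsum_eq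
  · have h0 : ∀ k : ↥(Λ ∪ {x, y}) → ℕ, 0 ≤ prodWeight k fun i => z i := fun k =>
      Finset.prod_nonneg fun i _ => poissonWeight_nonneg (hz0 i) _
    have he : genFunTerm (Λ ∪ {x, y}) (fun η => ‖edgeJump f η x y‖) z =
        fun k => ‖genFunTerm (Λ ∪ {x, y}) (fun η => edgeJump f η x y) z k‖ := by
      ext k
      rw [genFunTerm_eq, genFunTerm_eq, norm_mul, Real.norm_of_nonneg (h0 k)]
    have hs' : Summable (genFunTerm (Λ ∪ {x, y}) (fun η => ‖edgeJump f η x y‖) z) := by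
      rw [he]; exact hs.summable.norm
    rw [integral_poissonProduct hz0 (hd.comp_right fun a => ‖a‖) hs']
    obtain ⟨S, hS, hSle⟩ := exists_hasSum_edgeAbs (Λ' := Λ ∪ {x, y}) Finset.subset_union_left hf h x y
    simp only [abs_of_nonneg (hz0 _)] at hS
    refine le_trans ?_ hSle
    rw [← hS.tsum_eq]
    refine hs'.tsum_le_tsum (fun k => ?_) hS.summable
    rw [genFunTerm_eq, genFunTerm_eq]
    exact mul_le_mul_of_nonneg_left (abs_edgeJump_le _ _ _ _) (h0 k)

/-- The generator applied to a local function is integrable under a Poisson product measure, and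
its integral is given by the flow of the generating function. -/
lemma integrable_genIRW (hz0 : ∀ x, 0 ≤ z x) (hf : DependsOn f (Λ : Set V))
    (h : ConvergesBeyond (fun k : Λ → ℕ => f (extendZero Λ k)) (fun i => z i))
    (hz : ∀ x ∈ Λ, Summable fun y => R.p x y * |z y|) (o : V) (lam : ℝ) :
    Integrable (R.genIRW o lam f) (poissonProduct z) ∧
    ∫ η, R.genIRW o lam f η ∂(poissonProduct z) = R.genFlow o lam (genFun Λ f) z := by
  classical
  have hi : ∀ e : V × V, Integrable (fun η => R.p e.1 e.2 * edgeJump f η e.1 e.2)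
      (poissonProduct z) := fun e => (integrable_edgeJump hz0 hf h e.1 e.2).1.const_mul _
  have hs : Summable fun e : V × V =>
      ∫ η, ‖R.p e.1 e.2 * edgeJump f η e.1 e.2‖ ∂(poissonProduct z) := by
    refine Summable.of_nonneg_of_le (fun e => integral_nonneg fun _ => norm_nonneg _) (fun e => ?_)
      ((R.summable_touchWeight hz).mul_left (2 * genFunAbsBound Λ f z))
    by_cases he : e ∈ touching Λ
    · rw [touchWeight, Set.indicator_of_mem he]
      simp only [norm_mul, Real.norm_of_nonneg (R.nonneg _ _)]
      rw [integral_const_mul]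
      calc _ ≤ R.p e.1 e.2 * (2 * genFunAbsBound Λ f z * (|z e.1| + |z e.2|)) :=
            mul_le_mul_of_nonneg_left (integrable_edgeJump hz0 hf h e.1 e.2).2.2 (R.nonneg _ _)
        _ = _ := by ring
    · rw [touchWeight, Set.indicator_of_notMem he, mul_zero]
      simp only [touching, Set.mem_ofPred_eq, not_or] at he
      simp [hf.edgeJump_eq_zero he.1 he.2]
  have h1 := hasSum_integral_of_summable_integral_norm hi hs
  have h2 := integrable_tsum_of_summable_integral_norm hi hs
  have h3 := summable_genFunTerm_addParticle hf h o
  have h4 := integrable_poissonProduct hz0 (hf.comp_addParticle o) h3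
  have h5 := integrable_poissonProduct hz0 hf h.summable
  have hd : Integrable (fun η => lam * (f (addParticle η o) - f η)) (poissonProduct z) :=
    (h4.sub h5).const_mul lam
  refine ⟨(h2.const_mul (1 / 2)).add hd, ?_⟩
  have h6 : ∫ η, (f (addParticle η o) - f η) ∂(poissonProduct z) = genFunDiff Λ f z o := by
    rw [integral_sub h4 h5, integral_poissonProduct hz0 (hf.comp_addParticle o) h3,
      integral_poissonProduct hz0 hf h.summable, genFunDiff]
  have h7 : ∫ η, R.genIRW o lam f η ∂(poissonProduct z) =
      ∫ η, 1 / 2 * (∑' e : V × V, R.p e.1 e.2 * edgeJump f η e.1 e.2) ∂(poissonProduct z) +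
        ∫ η, lam * (f (addParticle η o) - f η) ∂(poissonProduct z) :=
    integral_add (h2.const_mul (1 / 2)) hd
  rw [h7, integral_const_mul, integral_const_mul, h6, ← h1.tsum_eq, genFlow, partialDeriv,
    (hasDerivAt_genFun_kron hf h _).deriv]
  congr 3
  ext e
  rw [R.flowTerm_genFun hf h, integral_const_mul, (integrable_edgeJump hz0 hf h e.1 e.2).2.1]

/-- The flow of a local function in terms of the velocity field of the linear system. -/
lemma genFlow_genFun (hf : DependsOn f (Λ : Set V))
    (h : ConvergesBeyond (fun k : Λ → ℕ => f (extendZero Λ k)) (fun i => z i))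
    (hz : ∀ x ∈ Λ, Summable fun y => R.p x y * |z y|) (o : V) (lam : ℝ) :
    R.genFlow o lam (genFun Λ f) z =
      ∑ x ∈ Λ, genFunDiff Λ f z x * (R.genRW z x + lam * kron o x) := by
  classical
  have hrow : ∀ x ∈ Λ, Summable fun y => R.p x y * (z x - z y) := by
    intro x hx
    have h1 : Summable fun y => R.p x y * z y := by
      refine Summable.of_norm ((hz x hx).congr fun y => ?_)
      rw [norm_mul, Real.norm_of_nonneg (R.nonneg _ _), Real.norm_eq_abs]
    refine (((R.summable_row x).mul_right (z x)).sub h1).congr fun y => ?_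
    ring
  -- The part of the edge term carrying the derivative at the first end. The flow term is minus `A`
  -- and its swap, and the rows of `A` sum to multiples of `-L z`; the two equal sums cancel the
  -- factor `1 / 2`.
  set A : V × V → ℝ := fun e => R.p e.1 e.2 * (z e.1 - z e.2) * genFunDiff Λ f z e.1 with hA
  have hAsum : HasSum A (-∑ x ∈ Λ, genFunDiff Λ f z x * R.genRW z x) := by
    have h1 : ∀ x ∈ Λ, HasSum ((Prod.fst ⁻¹' {x} : Set (V × V)).indicator A)
        (-(genFunDiff Λ f z x * R.genRW z x)) := by
      intro x hx
      rw [← (Prod.mk_right_injective x).hasSum_iff]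
      · have h2 : HasSum (fun y => R.p x y * (z x - z y)) (-R.genRW z x) := by
          rw [genRW, ← tsum_neg]
          simp only [← mul_neg, neg_sub]
          exact (hrow x hx).hasSum
        rw [mul_comm, ← neg_mul]
        refine (h2.mul_right (genFunDiff Λ f z x)).congr_fun fun y => ?_
        rw [Function.comp_apply, Set.indicator_of_mem (by rfl)]
      · rintro ⟨a, b⟩ hab
        refine Set.indicator_of_notMem ?_ _
        rintro rfl
        exact hab ⟨b, rfl⟩
    rw [← Finset.sum_neg_distrib]
    refine (hasSum_sum h1).congr_fun fun e => ?_
    by_cases he : e.1 ∈ Λ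
    · rw [Finset.sum_eq_single_of_mem e.1 he, Set.indicator_of_mem (by rfl)]
      intro x _ hx
      exact Set.indicator_of_notMem (fun h' => hx h'.symm) _
    · rw [Finset.sum_eq_zero fun x hx => Set.indicator_of_notMem (fun h' => he (by
        have : e.1 = x := h'
        rwa [this])) _]
      simp [hA, genFunDiff_of_notMem hf z he]
  have hB : HasSum (fun e : V × V => A e.swap) (-∑ x ∈ Λ, genFunDiff Λ f z x * R.genRW z x) :=
    (Equiv.prodComm V V).hasSum_iff.2 hAsum
  have hfl : ∀ e, -(A e + A e.swap) = R.flowTerm (genFun Λ f) z e := by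
    intro e
    rw [R.flowTerm_genFun hf h]
    simp only [hA, Prod.fst_swap, Prod.snd_swap, R.symm e.2 e.1]
    ring
  have hsum := (hAsum.add hB).neg.congr_fun fun e => (hfl e).symm
  rw [genFlow, hsum.tsum_eq, partialDeriv, (hasDerivAt_genFun_kron hf h _).deriv]
  simp only [mul_add, Finset.sum_add_distrib]
  have ho : ∑ x ∈ Λ, genFunDiff Λ f z x * (lam * kron o x) = lam * genFunDiff Λ f z o := by
    by_cases ho : o ∈ Λ
    · rw [Finset.sum_eq_single_of_mem o ho, kron_self]
      · ring
      · intro y _ hy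
        rw [kron_of_ne hy, mul_zero, mul_zero]
    · rw [genFunDiff_of_notMem hf z ho, mul_zero]
      refine Finset.sum_eq_zero fun y hy => ?_
      rw [kron_of_ne fun h => ho (by rw [← h]; exact hy), mul_zero, mul_zero]
  rw [ho]
  ring

end SymmRates

/-! ### The forward equation along the density -/

namespace SymmRates
variable {V : Type*} [Countable V] [MeasurableSpace V] [DiscreteMeasurableSpace V]
  {R : SymmRates V} {Λ : Finset V} {f : (V → ℕ) → ℝ}

lemma Admissible.summable_rate_density {ρ : V → ℝ} (h : R.Admissible ρ) (o : V) {lam : ℝ}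
    (hlam : 0 ≤ lam) {t : ℝ} (ht : 0 ≤ t) (x : V) :
    Summable fun y => R.p x y * |R.density o lam ρ t y| := by
  have h1 := (h.hasSum_genRW_density o lam ht x).summable
  refine (h1.add ((R.summable_row x).mul_right (R.density o lam ρ t x))).congr fun y => ?_
  rw [abs_of_nonneg (h.density_nonneg o hlam ht y)]
  ring

/-- The forward equation for a curve of Poisson product measures along the density. -/
lemma Admissible.forward {ρ : V → ℝ} (h : R.Admissible ρ) (o : V) {lam : ℝ}
    (hlam : 0 ≤ lam) (hf : DependsOn f (Λ : Set V)) {C : ℝ} (hC : ∀ ξ, |f ξ| ≤ C) {t : ℝ}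
    (ht : 0 ≤ t) :
    Integrable (R.genIRW o lam f) (poissonProduct (R.density o lam ρ t)) ∧
    HasDerivWithinAt (fun s => ∫ ξ, f ξ ∂(poissonProduct (R.density o lam ρ s)))
      (∫ ξ, R.genIRW o lam f ξ ∂(poissonProduct (R.density o lam ρ t))) (Set.Ici 0) t := by
  have hz0 : ∀ {s}, 0 ≤ s → ∀ x, 0 ≤ R.density o lam ρ s x := fun hs x =>
    h.density_nonneg o hlam hs x
  have hz : ∀ x ∈ Λ, Summable fun y => R.p x y * |R.density o lam ρ t y| := fun x _ =>
    h.summable_rate_density o hlam ht x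
  have hcb := fun s => convergesBeyond_of_bounded (Λ := Λ) hC (R.density o lam ρ s)
  obtain ⟨h1, h2⟩ := R.integrable_genIRW (hz0 ht) hf (hcb t) hz o lam
  refine ⟨h1, ?_⟩
  classical
  -- Both sides are now the derivative of the generating function in the direction of the velocity
  -- of the linear system.
  rw [h2, R.genFlow_genFun hf (hcb t) hz]
  have h3 : HasDerivWithinAt (fun s => genFun Λ f (R.density o lam ρ s)) _ (Set.Ici 0) t :=
    hasDerivWithinAt_genFun (c := fun s => R.density o lam ρ s) (hcb t)
      (fun x _ => h.hasDerivWithinAt_density o lam ht x)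
  exact h3.congr (fun s hs => integral_poissonProduct (hz0 hs) hf (hcb s).summable)
    (integral_poissonProduct (hz0 ht) hf (hcb t).summable)

end SymmRates

/-! ### Laws of configurations and their generating functions -/

section GeneratingFunctions
variable {V : Type*}

/-- Factors in `[0, 1]`, equal to `1` off a finite set. -/
structure IsTest (Λ : Finset V) (u : V → ℝ) : Prop where
  nonneg : ∀ y, 0 ≤ u y
  le_one : ∀ y, u y ≤ 1
  eq_one : ∀ y, y ∉ Λ → u y = 1

variable {Λ : Finset V} {u : V → ℝ}

lemma IsTest.prod_pow_eq_of_subset (h : IsTest Λ u) {Λ' : Finset V} (hΛ : Λ ⊆ Λ') (η : V → ℕ) :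
    ∏ y ∈ Λ', u y ^ η y = ∏ y ∈ Λ, u y ^ η y :=
  (Finset.prod_subset hΛ fun y _ hy => by rw [h.eq_one y hy, one_pow]).symm

lemma IsTest.prod_pow_nonneg (h : IsTest Λ u) (η : V → ℕ) : 0 ≤ ∏ y ∈ Λ, u y ^ η y :=
  Finset.prod_nonneg fun y _ => pow_nonneg (h.nonneg y) _

lemma IsTest.prod_pow_le_one (h : IsTest Λ u) (η : V → ℕ) : ∏ y ∈ Λ, u y ^ η y ≤ 1 :=
  Finset.prod_le_one (fun y _ => pow_nonneg (h.nonneg y) _)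
    fun y _ => pow_le_one₀ (h.nonneg y) (h.le_one y)

lemma dependsOn_prod_pow {M : Type*} [CommMonoid M] (Λ : Finset V) (u : V → M) :
    DependsOn (fun η : V → ℕ => ∏ y ∈ Λ, u y ^ η y) (Λ : Set V) := fun η ξ h =>
  Finset.prod_congr rfl fun y hy => by rw [h y hy]

open scoped BoundedContinuousFunction in
/-- The multiplicative functions `η ↦ ∏ u_y ^ η_y`, as a submonoid of the bounded continuous
functions. -/
def multiplicativeTests (V : Type*) : Submonoid ((V → ℕ) →ᵇ ℝ) where
  carrier := {g | ∃ (Λ : Finset V) (u : V → ℝ), IsTest Λ u ∧ ∀ η, g η = ∏ y ∈ Λ, u y ^ η y}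
  one_mem' := ⟨∅, fun _ => 1, ⟨fun _ => zero_le_one, fun _ => le_rfl, fun _ _ => rfl⟩, by simp⟩
  mul_mem' := by
    classical
    rintro g g' ⟨Λ, u, hu, hg⟩ ⟨Λ', u', hu', hg'⟩
    refine ⟨Λ ∪ Λ', fun y => u y * u' y, ⟨fun y => mul_nonneg (hu.nonneg y) (hu'.nonneg y),
      fun y => mul_le_one₀ (hu.le_one y) (hu'.nonneg y) (hu'.le_one y), fun y hy => ?_⟩,
      fun η => ?_⟩
    · rw [Finset.mem_union, not_or] at hy
      simp [hu.eq_one y hy.1, hu'.eq_one y hy.2]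
    · rw [BoundedContinuousFunction.mul_apply, hg, hg']
      simp only [mul_pow]
      rw [Finset.prod_mul_distrib, hu.prod_pow_eq_of_subset Finset.subset_union_left,
        hu'.prod_pow_eq_of_subset Finset.subset_union_right]

lemma continuous_prod_pow (Λ : Finset V) (u : V → ℝ) :
    Continuous fun η : V → ℕ => ∏ y ∈ Λ, u y ^ η y :=
  continuous_finsetProd _ fun y _ =>
    (continuous_of_discreteTopology (f := fun n : ℕ => u y ^ n)).comp (continuous_apply y)

open scoped BoundedContinuousFunction in
/-- Laws of configurations are determined by their generating functions. -/
theorem measure_ext_of_lintegral_prod_pow [Countable V] {μ ν : Measure (V → ℕ)}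
    [IsProbabilityMeasure μ] [IsProbabilityMeasure ν]
    (h : ∀ (Λ : Finset V) (u : V → ℝ), IsTest Λ u →
      ∫⁻ η, ENNReal.ofReal (∏ y ∈ Λ, u y ^ η y) ∂μ = ∫⁻ η, ENNReal.ofReal (∏ y ∈ Λ, u y ^ η y) ∂ν) :
    μ = ν := by
  classical
  set S := multiplicativeTests V
  have hstar : ∀ g : (V → ℕ) →ᵇ ℝ, star g = g := fun g => by ext; simp
  let A : StarSubalgebra ℝ ((V → ℕ) →ᵇ ℝ) :=
    { Algebra.adjoin ℝ (S : Set ((V → ℕ) →ᵇ ℝ)) with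
      star_mem' := fun {g} hg => by rw [hstar]; exact hg }
  -- The multiplicative functions are closed under products, so the algebra they generate is their
  -- linear span and integrals need to be compared on generators only.
  have hA : ∀ g, g ∈ A ↔ g ∈ Submodule.span ℝ (S : Set ((V → ℕ) →ᵇ ℝ)) := by
    intro g
    have h1 := Algebra.adjoin_eq_span (R := ℝ) (S : Set ((V → ℕ) →ᵇ ℝ))
    rw [Submonoid.closure_eq] at h1
    rw [← h1]
    rfl
  refine ext_of_forall_mem_subalgebra_integral_eq_of_polish (𝕜 := ℝ) (A := A) ?_ fun g hg => ?_
  · intro η ξ hne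
    obtain ⟨x, hx⟩ := Function.ne_iff.1 hne
    -- Powers of `1 / 2` are injective in the exponent, so this function separates configurations
    -- that differ at `x`.
    set u : V → ℝ := fun y => if y = x then 1 / 2 else 1
    have hu : IsTest {x} u := by
      refine ⟨fun y => ?_, fun y => ?_, fun y hy => ?_⟩
      · simp only [u]; split_ifs <;> norm_num
      · simp only [u]; split_ifs <;> norm_num
      · simp only [u]; rw [if_neg (by simpa using hy)]
    let g : (V → ℕ) →ᵇ ℝ := BoundedContinuousFunction.ofNormedAddCommGroup
      (fun η => ∏ y ∈ {x}, u y ^ η y) (continuous_prod_pow _ _) 1 fun η => by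
        rw [Real.norm_of_nonneg (hu.prod_pow_nonneg η)]; exact hu.prod_pow_le_one η
    have hg : g ∈ A := (hA g).2 (Submodule.subset_span ⟨_, u, hu, fun _ => rfl⟩)
    refine ⟨g, ⟨_, ⟨g, hg, rfl⟩, rfl⟩, ?_⟩
    change ∏ y ∈ {x}, u y ^ η y ≠ ∏ y ∈ {x}, u y ^ ξ y
    simp only [Finset.prod_singleton, u, if_true]
    intro he
    exact hx (pow_right_injective₀ (by norm_num) (by norm_num) he)
  · rw [hA] at hg
    induction hg using Submodule.span_induction with
    | mem g hg =>
      obtain ⟨Λ, u, hu, hg⟩ := hg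
      simp only [hg]
      rw [integral_eq_lintegral_of_nonneg_ae (ae_of_all _ hu.prod_pow_nonneg)
          (continuous_prod_pow Λ u).aestronglyMeasurable,
        integral_eq_lintegral_of_nonneg_ae (ae_of_all _ hu.prod_pow_nonneg)
          (continuous_prod_pow Λ u).aestronglyMeasurable, h Λ u hu]
    | zero => simp
    | add g g' _ _ h1 h2 =>
      simp only [BoundedContinuousFunction.add_apply]
      rw [integral_add (g.integrable μ) (g'.integrable μ),
        integral_add (g.integrable ν) (g'.integrable ν), h1, h2]
    | smul c g _ h1 =>
      simp only [BoundedContinuousFunction.coe_smul]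
      rw [integral_smul, integral_smul, h1]

/-- Exponential tilting: `g ^ k` times the weight with parameter `ρ` is a constant times the weight
with parameter `ρ * g`, and the latter weights sum to one. -/
lemma lintegral_prod_pow_poissonProduct {ρ : V → ℝ} (hρ : ∀ x, 0 ≤ ρ x) (D : Finset V)
    {g : V → ℝ} (hg : ∀ x, 0 ≤ g x) :
    ∫⁻ η, ENNReal.ofReal (∏ x ∈ D, g x ^ η x) ∂(poissonProduct ρ) =
      ENNReal.ofReal (Real.exp (∑ x ∈ D, ρ x * (g x - 1))) := by
  have hd : DependsOn (fun η : V → ℕ => ENNReal.ofReal (∏ x ∈ D, g x ^ η x)) (D : Set V) :=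
    (dependsOn_prod_pow D g).comp_right ENNReal.ofReal
  have h1 := lintegral_poissonProduct (Λ := D) (ρ := fun x => ρ x * g x)
    (fun x => mul_nonneg (hρ x) (hg x)) (g := fun _ => 1) (fun _ _ _ => rfl)
  rw [lintegral_one, measure_univ] at h1
  simp only [one_mul] at h1
  have h2 : ∀ k : D → ℕ, ENNReal.ofReal (∏ x ∈ D, g x ^ extendZero D k x) *
      ENNReal.ofReal (prodWeight k fun i => ρ i) =
      ENNReal.ofReal (Real.exp (∑ x ∈ D, ρ x * (g x - 1))) *
        ENNReal.ofReal (prodWeight k fun i => ρ i * g i) := by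
    intro k
    rw [← ENNReal.ofReal_mul (Finset.prod_nonneg fun x _ => pow_nonneg (hg x) _),
      ← ENNReal.ofReal_mul (Real.exp_pos _).le, Real.exp_sum, ← Finset.prod_coe_sort,
      ← Finset.prod_coe_sort D fun x => Real.exp (ρ x * (g x - 1)), prodWeight, prodWeight,
      ← Finset.prod_mul_distrib, ← Finset.prod_mul_distrib]
    congr 1
    refine Finset.prod_congr rfl fun x _ => ?_
    have h3 : Real.exp (ρ x * (g x - 1)) * Real.exp (-(ρ x * g x)) = Real.exp (-ρ x) := by
      rw [← Real.exp_add]; congr 1; ring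
    rw [extendZero_of_mem _ x.2, poissonWeight, poissonWeight, mul_pow, ← h3]
    ring
  rw [lintegral_poissonProduct hρ hd]
  simp only [h2]
  rw [ENNReal.tsum_mul_left, ← h1, mul_one]

end GeneratingFunctions

/-! ### The law of the system at a fixed time -/

lemma lintegral_finsetProd_infinitePi {ι : Type*} {Ω : ι → Type*} [∀ i, MeasurableSpace (Ω i)]
    (P : ∀ i, Measure (Ω i)) [∀ i, IsProbabilityMeasure (P i)] {f : ∀ i, Ω i → ℝ≥0∞}
    (hf : ∀ i, Measurable (f i)) (s : Finset ι) :
    ∫⁻ ω, ∏ i ∈ s, f i (ω i) ∂(Measure.infinitePi P) = ∏ i ∈ s, ∫⁻ v, f i v ∂(P i) := by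
  refine (lintegral_prod_eq_prod_lintegral_of_indepFun s (fun i (ω : ∀ i, Ω i) => f i (ω i))
    (iIndepFun_infinitePi hf) fun i => (hf i).comp (measurable_pi_apply i)).trans ?_
  refine Finset.prod_congr rfl fun i _ => ?_
  conv_rhs => rw [← Measure.infinitePi_map_eval P i]
  rw [lintegral_map (hf i) (measurable_pi_apply i)]

/-- Converts a product over sites of occupation numbers into a product over particles, to which
independence applies. -/
lemma prod_pow_ncard {V α M : Type*} [CommMonoid M] {Λ : Finset V} {u : V → M}
    (hu : ∀ y, y ∉ Λ → u y = 1) (pos : α → V) (S : Finset α) :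
    ∏ y ∈ Λ, u y ^ {a | a ∈ S ∧ pos a = y}.ncard = ∏ a ∈ S, u (pos a) := by
  classical
  have h1 : ∀ y, u y ^ {a | a ∈ S ∧ pos a = y}.ncard = ∏ a ∈ S with pos a = y, u (pos a) := by
    intro y
    have : {a | a ∈ S ∧ pos a = y} = ((S.filter fun a => pos a = y : Finset α) : Set α) := by
      ext a; simp
    rw [this, Set.ncard_coe_finset, Finset.prod_congr rfl (g := fun _ => u y), Finset.prod_const]
    intro a ha
    rw [(Finset.mem_filter.1 ha).2]
  simp only [h1]
  have h2 : ∏ a ∈ S with pos a ∈ Λ, u (pos a) = ∏ a ∈ S, u (pos a) := by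
    refine Finset.prod_subset (Finset.filter_subset _ _) fun a ha hna => hu _ fun hm => hna ?_
    exact Finset.mem_filter.2 ⟨ha, hm⟩
  rw [← h2, ← Finset.prod_fiberwise_of_maps_to (t := Λ) (g := pos)
    fun a ha => (Finset.mem_filter.1 ha).2]
  refine Finset.prod_congr rfl fun y hy => Finset.prod_congr ?_ fun _ _ => rfl
  ext a
  simp only [Finset.mem_filter]
  refine ⟨fun h => ⟨⟨h.1, by rw [h.2]; exact hy⟩, h.2⟩, fun h => ⟨h.1.1, h.2⟩⟩

namespace SymmRates
variable {V : Type*} [Countable V] [MeasurableSpace V] [DiscreteMeasurableSpace V]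
  (R : SymmRates V) {Λ : Finset V} {u : V → ℝ}

lemma hitProb_comm (x y : V) {s : ℝ} (hs : 0 ≤ s) : R.hitProb x y s = R.hitProb y x s := by
  have h1 := (R.admissible_kron x).lintegral_eq hs y
  have h2 := (R.admissible_kron y).lintegral_eq hs x
  simp only [stepLMean_kron, ← hitProb_eq_mean] at h1 h2
  simp only [R.stepPow_symm _ y x, ← h2] at h1
  exact (ENNReal.ofReal_eq_ofReal_iff (R.hitProb_nonneg _ _ _) (R.hitProb_nonneg _ _ _)).1 h1

lemma integrable_test (hu : IsTest Λ u) (x : V) (t : ℝ) :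
    Integrable (fun w => u (R.walk t w)) (R.walkLaw x) := by
  refine Integrable.of_bound (C := 1) ?_ (ae_of_all _ fun w => ?_)
  · exact (Measurable.of_discrete.comp (R.measurable_walk_right t)).aestronglyMeasurable
  · rw [Real.norm_of_nonneg (hu.nonneg _)]; exact hu.le_one _

lemma IsTest.eq_sub (hu : IsTest Λ u) (z : V) : u z = 1 - ∑ y ∈ Λ, (1 - u y) * kron y z := by
  by_cases hz : z ∈ Λ
  · rw [Finset.sum_eq_single_of_mem z hz, kron_self]
    · ring
    · intro y _ hy
      rw [kron_of_ne hy.symm, mul_zero]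
  · rw [hu.eq_one z hz, Finset.sum_eq_zero, sub_zero]
    intro y hy
    rw [kron_of_ne (fun h => hz (by rw [h]; exact hy)), mul_zero]

lemma mean_test (hu : IsTest Λ u) (t : ℝ) (x : V) :
    R.mean u t x = 1 - ∑ y ∈ Λ, (1 - u y) * R.hitProb y x t := by
  have hk : ∀ y, Integrable (fun w => kron y (R.walk t w)) (R.walkLaw x) := by
    intro y
    refine Integrable.of_bound (C := 1) ?_ (ae_of_all _ fun w => ?_)
    · exact (Measurable.of_discrete.comp (R.measurable_walk_right t)).aestronglyMeasurable
    · rw [Real.norm_of_nonneg (kron_nonneg _ _)]; exact kron_le_one _ _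
  have h1 : ∀ w, u (R.walk t w) = 1 - ∑ y ∈ Λ, (1 - u y) * kron y (R.walk t w) := fun w =>
    IsTest.eq_sub hu _
  rw [mean]
  simp only [h1]
  rw [integral_sub (integrable_const _) (integrable_finsetSum _ fun y _ => (hk y).const_mul _),
    integral_finsetSum _ fun y _ => (hk y).const_mul _]
  simp only [integral_const_mul, hitProb_eq_mean, mean]
  simp

lemma mean_test_nonneg (hu : IsTest Λ u) (t : ℝ) (x : V) : 0 ≤ R.mean u t x :=
  integral_nonneg fun _ => hu.nonneg _

lemma lintegral_test (hu : IsTest Λ u) (t : ℝ) (x : V) :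
    ∫⁻ w, ENNReal.ofReal (u (R.walk t w)) ∂(R.walkLaw x) = ENNReal.ofReal (R.mean u t x) :=
  (ofReal_integral_eq_lintegral_ofReal (R.integrable_test hu x t)
    (ae_of_all _ fun _ => hu.nonneg _)).symm

/-! ### Particles created by the source -/

lemma measurable_createdAt_ncard (lam t : ℝ) (y : V) :
    Measurable fun q : (ℕ → ℝ) × (ℕ → WalkSample V) =>
      {k | arrivalTime q.1 k ≤ lam * t ∧ R.walk (t - arrivalTime q.1 k / lam) (q.2 k) = y}.ncard := by
  refine measurable_ncard_setOf fun k => ?_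
  have h1 : Measurable fun q : (ℕ → ℝ) × (ℕ → WalkSample V) => arrivalTime q.1 k :=
    (measurable_arrivalTime k).comp measurable_fst
  have h2 : Measurable fun q : (ℕ → ℝ) × (ℕ → WalkSample V) =>
      R.walk (t - arrivalTime q.1 k / lam) (q.2 k) :=
    R.measurable_walk.comp ((measurable_const.sub (h1.div_const lam)).prodMk
      ((measurable_pi_apply k).comp measurable_snd))
  exact (measurableSet_le h1 measurable_const).inter (h2 (measurableSet_singleton y))

/-- Given the creation times, the created particles are independent, and one created at `a / lam`
contributes `E_o u(X_{t - a / lam})`. The exponential functional of the clock then applies, and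
symmetry replaces `P_o(X_s = y)` by `P_y(X_s = o)`. -/
lemma lintegral_created (o : V) {lam : ℝ} (hlam : 0 ≤ lam) {t : ℝ} (ht : 0 ≤ t)
    (hu : IsTest Λ u) :
    ∫⁻ q : (ℕ → ℝ) × (ℕ → WalkSample V), ∏ y ∈ Λ, ENNReal.ofReal (u y) ^
      {k | arrivalTime q.1 k ≤ lam * t ∧
        R.walk (t - arrivalTime q.1 k / lam) (q.2 k) = y}.ncard
      ∂(expClock.prod (Measure.infinitePi (fun _ : ℕ => R.walkLaw o))) =
    ENNReal.ofReal (Real.exp (∑ y ∈ Λ, lam * (∫ s in (0 : ℝ)..t, R.hitProb o y s) * (u y - 1))) := by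
  -- Written with `hitSeries`, continuous on all of `ℝ`; it agrees with the mean of `u` for
  -- arguments up to `lam * t`, where the remaining time is nonnegative.
  set h : ℝ → ℝ := fun a => 1 - ∑ y ∈ Λ, (1 - u y) * R.hitSeries y o (t - a / lam) with hh
  have hmean : ∀ a ≤ lam * t, 0 ≤ t - a / lam ∧ h a = R.mean u (t - a / lam) o := by
    intro a ha
    have h1 : 0 ≤ t - a / lam := by
      rcases hlam.eq_or_lt with h0 | h0
      · simpa [← h0] using ht
      · rw [sub_nonneg, div_le_iff₀ h0, mul_comm]; exact ha
    refine ⟨h1, ?_⟩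
    rw [R.mean_test hu, hh]
    simp only [R.hitProb_eq_hitSeries _ _ h1]
  have hc : Continuous h := by
    refine continuous_const.sub (continuous_finsetSum _ fun y _ => continuous_const.mul ?_)
    exact (R.continuous_hitSeries y o).comp (by fun_prop)
  have hT : 0 ≤ lam * t := mul_nonneg hlam ht
  have hmeas : Measurable fun q : (ℕ → ℝ) × (ℕ → WalkSample V) => ∏ y ∈ Λ, ENNReal.ofReal (u y) ^
      {k | arrivalTime q.1 k ≤ lam * t ∧ R.walk (t - arrivalTime q.1 k / lam) (q.2 k) = y}.ncard :=
    Finset.measurable_fun_prod _ fun y _ => (Measurable.of_discrete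
      (f := fun n : ℕ => ENNReal.ofReal (u y) ^ n)).comp (R.measurable_createdAt_ncard lam t y)
  rw [lintegral_prod _ hmeas.aemeasurable, lintegral_prod_arrivals hc hT
    (fun a ha => by rw [(hmean a ha).2]; exact R.mean_test_nonneg hu _ _)]
  · congr 2
    simp only [hh, sub_sub_cancel_left]
    rw [intervalIntegral.integral_neg, intervalIntegral.integral_finsetSum]
    · rw [← Finset.sum_neg_distrib]
      refine Finset.sum_congr rfl fun y _ => ?_
      rw [intervalIntegral.integral_const_mul]
      have h1 : ∫ a in (0 : ℝ)..(lam * t), R.hitSeries y o (t - a / lam) =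
          lam * ∫ s in (0 : ℝ)..t, R.hitProb o y s := by
        have h2 : ∫ s in (0 : ℝ)..t, R.hitProb o y s = ∫ s in (0 : ℝ)..t, R.hitProb y o s := by
          refine intervalIntegral.integral_congr fun s hs => ?_
          rw [Set.uIcc_of_le ht] at hs
          exact R.hitProb_comm o y hs.1
        rw [h2, R.integral_hitProb_eq y o ht]
        rcases hlam.eq_or_lt with h0 | h0
        -- For `lam = 0` the clock interval is a single point and both sides vanish, so the default
        -- value of `a / 0` is harmless.
        · simp [← h0]
        · rw [intervalIntegral.integral_comp_sub_div _ h0.ne']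
          rw [mul_div_cancel_left₀ _ h0.ne', zero_div, sub_self, sub_zero, smul_eq_mul]
      rw [h1]
      ring
    · intro y _
      exact (continuous_const.mul ((R.continuous_hitSeries y o).comp
        (by fun_prop))).intervalIntegrable _ _
  · intro e he m hm
    have harr := arrivals_eq_of_mem_arrivalEvent he hm
    have h1 : ∀ c : ℕ → WalkSample V, ∏ y ∈ Λ, ENNReal.ofReal (u y) ^
        {k | arrivalTime e k ≤ lam * t ∧ R.walk (t - arrivalTime e k / lam) (c k) = y}.ncard =
        ∏ k ∈ Finset.range m, ENNReal.ofReal (u (R.walk (t - arrivalTime e k / lam) (c k))) := by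
      intro c
      rw [← prod_pow_ncard (u := fun y => ENNReal.ofReal (u y))
        (fun y hy => by rw [hu.eq_one y hy, ENNReal.ofReal_one])
        (fun k => R.walk (t - arrivalTime e k / lam) (c k)) (Finset.range m)]
      simp only [harr, Finset.mem_range]
    simp only [h1]
    rw [lintegral_finsetProd_infinitePi (fun _ : ℕ => R.walkLaw o)
      (f := fun k v => ENNReal.ofReal (u (R.walk (t - arrivalTime e k / lam) v)))
      (fun k => (Measurable.of_discrete (f := fun x => ENNReal.ofReal (u x))).comp
        (R.measurable_walk_right _))]
    refine Finset.prod_congr rfl fun k hk => ?_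
    rw [R.lintegral_test hu, (hmean _ ((harr k).2 (Finset.mem_range.1 hk))).2]

/-! ### Particles initially present -/

/-- The labels of the particles of `η` at the sites of `D`. -/
def labels (D : Finset V) (η : V → ℕ) : Finset (V × ℕ) :=
  (D.sigma fun x => Finset.range (η x)).map (Equiv.sigmaEquivProd V ℕ).toEmbedding

lemma mem_labels {D : Finset V} {η : V → ℕ} {a : V × ℕ} :
    a ∈ labels D η ↔ a.1 ∈ D ∧ a.2 < η a.1 := by
  rw [labels, Finset.mem_map_equiv]
  simp

lemma prod_labels {M : Type*} [CommMonoid M] (D : Finset V) (η : V → ℕ) (F : V × ℕ → M) :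
    ∏ a ∈ labels D η, F a = ∏ x ∈ D, ∏ i ∈ Finset.range (η x), F (x, i) := by
  rw [labels, Finset.prod_map, Finset.prod_sigma]
  rfl

lemma measurable_ofReal_walk (u : V → ℝ) (t : ℝ) :
    Measurable fun v : WalkSample V => ENNReal.ofReal (u (R.walk t v)) :=
  (Measurable.of_discrete (f := fun x => ENNReal.ofReal (u x))).comp (R.measurable_walk_right t)

lemma measurable_prod_labels (D : Finset V) (u : V → ℝ) (t : ℝ) :
    Measurable fun q : (V → ℕ) × (V × ℕ → WalkSample V) =>
      ∏ a ∈ labels D q.1, ENNReal.ofReal (u (R.walk t (q.2 a))) := by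
  simp only [prod_labels]
  refine Finset.measurable_fun_prod _ fun x _ => ?_
  have h1 : Measurable fun q : ℕ × (V × ℕ → WalkSample V) =>
      ∏ i ∈ Finset.range q.1, ENNReal.ofReal (u (R.walk t (q.2 (x, i)))) :=
    measurable_from_prod_countable_right fun n => by
      change Measurable fun w : V × ℕ → WalkSample V =>
        ∏ i ∈ Finset.range n, ENNReal.ofReal (u (R.walk t (w (x, i))))
      exact Finset.measurable_fun_prod _ fun i _ =>
        (R.measurable_ofReal_walk u t).comp (measurable_pi_apply (x, i))
  have h2 : Measurable fun q : (V → ℕ) × (V × ℕ → WalkSample V) => (q.1 x, q.2) :=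
    ((measurable_pi_apply x).comp measurable_fst).prodMk measurable_snd
  exact h1.comp h2

lemma lintegral_prod_labels (hu : IsTest Λ u) (D : Finset V) (η : V → ℕ) (t : ℝ) :
    ∫⁻ w, ∏ a ∈ labels D η, ENNReal.ofReal (u (R.walk t (w a)))
      ∂(Measure.infinitePi (fun a : V × ℕ => R.walkLaw a.1)) =
    ENNReal.ofReal (∏ x ∈ D, R.mean u t x ^ η x) := by
  rw [lintegral_finsetProd_infinitePi (fun a : V × ℕ => R.walkLaw a.1)
    (f := fun _ v => ENNReal.ofReal (u (R.walk t v)))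
    fun a => R.measurable_ofReal_walk u t]
  simp only [R.lintegral_test hu]
  rw [prod_labels, ENNReal.ofReal_prod_of_nonneg fun x _ => pow_nonneg (R.mean_test_nonneg hu t x) _]
  refine Finset.prod_congr rfl fun x _ => ?_
  rw [ENNReal.ofReal_pow (R.mean_test_nonneg hu t x)]
  exact (Finset.prod_const (ENNReal.ofReal (R.mean u t x))).trans (by rw [Finset.card_range])

/-- Particles that end off `Λ` contribute a factor one. The product is therefore constant once `D`
contains the starting sites of the finitely many that end in `Λ`. -/
lemma tendsto_prod_labels (hu : IsTest Λ u) {t : ℝ} {η : V → ℕ} {w : V × ℕ → WalkSample V}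
    (hfin : ∀ y, {a : V × ℕ | a.2 < η a.1 ∧ R.walk t (w a) = y}.Finite) :
    Tendsto (fun D => ∏ a ∈ labels D η, ENNReal.ofReal (u (R.walk t (w a)))) atTop
      (𝓝 (∏ y ∈ Λ, ENNReal.ofReal (u y) ^
        {a : V × ℕ | a.2 < η a.1 ∧ R.walk t (w a) = y}.ncard)) := by
  classical
  have hu1 : ∀ y, y ∉ Λ → ENNReal.ofReal (u y) = 1 := fun y hy => by
    rw [hu.eq_one y hy, ENNReal.ofReal_one]
  set T : Finset (V × ℕ) := Λ.biUnion fun y => (hfin y).toFinset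
  have hT : ∀ a, a ∈ T ↔ R.walk t (w a) ∈ Λ ∧ a.2 < η a.1 := by
    intro a
    simp only [T, Finset.mem_biUnion, Set.Finite.mem_toFinset, Set.mem_ofPred_eq]
    exact ⟨fun ⟨y, hy, h1, h2⟩ => ⟨by rwa [h2], h1⟩, fun h => ⟨_, h.1, h.2, rfl⟩⟩
  have h1 : ∏ y ∈ Λ, ENNReal.ofReal (u y) ^
      {a : V × ℕ | a.2 < η a.1 ∧ R.walk t (w a) = y}.ncard =
      ∏ a ∈ T, ENNReal.ofReal (u (R.walk t (w a))) := by
    rw [← prod_pow_ncard (u := fun y => ENNReal.ofReal (u y)) hu1 (fun a => R.walk t (w a)) T]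
    refine Finset.prod_congr rfl fun y hy => ?_
    congr 2
    ext a
    simp only [Set.mem_ofPred_eq, hT]
    refine ⟨fun h => ⟨⟨by rwa [h.2], h.1⟩, h.2⟩, fun h => ⟨h.1.2, h.2⟩⟩
  rw [h1]
  refine tendsto_const_nhds.congr' ?_
  filter_upwards [eventually_ge_atTop (T.image Prod.fst)] with D hD
  refine Finset.prod_subset (fun a ha => ?_) fun a ha hna => hu1 _ fun hm => hna ?_
  · exact mem_labels.2 ⟨hD (Finset.mem_image_of_mem _ ha), ((hT a).1 ha).2⟩
  · exact (hT a).2 ⟨hm, (mem_labels.1 ha).2⟩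

lemma measurable_initialAt_ncard (t : ℝ) (y : V) :
    Measurable fun q : (V → ℕ) × (V × ℕ → WalkSample V) =>
      {a : V × ℕ | a.2 < q.1 a.1 ∧ R.walk t (q.2 a) = y}.ncard := by
  refine measurable_ncard_setOf fun a => ?_
  refine MeasurableSet.inter ?_ ?_
  · exact measurableSet_lt measurable_const ((measurable_pi_apply a.1).comp measurable_fst)
  · exact ((R.measurable_walk_right t).comp ((measurable_pi_apply a).comp measurable_snd))
      (measurableSet_singleton y)

lemma measurable_config (lam t : ℝ) : Measurable (R.config lam t) := by
  refine measurable_pi_iff.2 fun y => ?_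
  have h1 : Measurable fun ω : SystemSample V => (R.initialAt t y ω).ncard :=
    (R.measurable_initialAt_ncard t y).comp
      (measurable_fst.prodMk (measurable_fst.comp measurable_snd))
  have h2 : Measurable fun ω : SystemSample V => (R.createdAt lam t y ω).ncard :=
    (R.measurable_createdAt_ncard lam t y).comp (measurable_snd.comp measurable_snd)
  exact h1.add h2

instance (o : V) (μ : Measure (V → ℕ)) [IsProbabilityMeasure μ] :
    IsProbabilityMeasure (R.systemLaw o μ) := by
  rw [systemLaw]; infer_instance

instance (o : V) (lam t : ℝ) (μ : Measure (V → ℕ)) [IsProbabilityMeasure μ] :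
    IsProbabilityMeasure (R.lawAt o lam μ t) :=
  Measure.isProbabilityMeasure_map (R.measurable_config lam t).aemeasurable

/-- Independence of initial particles and source. Only particles starting in the finite set `D` are
kept, so that the product over particles is finite. -/
lemma lintegral_labels_system (hu : IsTest Λ u) (o : V) {lam : ℝ} (hlam : 0 ≤ lam) {t : ℝ}
    (ht : 0 ≤ t) (μ : Measure (V → ℕ)) [IsProbabilityMeasure μ] (D : Finset V) :
    ∫⁻ ω, (∏ a ∈ labels D ω.1, ENNReal.ofReal (u (R.walk t (ω.2.1 a)))) *
      ∏ y ∈ Λ, ENNReal.ofReal (u y) ^ (R.createdAt lam t y ω).ncard ∂(R.systemLaw o μ) =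
    (∫⁻ η, ENNReal.ofReal (∏ x ∈ D, R.mean u t x ^ η x) ∂μ) *
      ENNReal.ofReal
        (Real.exp (∑ y ∈ Λ, lam * (∫ s in (0 : ℝ)..t, R.hitProb o y s) * (u y - 1))) := by
  rw [← R.lintegral_created o hlam ht hu]
  set B : (ℕ → ℝ) × (ℕ → WalkSample V) → ℝ≥0∞ := fun q => ∏ y ∈ Λ, ENNReal.ofReal (u y) ^
      {k | arrivalTime q.1 k ≤ lam * t ∧ R.walk (t - arrivalTime q.1 k / lam) (q.2 k) = y}.ncard
    with hB
  have hBm : Measurable B := Finset.measurable_fun_prod _ fun y _ => (Measurable.of_discrete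
      (f := fun n : ℕ => ENNReal.ofReal (u y) ^ n)).comp (R.measurable_createdAt_ncard lam t y)
  set A : (V → ℕ) × (V × ℕ → WalkSample V) → ℝ≥0∞ := fun q =>
    ∏ a ∈ labels D q.1, ENNReal.ofReal (u (R.walk t (q.2 a))) with hA
  have hAm : Measurable A := R.measurable_prod_labels D u t
  have hm : Measurable fun ω : SystemSample V => A (ω.1, ω.2.1) * B ω.2.2 :=
    (hAm.comp (measurable_fst.prodMk (measurable_fst.comp measurable_snd))).mul
      (hBm.comp (measurable_snd.comp measurable_snd))
  have h1 := lintegral_prod (μ := μ)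
    (ν := (Measure.infinitePi (fun a : V × ℕ => R.walkLaw a.1)).prod
      (expClock.prod (Measure.infinitePi (fun _ : ℕ => R.walkLaw o)))) _ hm.aemeasurable
  refine h1.trans ?_
  have h2 : ∀ η : V → ℕ, ∫⁻ q, A (η, q.1) * B q.2
      ∂((Measure.infinitePi (fun a : V × ℕ => R.walkLaw a.1)).prod
      (expClock.prod (Measure.infinitePi (fun _ : ℕ => R.walkLaw o)))) =
      ENNReal.ofReal (∏ x ∈ D, R.mean u t x ^ η x) *
        ∫⁻ q, B q ∂(expClock.prod (Measure.infinitePi (fun _ : ℕ => R.walkLaw o))) := by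
    intro η
    have h3 := lintegral_prod_mul (μ := Measure.infinitePi (fun a : V × ℕ => R.walkLaw a.1))
      (ν := expClock.prod (Measure.infinitePi (fun _ : ℕ => R.walkLaw o)))
      (f := fun w => A (η, w)) (g := B) (hAm.comp measurable_prodMk_left).aemeasurable
      hBm.aemeasurable
    rw [h3]
    congr 1
    exact R.lintegral_prod_labels hu D η t
  simp only [h2]
  refine lintegral_mul_const _ ?_
  exact ENNReal.measurable_ofReal.comp (dependsOn_prod_pow D (R.mean u t)).measurable

/-- The generating function of the law at time `t`. -/
theorem tendsto_lintegral_lawAt (hu : IsTest Λ u) (o : V) {lam : ℝ} (hlam : 0 ≤ lam) {t : ℝ}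
    (ht : 0 ≤ t) (μ : Measure (V → ℕ)) [IsProbabilityMeasure μ]
    (hfin : ∀ᵐ ω ∂(R.systemLaw o μ), ∀ y, (R.initialAt t y ω).Finite) :
    Tendsto (fun D : Finset V => (∫⁻ η, ENNReal.ofReal (∏ x ∈ D, R.mean u t x ^ η x) ∂μ) *
      ENNReal.ofReal
        (Real.exp (∑ y ∈ Λ, lam * (∫ s in (0 : ℝ)..t, R.hitProb o y s) * (u y - 1)))) atTop
      (𝓝 (∫⁻ η, ENNReal.ofReal (∏ y ∈ Λ, u y ^ η y) ∂(R.lawAt o lam μ t))) := by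
  have h1 : ∫⁻ η, ENNReal.ofReal (∏ y ∈ Λ, u y ^ η y) ∂(R.lawAt o lam μ t) =
      ∫⁻ ω, (∏ y ∈ Λ, ENNReal.ofReal (u y) ^ (R.initialAt t y ω).ncard) *
        ∏ y ∈ Λ, ENNReal.ofReal (u y) ^ (R.createdAt lam t y ω).ncard ∂(R.systemLaw o μ) := by
    have hm : Measurable fun η : V → ℕ => ENNReal.ofReal (∏ y ∈ Λ, u y ^ η y) :=
      ENNReal.measurable_ofReal.comp (dependsOn_prod_pow Λ u).measurable
    rw [lawAt, lintegral_map hm (R.measurable_config lam t)]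
    refine lintegral_congr fun ω => ?_
    rw [← Finset.prod_mul_distrib,
      ENNReal.ofReal_prod_of_nonneg fun y _ => pow_nonneg (hu.nonneg y) _]
    refine Finset.prod_congr rfl fun y _ => ?_
    rw [ENNReal.ofReal_pow (hu.nonneg y), config, pow_add]
  rw [h1]
  simp only [← R.lintegral_labels_system hu o hlam ht μ]
  have hm1 : ∀ D : Finset V, Measurable fun ω : SystemSample V =>
      ∏ a ∈ labels D ω.1, ENNReal.ofReal (u (R.walk t (ω.2.1 a))) := fun D =>
    Measurable.comp (g := fun q : (V → ℕ) × (V × ℕ → WalkSample V) =>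
      ∏ a ∈ labels D q.1, ENNReal.ofReal (u (R.walk t (q.2 a))))
      (f := fun ω : SystemSample V => (ω.1, ω.2.1)) (R.measurable_prod_labels D u t)
      (measurable_fst.prodMk (measurable_fst.comp measurable_snd))
  have hm2 : Measurable fun ω : SystemSample V =>
      ∏ y ∈ Λ, ENNReal.ofReal (u y) ^ (R.createdAt lam t y ω).ncard :=
    Finset.measurable_fun_prod _ fun y _ => (Measurable.of_discrete
      (f := fun n : ℕ => ENNReal.ofReal (u y) ^ n)).comp
        ((R.measurable_createdAt_ncard lam t y).comp (measurable_snd.comp measurable_snd))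
  have hle1 : ∀ y, ENNReal.ofReal (u y) ≤ 1 := fun y => ENNReal.ofReal_le_one.2 (hu.le_one y)
  -- All factors lie in `[0, 1]`, so the constant one dominates as `D` exhausts `V`.
  refine tendsto_lintegral_filter_of_dominated_convergence (fun _ => 1)
    (Eventually.of_forall fun D => (hm1 D).mul hm2)
    (Eventually.of_forall fun D => ae_of_all _ fun ω => ?_) (by simp) ?_
  · exact mul_le_one' (Finset.prod_le_one' fun a _ => hle1 _)
      (Finset.prod_le_one' fun y _ => pow_le_one' (hle1 y) _)
  · filter_upwards [hfin] with ω hω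
    refine ENNReal.Tendsto.mul_const (R.tendsto_prod_labels hu hω) (Or.inr ?_)
    exact ne_top_of_le_ne_top ENNReal.one_ne_top
      (Finset.prod_le_one' fun y _ => pow_le_one' (hle1 y) _)

end SymmRates

/-! ### Reversibility and evolution of Poisson product measures -/

lemma lintegral_eval_poissonProduct {V : Type*} {ρ : V → ℝ} (hρ : ∀ x, 0 ≤ ρ x) (x : V) :
    ∫⁻ η, (η x : ℝ≥0∞) ∂(poissonProduct ρ) = ENNReal.ofReal (ρ x) := by
  have h1 := hasSum_genFunTerm_mul (g := fun _ => 1) (Finset.mem_singleton_self x)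
    (hasSum_genFunTerm_one {x} ρ)
  simp only [mul_one] at h1
  have hd : DependsOn (fun η : V → ℕ => (η x : ℝ)) (({x} : Finset V) : Set V) := fun η ξ h => by
    exact congrArg Nat.cast (h x (by simp))
  have h2 := ofReal_integral_eq_lintegral_ofReal (integrable_poissonProduct hρ hd h1.summable)
    (ae_of_all _ fun η => Nat.cast_nonneg (η x))
  rw [integral_poissonProduct hρ hd h1.summable, genFun, h1.tsum_eq] at h2
  simpa using h2.symm

namespace SymmRates
variable {V : Type*} [Countable V] [MeasurableSpace V] [DiscreteMeasurableSpace V]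
  (R : SymmRates V) {Λ : Finset V} {u : V → ℝ} {ρ : V → ℝ}

lemma ofReal_hitProb (x y : V) (t : ℝ) :
    ENNReal.ofReal (R.hitProb y x t) = R.walkLaw x {w | R.walk t w = y} := by
  rw [hitProb, Measure.real, ENNReal.ofReal_toReal (measure_ne_top _ _)]

/-- Reversibility of the walk. -/
lemma Admissible.tsum_ofReal_mul_hitProb {R : SymmRates V} (h : R.Admissible ρ) {t : ℝ}
    (ht : 0 ≤ t) (y : V) :
    ∑' x, ENNReal.ofReal (ρ x) * ENNReal.ofReal (R.hitProb y x t) =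
      ENNReal.ofReal (R.mean ρ t y) := by
  have h1 : ∀ x, ENNReal.ofReal (R.hitProb y x t) =
      ∑' n, ENNReal.ofReal (poissonWeight n (R.clockRate * t)) * R.stepPow n y x := by
    intro x
    rw [hitProb_eq_mean, (R.admissible_kron y).lintegral_eq ht]
    simp only [stepLMean_kron, R.stepPow_symm _ x y]
  rw [h.lintegral_eq ht]
  simp only [h1, stepLMean, ← ENNReal.tsum_mul_left]
  rw [ENNReal.tsum_comm]
  refine tsum_congr fun n => tsum_congr fun x => ?_
  ring

lemma Admissible.hasSum_mul_hitProb {R : SymmRates V} (h : R.Admissible ρ) {t : ℝ}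
    (ht : 0 ≤ t) (y : V) : HasSum (fun x => ρ x * R.hitProb y x t) (R.mean ρ t y) := by
  have h1 := h.tsum_ofReal_mul_hitProb ht y
  have h2 := ENNReal.hasSum_toReal (h1.trans_ne ENNReal.ofReal_ne_top)
  rw [← ENNReal.tsum_toReal_eq fun x => ENNReal.mul_ne_top ENNReal.ofReal_ne_top
    ENNReal.ofReal_ne_top, h1, ENNReal.toReal_ofReal (h.mean_nonneg t y)] at h2
  refine h2.congr_fun fun x => ?_
  rw [ENNReal.toReal_mul, ENNReal.toReal_ofReal (h.1 x),
    ENNReal.toReal_ofReal (R.hitProb_nonneg y x t)]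

/-- Borel–Cantelli over the labels: presence and path of a label are independent, and summing `μ {i
< η x}` over `i` gives the mean of `η x`. The hypothesis thus says that the expected number of
initial particles at `y` is finite. -/
lemma ae_initialAt_finite (o : V) {t : ℝ} {y : V} (μ : Measure (V → ℕ)) [IsProbabilityMeasure μ]
    (hμ : ∑' x, (∫⁻ η, (η x : ℝ≥0∞) ∂μ) * ENNReal.ofReal (R.hitProb y x t) ≠ ∞) :
    ∀ᵐ ω ∂(R.systemLaw o μ), (R.initialAt t y ω).Finite := by
  set I := Measure.infinitePi (fun a : V × ℕ => R.walkLaw a.1)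
  set B : V × ℕ → Set ((V → ℕ) × (V × ℕ → WalkSample V)) := fun a =>
    {η : V → ℕ | a.2 < η a.1} ×ˢ {w : V × ℕ → WalkSample V | R.walk t (w a) = y} with hB
  have hm1 : ∀ a : V × ℕ, MeasurableSet {η : V → ℕ | a.2 < η a.1} := fun a =>
    measurableSet_lt measurable_const (measurable_pi_apply a.1)
  have h1 : ∀ a, (μ.prod I) (B a) = μ {η | a.2 < η a.1} * ENNReal.ofReal (R.hitProb y a.1 t) := by
    intro a
    rw [hB, Measure.prod_prod, ofReal_hitProb]
    congr 1
    have hms : MeasurableSet {w : WalkSample V | R.walk t w = y} :=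
      R.measurable_walk_right t (measurableSet_singleton y)
    rw [← Measure.infinitePi_map_eval (fun a : V × ℕ => R.walkLaw a.1) a,
      Measure.map_apply (measurable_pi_apply a) hms]
    rfl
  have h2 : ∑' a, (μ.prod I) (B a) ≠ ∞ := by
    rw [ENNReal.tsum_prod']
    simp only [h1]
    convert hμ using 3 with x
    rw [ENNReal.tsum_mul_right]
    congr 1
    have h3 : ∀ i : ℕ, μ {η | i < η x} = ∫⁻ η, Set.indicator {η : V → ℕ | i < η x} 1 η ∂μ :=
      fun i => (lintegral_indicator_one (hm1 (x, i))).symm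
    simp only [h3]
    rw [← lintegral_tsum fun i => (measurable_one.indicator (hm1 (x, i))).aemeasurable]
    refine lintegral_congr fun η => ?_
    rw [tsum_eq_sum (s := Finset.range (η x))]
    · rw [Finset.sum_congr rfl (g := fun _ => (1 : ℝ≥0∞))]
      · simp
      · intro i hi
        exact Set.indicator_of_mem (s := {η : V → ℕ | i < η x}) (Finset.mem_range.1 hi) _
    · intro i hi
      exact Set.indicator_of_notMem (s := {η : V → ℕ | i < η x})
        (fun h => hi (Finset.mem_range.2 h)) _
  have h3 : ∀ᵐ q ∂(μ.prod I), {a | q ∈ B a}.Finite := by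
    have h4 := ae_finite_setOfPred_mem h2
    exact h4
  have hqm : Measure.QuasiMeasurePreserving
      (fun ω : SystemSample V => (ω.1, ω.2.1)) (R.systemLaw o μ) (μ.prod I) := by
    have h5 : MeasurePreserving (Prod.map id Prod.fst)
        (μ.prod (I.prod (expClock.prod (Measure.infinitePi (fun _ : ℕ => R.walkLaw o)))))
        (μ.prod I) := (MeasurePreserving.id μ).prod measurePreserving_fst
    exact h5.quasiMeasurePreserving
  exact hqm.ae h3

lemma ae_createdAt_finite (o : V) {lam t : ℝ} (hT : 0 ≤ lam * t) (μ : Measure (V → ℕ))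
    [IsProbabilityMeasure μ] :
    ∀ᵐ ω ∂(R.systemLaw o μ), ∀ y, (R.createdAt lam t y ω).Finite := by
  have h1 : Measure.QuasiMeasurePreserving (fun ω : SystemSample V => ω.2.2.1)
      (R.systemLaw o μ) expClock :=
    Measure.quasiMeasurePreserving_fst.comp
      (Measure.quasiMeasurePreserving_snd.comp Measure.quasiMeasurePreserving_snd)
  filter_upwards [h1.ae (ae_arrivals_finite hT)] with ω hω y
  exact hω.subset fun k hk => hk.1

lemma Admissible.ae_initialAt_finite {R : SymmRates V} (h : R.Admissible ρ) (o : V) {t : ℝ}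
    (ht : 0 ≤ t) : ∀ᵐ ω ∂(R.systemLaw o (poissonProduct ρ)), ∀ y, (R.initialAt t y ω).Finite := by
  refine ae_all_iff.2 fun y => R.ae_initialAt_finite o _ ?_
  simp only [lintegral_eval_poissonProduct h.1, h.tsum_ofReal_mul_hitProb ht]
  exact ENNReal.ofReal_ne_top

/-- Poisson product measures are preserved by the evolution. -/
theorem Admissible.lawAt_poissonProduct {R : SymmRates V} (h : R.Admissible ρ) (o : V) {lam : ℝ}
    (hlam : 0 ≤ lam) {t : ℝ} (ht : 0 ≤ t) :
    R.lawAt o lam (poissonProduct ρ) t = poissonProduct (R.density o lam ρ t) := by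
  refine measure_ext_of_lintegral_prod_pow fun Λ u hu => ?_
  have h1 := R.tendsto_lintegral_lawAt hu o hlam ht _ (h.ae_initialAt_finite o ht)
  refine tendsto_nhds_unique h1 ?_
  rw [lintegral_prod_pow_poissonProduct (fun x => h.density_nonneg o hlam ht x) Λ hu.nonneg]
  simp only [lintegral_prod_pow_poissonProduct h.1 _ fun x => R.mean_test_nonneg hu t x]
  simp only [← ENNReal.ofReal_mul (Real.exp_pos _).le, ← Real.exp_add]
  refine ENNReal.tendsto_ofReal (Real.continuous_exp.continuousAt.tendsto.comp ?_)
  -- Moving the semigroup from `u` to `ρ` by reversibility; only the finitely many sites where `u`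
  -- differs from one matter.
  have h2 : HasSum (fun x => ρ x * (R.mean u t x - 1)) (∑ y ∈ Λ, R.mean ρ t y * (u y - 1)) := by
    refine (hasSum_sum fun y _ => (h.hasSum_mul_hitProb ht y).mul_right (u y - 1)).congr_fun
      fun x => ?_
    rw [R.mean_test hu, sub_sub_cancel_left, mul_neg, Finset.mul_sum, ← Finset.sum_neg_distrib]
    exact Finset.sum_congr rfl fun y _ => by ring
  have h2' : Tendsto (fun D : Finset V => ∑ x ∈ D, ρ x * (R.mean u t x - 1)) atTop
      (𝓝 (∑ y ∈ Λ, R.mean ρ t y * (u y - 1))) := h2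
  have h3 := h2'.add_const (∑ y ∈ Λ, lam * (∫ s in (0 : ℝ)..t, R.hitProb o y s) * (u y - 1))
  convert h3 using 2
  rw [← Finset.sum_add_distrib]
  refine Finset.sum_congr rfl fun y _ => ?_
  rw [density_eq]
  ring

end SymmRates

/-! ### The generator at finite configurations -/

section Configurations
variable {V : Type*}

lemma addParticle_comm (η : V → ℕ) (x y : V) :
    addParticle (addParticle η x) y = addParticle (addParticle η y) x := by
  by_cases h : x = y
  · rw [h]
  · ext v
    by_cases hx : v = x
    · subst hx
      rw [addParticle_apply_of_ne _ h, addParticle_apply_self, addParticle_apply_self,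
        addParticle_apply_of_ne _ h]
    · rw [addParticle_apply_of_ne (addParticle η y) hx]
      by_cases hy : v = y
      · subst hy
        rw [addParticle_apply_self, addParticle_apply_self, addParticle_apply_of_ne _ hx]
      · rw [addParticle_apply_of_ne _ hy, addParticle_apply_of_ne _ hy,
          addParticle_apply_of_ne _ hx]

/-- Nonemptiness of `a` is essential: by convention a move from an empty site does nothing, and
adding a particle at `a` would change that. -/
lemma moveParticle_addParticle_of_ne (η : V → ℕ) {a x : V} (b : V) (ha : η a ≠ 0) :
    moveParticle (addParticle η x) a b = addParticle (moveParticle η a b) x := by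
  classical
  have hs : η = addParticle (Function.update η a (η a - 1)) a := by
    ext v
    by_cases hv : v = a
    · subst hv
      rw [addParticle_apply_self, Function.update_self]
      omega
    · rw [addParticle_apply_of_ne _ hv, Function.update_of_ne hv]
  rw [hs, addParticle_comm _ a x, moveParticle_addParticle, moveParticle_addParticle,
    addParticle_comm]

/-- The rate at which a particle at `a` jumps to `b` splits when a particle is added at `x`. -/
lemma jump_addParticle (f : (V → ℕ) → ℝ) (η : V → ℕ) (x a b : V) :
    (addParticle η x a : ℝ) * (f (moveParticle (addParticle η x) a b) - f (addParticle η x)) =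
      (η a : ℝ) * (f (addParticle (moveParticle η a b) x) - f (addParticle η x)) +
        kron x a * (f (addParticle η b) - f (addParticle η x)) := by
  by_cases hax : a = x
  · subst hax
    rw [addParticle_apply_self, moveParticle_addParticle, kron_self]
    by_cases h0 : η a = 0
    · simp [h0]
    · rw [← moveParticle_addParticle_of_ne _ b h0, moveParticle_addParticle]
      push_cast
      ring
  · rw [addParticle_apply_of_ne _ hax, kron_of_ne hax]
    by_cases h0 : η a = 0
    · simp [h0]
    · rw [moveParticle_addParticle_of_ne _ b h0]
      ring

lemma edgeJump_addParticle (f : (V → ℕ) → ℝ) (η : V → ℕ) (x a b : V) :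
    edgeJump f (addParticle η x) a b = edgeJump (fun ξ => f (addParticle ξ x)) η a b +
      (kron x a * (f (addParticle η b) - f (addParticle η x)) +
        kron x b * (f (addParticle η a) - f (addParticle η x))) := by
  rw [edgeJump, edgeJump, jump_addParticle, jump_addParticle]
  ring

end Configurations

namespace SymmRates
variable {V : Type*} [Countable V] (R : SymmRates V) {Λ : Finset V} {f : (V → ℕ) → ℝ}

/-- Only edges with an end at an occupied site contribute, so boundedness of `f` suffices and no
locality is needed. -/
lemma summable_edgeJump {C : ℝ} (hC : ∀ ξ, |f ξ| ≤ C) {η : V → ℕ} (hη : η.support.Finite) :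
    Summable fun e : V × V => R.p e.1 e.2 * edgeJump f η e.1 e.2 := by
  have hz : ∀ x ∈ hη.toFinset, Summable fun y => R.p x y * |(η y : ℝ)| := fun x _ =>
    summable_of_ne_finset_zero (s := hη.toFinset) fun y hy => by
      have : η y = 0 := by simpa using hy
      simp [this]
  refine Summable.of_norm_bounded ((R.summable_touchWeight hz).mul_left (2 * C)) fun e => ?_
  by_cases he : e ∈ touching hη.toFinset
  · rw [touchWeight, Set.indicator_of_mem he, norm_mul, Real.norm_of_nonneg (R.nonneg _ _),
      Real.norm_eq_abs, Nat.abs_cast, Nat.abs_cast]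
    have h1 : ∀ ξ ξ', |f ξ - f ξ'| ≤ 2 * C := fun ξ ξ' =>
      (abs_sub _ _).trans (by linarith [hC ξ, hC ξ'])
    have h2 : |edgeJump f η e.1 e.2| ≤ (η e.1 : ℝ) * (2 * C) + (η e.2 : ℝ) * (2 * C) := by
      refine (abs_add_le _ _).trans (add_le_add ?_ ?_) <;>
      · rw [abs_mul, Nat.abs_cast]
        exact mul_le_mul_of_nonneg_left (h1 _ _) (Nat.cast_nonneg _)
    calc _ ≤ R.p e.1 e.2 * ((η e.1 : ℝ) * (2 * C) + (η e.2 : ℝ) * (2 * C)) :=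
          mul_le_mul_of_nonneg_left h2 (R.nonneg _ _)
      _ = _ := by ring
  · rw [touchWeight, Set.indicator_of_notMem he, mul_zero]
    simp only [touching, Set.mem_ofPred_eq, not_or, Set.Finite.mem_toFinset,
      Function.mem_support, not_not] at he
    simp [edgeJump, he.1, he.2]

/-- The generator when a particle is added at `x`. -/
lemma genIRW_addParticle (o : V) (lam : ℝ) {C : ℝ} (hC : ∀ ξ, |f ξ| ≤ C) {η : V → ℕ}
    (hη : η.support.Finite) (x : V) :
    R.genIRW o lam f (addParticle η x) = R.genIRW o lam (fun ξ => f (addParticle ξ x)) η +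
      R.genRW (fun y => f (addParticle η y)) x := by
  classical
  have h1 := R.summable_edgeJump (f := fun ξ => f (addParticle ξ x)) (fun ξ => hC _) hη
  have hrow : Summable fun y => R.p x y * (f (addParticle η y) - f (addParticle η x)) := by
    refine Summable.of_norm_bounded ((R.summable_row x).mul_right (2 * C)) fun y => ?_
    rw [norm_mul, Real.norm_of_nonneg (R.nonneg _ _)]
    refine mul_le_mul_of_nonneg_left ?_ (R.nonneg _ _)
    exact (abs_sub _ _).trans (by linarith [hC (addParticle η y), hC (addParticle η x)])
  -- The jumps of the added particle, recorded on ordered pairs starting at `x`. The swapped pairs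
  -- give the same sum, and the factor `1 / 2` leaves one copy of `genRW`.
  set A : V × V → ℝ := fun e =>
    R.p e.1 e.2 * (kron x e.1 * (f (addParticle η e.2) - f (addParticle η x))) with hA
  have hAs : HasSum A (R.genRW (fun y => f (addParticle η y)) x) := by
    rw [← (Prod.mk_right_injective x).hasSum_iff]
    · refine hrow.hasSum.congr_fun fun y => ?_
      rw [Function.comp_apply, hA]
      simp only [kron_self, one_mul]
    · rintro ⟨a, b⟩ hab
      have : a ≠ x := by
        rintro rfl
        exact hab ⟨b, rfl⟩
      simp only [hA, kron_of_ne this]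
      ring
  have hBs : HasSum (fun e : V × V => A e.swap) (R.genRW (fun y => f (addParticle η y)) x) :=
    (Equiv.prodComm V V).hasSum_iff.2 hAs
  have h2 := (h1.hasSum.add (hAs.add hBs)).congr_fun
    (g := fun e : V × V => R.p e.1 e.2 * edgeJump f (addParticle η x) e.1 e.2) fun e => by
      rw [edgeJump_addParticle]
      simp only [hA, Prod.fst_swap, Prod.snd_swap, R.symm e.2 e.1]
      ring
  rw [genIRW, genIRW, h2.tsum_eq, addParticle_comm η x o]
  ring

/-- Expands a finitely supported function in Kronecker deltas, the form in which the derivatives of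
the hitting probabilities at time zero appear. -/
lemma genRW_eq_sum {d : V → ℝ} (hd : ∀ y, y ∉ Λ → d y = 0) (x : V) :
    R.genRW d x = ∑ y ∈ Λ, R.genRW (kron y) x * d y := by
  have h1 : ∀ y ∈ Λ, HasSum (fun b => R.p x b * (kron y b - kron y x) * d y)
      (R.genRW (kron y) x * d y) := by
    intro y _
    refine HasSum.mul_right _ (Summable.hasSum ?_)
    refine Summable.of_norm_bounded (R.summable_row x) fun b => ?_
    rw [norm_mul, Real.norm_of_nonneg (R.nonneg _ _)]
    refine mul_le_of_le_one_right (R.nonneg _ _) ?_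
    rw [Real.norm_eq_abs, abs_le]
    have := kron_nonneg y b
    have := kron_le_one y b
    have := kron_nonneg y x
    have := kron_le_one y x
    constructor <;> linarith
  have hk : ∀ z, d z = ∑ y ∈ Λ, kron y z * d y := by
    intro z
    by_cases hz : z ∈ Λ
    · rw [Finset.sum_eq_single_of_mem z hz, kron_self, one_mul]
      intro y _ hy
      rw [kron_of_ne hy.symm, zero_mul]
    · rw [hd z hz, Finset.sum_eq_zero]
      intro y hy
      rw [kron_of_ne (fun h => hz (by rw [h]; exact hy)), zero_mul]
  rw [← (hasSum_sum h1).tsum_eq, genRW]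
  refine tsum_congr fun b => ?_
  conv_lhs => rw [hk b, hk x]
  rw [← Finset.sum_sub_distrib, Finset.mul_sum]
  exact Finset.sum_congr rfl fun y _ => by ring

variable [MeasurableSpace V] [DiscreteMeasurableSpace V]

lemma initialAt_finite {η : V → ℕ} (hη : η.support.Finite) (o : V) (t : ℝ) :
    ∀ᵐ ω ∂(R.systemLaw o (Measure.dirac η)), ∀ y, (R.initialAt t y ω).Finite := by
  have h1 : Measure.QuasiMeasurePreserving (fun ω : SystemSample V => ω.1)
      (R.systemLaw o (Measure.dirac η)) (Measure.dirac η) := Measure.quasiMeasurePreserving_fst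
  have h2 : ∀ᵐ ξ ∂(Measure.dirac η), ξ = η := by
    rw [ae_dirac_eq]; rfl
  filter_upwards [h1.ae h2] with ω hω y
  refine (labels hη.toFinset η).finite_toSet.subset fun a ha => ?_
  have ha1 : a.2 < ω.1 a.1 := ha.1
  rw [hω] at ha1
  refine Finset.mem_coe.2 (mem_labels.2 ⟨?_, ha1⟩)
  rw [Set.Finite.mem_toFinset, Function.mem_support]
  omega

lemma measurable_addParticle :
    Measurable fun q : (V → ℕ) × V => addParticle q.1 q.2 :=
  measurable_from_prod_countable_left fun x => by
    classical
    refine measurable_pi_iff.2 fun y => ?_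
    by_cases h : y = x
    · subst h
      simp only [addParticle_apply_self]
      exact (measurable_pi_apply y).add_const 1
    · simp only [addParticle_apply_of_ne _ h]
      exact measurable_pi_apply y

lemma support_addParticle_finite {η : V → ℕ} (hη : η.support.Finite) (x : V) :
    (addParticle η x).support.Finite := by
  refine (hη.insert x).subset fun y hy => ?_
  by_cases h : y = x
  · exact Or.inl h
  · rw [Function.mem_support, addParticle_apply_of_ne _ h] at hy
    exact Or.inr hy

lemma prod_pow_addParticle {M : Type*} [CommMonoid M] {u : V → M} {D : Finset V} (η : V → ℕ)
    {x : V} (hx : x ∈ D) : ∏ y ∈ D, u y ^ addParticle η x y = u x * ∏ y ∈ D, u y ^ η y := by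
  classical
  rw [← Finset.mul_prod_erase D _ hx, ← Finset.mul_prod_erase D (fun y => u y ^ η y) hx,
    addParticle_apply_self, pow_succ', mul_assoc]
  congr 2
  refine Finset.prod_congr rfl fun y hy => ?_
  rw [addParticle_apply_of_ne _ (Finset.ne_of_mem_erase hy)]

/-- An additional initial particle moves independently of the rest of the system. -/
theorem lawAt_dirac_addParticle (o : V) {lam : ℝ} (hlam : 0 ≤ lam) {t : ℝ} (ht : 0 ≤ t)
    {η : V → ℕ} (hη : η.support.Finite) (x : V) :
    R.lawAt o lam (Measure.dirac (addParticle η x)) t =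
      ((R.lawAt o lam (Measure.dirac η) t).prod ((R.walkLaw x).map (R.walk t))).map
        fun q => addParticle q.1 q.2 := by
  have : IsProbabilityMeasure ((R.walkLaw x).map (R.walk t)) :=
    Measure.isProbabilityMeasure_map (R.measurable_walk_right t).aemeasurable
  have : IsProbabilityMeasure (((R.lawAt o lam (Measure.dirac η) t).prod
      ((R.walkLaw x).map (R.walk t))).map fun q => addParticle q.1 q.2) :=
    Measure.isProbabilityMeasure_map measurable_addParticle.aemeasurable
  refine measure_ext_of_lintegral_prod_pow fun Λ u hu => ?_
  have hm : Measurable fun η : V → ℕ => ENNReal.ofReal (∏ y ∈ Λ, u y ^ η y) :=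
    ENNReal.measurable_ofReal.comp (dependsOn_prod_pow Λ u).measurable
  have hd : ∀ (D : Finset V) (ξ : V → ℕ),
      ∫⁻ η, ENNReal.ofReal (∏ x ∈ D, R.mean u t x ^ η x) ∂(Measure.dirac ξ) =
        ENNReal.ofReal (∏ x ∈ D, R.mean u t x ^ ξ x) := fun D ξ =>
    lintegral_dirac' _
      (ENNReal.measurable_ofReal.comp (dependsOn_prod_pow D (R.mean u t)).measurable)
  have h1 := R.tendsto_lintegral_lawAt hu o hlam ht _ (R.initialAt_finite hη o t)
  have h2 := R.tendsto_lintegral_lawAt hu o hlam ht _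
    (R.initialAt_finite (support_addParticle_finite hη x) o t)
  simp only [hd] at h1 h2
  have h3 := ENNReal.Tendsto.const_mul (a := ENNReal.ofReal (R.mean u t x)) h1
    (Or.inr ENNReal.ofReal_ne_top)
  have h4 : ∫⁻ η, ENNReal.ofReal (∏ y ∈ Λ, u y ^ η y)
      -- Once `D` contains `x`, the two generating functions differ by the single factor `E_x
      -- u(X_t)`; the label of the added particle is irrelevant.
      ∂(R.lawAt o lam (Measure.dirac (addParticle η x)) t) = ENNReal.ofReal (R.mean u t x) *
      ∫⁻ η, ENNReal.ofReal (∏ y ∈ Λ, u y ^ η y) ∂(R.lawAt o lam (Measure.dirac η) t) := by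
    refine tendsto_nhds_unique h2 (h3.congr' ?_)
    filter_upwards [eventually_ge_atTop {x}] with D hD
    rw [prod_pow_addParticle _ (hD (Finset.mem_singleton_self x)),
      ENNReal.ofReal_mul (R.mean_test_nonneg hu t x), mul_assoc]
  rw [h4, lintegral_map hm measurable_addParticle]
  classical
  have h5 : ∀ q : (V → ℕ) × V, ENNReal.ofReal (∏ y ∈ Λ, u y ^ addParticle q.1 q.2 y) =
      ENNReal.ofReal (∏ y ∈ Λ, u y ^ q.1 y) * ENNReal.ofReal (u q.2) := by
    intro q
    rw [← hu.prod_pow_eq_of_subset (Finset.subset_insert q.2 Λ),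
      prod_pow_addParticle _ (Finset.mem_insert_self _ _),
      hu.prod_pow_eq_of_subset (Finset.subset_insert q.2 Λ), ENNReal.ofReal_mul (hu.nonneg _),
      mul_comm]
  simp only [h5]
  have h6 := lintegral_prod_mul (μ := R.lawAt o lam (Measure.dirac η) t)
    (ν := (R.walkLaw x).map (R.walk t)) hm.aemeasurable
    (Measurable.of_discrete (f := fun y => ENNReal.ofReal (u y))).aemeasurable
  rw [h6, lintegral_map Measurable.of_discrete (R.measurable_walk_right t), R.lintegral_test hu,
    mul_comm]

/-- The final position of the added particle matters only if it lies in `Λ`. This gives a finite sum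
of products of functions of `t`, to which the product rule applies. -/
lemma integral_lawAt_addParticle (o : V) {lam : ℝ} (hlam : 0 ≤ lam) {t : ℝ} (ht : 0 ≤ t)
    {η : V → ℕ} (hη : η.support.Finite) (x : V) (hf : DependsOn f (Λ : Set V)) {C : ℝ}
    (hC : ∀ ξ, |f ξ| ≤ C) :
    ∫ ξ, f ξ ∂(R.lawAt o lam (Measure.dirac (addParticle η x)) t) =
      ∫ ξ, f ξ ∂(R.lawAt o lam (Measure.dirac η) t) + ∑ y ∈ Λ, R.hitProb y x t *
        (∫ ξ, f (addParticle ξ y) ∂(R.lawAt o lam (Measure.dirac η) t) -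
          ∫ ξ, f ξ ∂(R.lawAt o lam (Measure.dirac η) t)) := by
  set μ := R.lawAt o lam (Measure.dirac η) t
  have : IsProbabilityMeasure ((R.walkLaw x).map (R.walk t)) :=
    Measure.isProbabilityMeasure_map (R.measurable_walk_right t).aemeasurable
  have hi : ∀ {g : (V → ℕ) → ℝ}, DependsOn g (Λ : Set V) → (∀ ξ, |g ξ| ≤ C) →
      Integrable g μ := fun hg hb =>
    Integrable.of_bound hg.measurable.aestronglyMeasurable C (ae_of_all _ hb)
  have hid : ∀ y, Integrable (fun ξ => f (addParticle ξ y) - f ξ) μ := fun y =>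
    (hi (hf.comp_addParticle y) fun ξ => hC _).sub (hi hf hC)
  have hk : ∀ y, Integrable (kron y) ((R.walkLaw x).map (R.walk t)) := fun y =>
    Integrable.of_bound Measurable.of_discrete.aestronglyMeasurable 1 (ae_of_all _ fun z => by
      rw [Real.norm_of_nonneg (kron_nonneg _ _)]; exact kron_le_one _ _)
  have h1 : ∀ q : (V → ℕ) × V, f (addParticle q.1 q.2) =
      f q.1 + ∑ y ∈ Λ, (f (addParticle q.1 y) - f q.1) * kron y q.2 := by
    intro q
    by_cases hq : q.2 ∈ Λ
    · rw [Finset.sum_eq_single_of_mem q.2 hq, kron_self]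
      · ring
      · intro y _ hy
        rw [kron_of_ne hy.symm, mul_zero]
    · rw [hf.addParticle_eq hq, Finset.sum_eq_zero, add_zero]
      intro y hy
      rw [kron_of_ne (fun h => hq (by rw [h]; exact hy)), mul_zero]
  rw [R.lawAt_dirac_addParticle o hlam ht hη x, integral_map measurable_addParticle.aemeasurable
    hf.measurable.aestronglyMeasurable]
  simp only [h1]
  have h2 : ∀ y, Integrable (fun q : (V → ℕ) × V => (f (addParticle q.1 y) - f q.1) * kron y q.2)
      (μ.prod ((R.walkLaw x).map (R.walk t))) := fun y => (hid y).mul_prod (hk y)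
  rw [integral_add ((hi hf hC).comp_fst _) (integrable_finsetSum _ fun y _ => h2 y),
    integral_finsetSum _ fun y _ => h2 y]
  congr 1
  · rw [integral_fun_fst]; simp
  · refine Finset.sum_congr rfl fun y _ => ?_
    rw [integral_prod_mul (fun ξ => f (addParticle ξ y) - f ξ) (kron y), integral_sub (hi (hf.comp_addParticle y) fun ξ => hC _) (hi hf hC),
      mul_comm, integral_map (R.measurable_walk_right t).aemeasurable
        Measurable.of_discrete.aestronglyMeasurable, hitProb_eq_mean, mean]

lemma poissonProduct_zero : poissonProduct (fun _ : V => (0 : ℝ)) = Measure.dirac 0 := by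
  refine measure_ext_of_lintegral_prod_pow fun Λ u hu => ?_
  have hm : Measurable fun η : V → ℕ => ENNReal.ofReal (∏ y ∈ Λ, u y ^ η y) :=
    ENNReal.measurable_ofReal.comp (dependsOn_prod_pow Λ u).measurable
  rw [lintegral_prod_pow_poissonProduct (fun _ => le_rfl) Λ hu.nonneg, lintegral_dirac' _ hm]
  simp

/-- The generator of the particle system at `η`. -/
def HasGeneratorAt (o : V) (lam : ℝ) (η : V → ℕ) : Prop :=
  ∀ (Λ : Finset V) (f : (V → ℕ) → ℝ), DependsOn f (Λ : Set V) → (∃ C, ∀ ξ, |f ξ| ≤ C) →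
    ∫ ξ, f ξ ∂(R.lawAt o lam (Measure.dirac η) 0) = f η ∧
    HasDerivWithinAt (fun t => ∫ ξ, f ξ ∂(R.lawAt o lam (Measure.dirac η) t))
      (R.genIRW o lam f η) (Set.Ici 0) 0

/-- The empty configuration is the Poisson product of density zero, so this is the forward equation
at time zero. -/
lemma hasGeneratorAt_zero (o : V) {lam : ℝ} (hlam : 0 ≤ lam) : R.HasGeneratorAt o lam 0 := by
  intro Λ f hf ⟨C, hC⟩
  have hadm : R.Admissible fun _ => (0 : ℝ) :=
    Admissible.of_bounded (M := 0) (fun _ => le_rfl) fun _ => le_rfl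
  have hlaw : ∀ t, 0 ≤ t → R.lawAt o lam (Measure.dirac 0) t =
      poissonProduct (R.density o lam (fun _ => (0 : ℝ)) t) := fun t ht => by
    rw [← poissonProduct_zero, hadm.lawAt_poissonProduct o hlam ht]
  have h1 := (hadm.forward o hlam hf hC le_rfl).2
  rw [hadm.density_zero o lam, poissonProduct_zero, integral_dirac] at h1
  refine ⟨?_, h1.congr (fun t ht => by rw [hlaw t ht]) (by rw [hlaw 0 le_rfl])⟩
  rw [hlaw 0 le_rfl, hadm.density_zero o lam, poissonProduct_zero, integral_dirac]

lemma hitProb_zero (x y : V) : R.hitProb y x 0 = kron y x := by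
  rw [R.hitProb_eq_hitSeries y x le_rfl, hitSeries_zero]

lemma hasDerivWithinAt_hitProb_zero (x y : V) :
    HasDerivWithinAt (R.hitProb y x) (R.genRW (kron y) x) (Set.Ici 0) 0 := by
  have h1 := (R.admissible_kron y).hasDerivWithinAt_mean le_rfl x
  have h2 : R.mean (kron y) 0 = kron y := by
    ext z
    rw [← hitProb_eq_mean, hitProb_zero]
  rw [h2] at h1
  exact h1.congr (fun s _ => R.hitProb_eq_mean y x s) (R.hitProb_eq_mean y x 0)

/-- Product rule at time zero, where the hitting probabilities are Kronecker deltas. The induction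
hypothesis is applied to `f` and to its translates by one particle; its value at time zero is needed
as well as its derivative. -/
lemma HasGeneratorAt.addParticle {R : SymmRates V} {o : V} {lam : ℝ} (hlam : 0 ≤ lam)
    {η : V → ℕ} (hη : η.support.Finite) (h : R.HasGeneratorAt o lam η) (x : V) :
    R.HasGeneratorAt o lam (addParticle η x) := by
  intro Λ f hf ⟨C, hC⟩
  obtain ⟨h1, h2⟩ := h Λ f hf ⟨C, hC⟩
  have h3 := fun y => h Λ _ (hf.comp_addParticle y) ⟨C, fun ξ => hC _⟩
  have hval := R.integral_lawAt_addParticle o hlam le_rfl hη x hf hC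
  simp only [h1, (h3 _).1, hitProb_zero] at hval
  have hkx : ∀ G : V → ℝ, (x ∉ Λ → G x = 0) → ∑ y ∈ Λ, kron y x * G y = G x := by
    intro G hG
    by_cases hx : x ∈ Λ
    · rw [Finset.sum_eq_single_of_mem x hx, kron_self, one_mul]
      intro y _ hy
      rw [kron_of_ne hy.symm, zero_mul]
    · rw [hG hx, Finset.sum_eq_zero]
      intro y hy
      rw [kron_of_ne (fun h => hx (by rw [h]; exact hy)), zero_mul]
  refine ⟨?_, ?_⟩
  · rw [hval, hkx _ fun hx => by rw [hf.addParticle_eq hx, sub_self]]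
    ring
  have h4 := h2.add (HasDerivWithinAt.fun_sum (u := Λ) fun y _ =>
    (R.hasDerivWithinAt_hitProb_zero x y).mul ((h3 y).2.sub h2))
  have h5 := h4.congr (f₁ := fun t =>
    ∫ ξ, f ξ ∂(R.lawAt o lam (Measure.dirac (_root_.addParticle η x)) t))
    (fun t ht => R.integral_lawAt_addParticle o hlam ht hη x hf hC)
    (R.integral_lawAt_addParticle o hlam le_rfl hη x hf hC)
  refine h5.congr_deriv ?_
  rw [R.genIRW_addParticle o lam hC hη x]
  simp only [Pi.sub_apply, h1, (h3 _).1, hitProb_zero, Finset.sum_add_distrib]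
  rw [hkx (fun y => R.genIRW o lam (fun ξ => f (_root_.addParticle ξ y)) η - R.genIRW o lam f η)
    fun hx => by simp only [hf.addParticle_eq hx, sub_self],
    ← R.genRW_eq_sum (d := fun y => f (_root_.addParticle η y) - f η)
      fun y hy => by rw [hf.addParticle_eq hy, sub_self]]
  have h6 : R.genRW (fun y => f (_root_.addParticle η y) - f η) x =
      R.genRW (fun y => f (_root_.addParticle η y)) x := by
    simp only [genRW, sub_sub_sub_cancel_right]
  rw [h6]
  ring

/-- Induction on the total number of particles, removing one at an occupied site. -/
theorem hasGeneratorAt (o : V) {lam : ℝ} (hlam : 0 ≤ lam) {η : V → ℕ} (hη : η.support.Finite) :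
    R.HasGeneratorAt o lam η := by
  classical
  have key : ∀ (n : ℕ) (S : Finset V) (η : V → ℕ), (∀ x, x ∉ S → η x = 0) →
      ∑ x ∈ S, η x = n → R.HasGeneratorAt o lam η := by
    intro n
    induction n with
    | zero =>
      intro S η h0 hs
      have : η = 0 := by
        ext x
        by_cases hx : x ∈ S
        · exact (Finset.sum_eq_zero_iff.1 hs) x hx
        · exact h0 x hx
      rw [this]
      exact R.hasGeneratorAt_zero o hlam
    | succ n ih =>
      intro S η h0 hs
      obtain ⟨x, hx, hne⟩ := Finset.exists_ne_zero_of_sum_ne_zero (by rw [hs]; omega)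
      set ξ := Function.update η x (η x - 1) with hξ
      have hadd : η = _root_.addParticle ξ x := by
        ext v
        by_cases hv : v = x
        · subst hv
          rw [addParticle_apply_self, hξ, Function.update_self]
          omega
        · rw [addParticle_apply_of_ne _ hv, hξ, Function.update_of_ne hv]
      have hξ0 : ∀ y, y ∉ S → ξ y = 0 := by
        intro y hy
        have : y ≠ x := fun h => hy (h ▸ hx)
        rw [hξ, Function.update_of_ne this, h0 y hy]
      have hsum : ∑ y ∈ S, ξ y = n := by
        have h1 : ∑ y ∈ S, η y = ∑ y ∈ S, ξ y + 1 := by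
          rw [← Finset.add_sum_erase S η hx, ← Finset.add_sum_erase S ξ hx, hadd,
            addParticle_apply_self]
          have : ∑ y ∈ S.erase x, _root_.addParticle ξ x y = ∑ y ∈ S.erase x, ξ y :=
            Finset.sum_congr rfl fun y hy =>
              addParticle_apply_of_ne _ (Finset.ne_of_mem_erase hy)
          omega
        omega
      rw [hadd]
      refine (ih S ξ hξ0 hsum).addParticle hlam (S.finite_toSet.subset fun y hy => ?_) x
      by_contra hy'
      exact hy (hξ0 y hy')
  exact key _ hη.toFinset η (fun x hx => by simpa using hx) rfl

end SymmRates

/-! ### Continuity in the densities and weak convergence -/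

lemma eventually_arrivalCount_eq {e : ℕ → ℝ} (hf : ∀ T, {k | arrivalTime e k ≤ T}.Finite) {s : ℝ}
    (hs : ∀ k, arrivalTime e k ≠ s) : ∀ᶠ s' in 𝓝 s, arrivalCount e s' = arrivalCount e s := by
  -- Only the finitely many arrivals up to `s + 1` can matter near `s`, and none of them is at `s`.
  have h1 : ∀ᶠ s' in 𝓝 s, ∀ k ∈ (hf (s + 1)).toFinset,
      (arrivalTime e k ≤ s' ↔ arrivalTime e k ≤ s) := by
    rw [Filter.eventually_all_finset]
    intro k _
    rcases (hs k).lt_or_gt with h | h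
    · filter_upwards [eventually_gt_nhds h] with s' hs'
      exact ⟨fun _ => h.le, fun _ => hs'.le⟩
    · filter_upwards [eventually_lt_nhds h] with s' hs'
      exact ⟨fun h' => absurd hs' (not_lt.2 h'), fun h' => absurd h (not_lt.2 h')⟩
  filter_upwards [h1, eventually_lt_nhds (lt_add_one s)] with s' h2 h3
  rw [arrivalCount, arrivalCount]
  congr 1
  ext k
  simp only [Set.mem_ofPred_eq]
  by_cases hk : arrivalTime e k ≤ s + 1
  · exact h2 k (by simpa using hk)
  · push Not at hk
    exact ⟨fun h => by linarith, fun h => by linarith⟩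

/-- Poisson product measures are realized by independent Poisson processes. -/
lemma poissonProduct_eq_map {V : Type*} {ρ : V → ℝ} (hρ : ∀ x, 0 ≤ ρ x) :
    poissonProduct ρ = (Measure.infinitePi fun _ : V => expClock).map
      fun e x => arrivalCount (e x) (ρ x) := by
  have h := Measure.infinitePi_map_pi (μ := fun _ : V => expClock)
    (f := fun x e => arrivalCount e (ρ x)) fun x => measurable_arrivalCount_left (ρ x)
  rw [h, poissonProduct]
  simp only [expClock_map_arrivalCount (hρ _)]

/-- Poisson product measures depend continuously on the densities. -/
lemma tendsto_integral_poissonProduct {V : Type*} [Countable V] {ι : Type*} {l : Filter ι}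
    [l.IsCountablyGenerated] {ρ : ι → V → ℝ} {ρ' : V → ℝ} (h0 : ∀ᶠ i in l, ∀ x, 0 ≤ ρ i x)
    (h0' : ∀ x, 0 ≤ ρ' x) (h : ∀ x, Tendsto (fun i => ρ i x) l (𝓝 (ρ' x))) {F : (V → ℕ) → ℝ}
    (hF : Continuous F) {C : ℝ} (hC : ∀ ξ, |F ξ| ≤ C) :
    Tendsto (fun i => ∫ ξ, F ξ ∂(poissonProduct (ρ i))) l (𝓝 (∫ ξ, F ξ ∂(poissonProduct ρ'))) := by
  have hm : ∀ ρ : V → ℝ, Measurable fun (e : V → ℕ → ℝ) x => arrivalCount (e x) (ρ x) := fun ρ =>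
    measurable_pi_iff.2 fun x => (measurable_arrivalCount_left (ρ x)).comp (measurable_pi_apply x)
  have hint : ∀ ρ : V → ℝ, (∀ x, 0 ≤ ρ x) → ∫ ξ, F ξ ∂(poissonProduct ρ) =
      ∫ e, F (fun x => arrivalCount (e x) (ρ x)) ∂(Measure.infinitePi fun _ : V => expClock) :=
    fun ρ hρ => by
      rw [poissonProduct_eq_map hρ, integral_map (hm ρ).aemeasurable
        hF.measurable.aestronglyMeasurable]
  rw [hint ρ' h0']
  refine Tendsto.congr' (h0.mono fun i hi => (hint (ρ i) hi).symm) ?_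
  -- In the common realization almost surely no Poisson process jumps at its limiting density, so
  -- each occupation number is eventually constant and the configurations converge in the product
  -- topology.
  have hae : ∀ᵐ e ∂(Measure.infinitePi fun _ : V => expClock), ∀ x,
      (∀ T, {k | arrivalTime (e x) k ≤ T}.Finite) ∧ ∀ k, arrivalTime (e x) k ≠ ρ' x := by
    refine ae_all_iff.2 fun x => ?_
    have h1 := (measurePreserving_eval_infinitePi (fun _ : V => expClock) x).quasiMeasurePreserving
    have h2 : ∀ᵐ e ∂expClock, (∀ T, {k | arrivalTime e k ≤ T}.Finite) ∧
        ∀ k, arrivalTime e k ≠ ρ' x := by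
      filter_upwards [SymmRates.ae_clock, ae_arrivalTime_ne (ρ' x)] with e h1 h2
      exact ⟨h1.2, h2⟩
    exact h1.ae h2
  refine tendsto_integral_filter_of_dominated_convergence (fun _ => C)
    (Eventually.of_forall fun i => (hF.measurable.comp (hm (ρ i))).aestronglyMeasurable)
    (Eventually.of_forall fun i => ae_of_all _ fun e => hC _) (integrable_const C) ?_
  filter_upwards [hae] with e he
  refine (hF.tendsto _).comp (tendsto_pi_nhds.2 fun x => ?_)
  refine tendsto_const_nhds.congr' ?_
  filter_upwards [(h x).eventually (eventually_arrivalCount_eq (he x).1 (he x).2)] with i hi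
  exact hi.symm

namespace SymmRates
variable {V : Type*} [Countable V] [MeasurableSpace V] [DiscreteMeasurableSpace V]
  (R : SymmRates V)

/-- Weak convergence to the stationary state in the transient case. -/
theorem tendsto_lawAt_of_isTransient (h : R.IsTransient) (o : V) {lam r : ℝ} (hlam : 0 ≤ lam)
    (hr : 0 ≤ r) {F : (V → ℕ) → ℝ} (hF : Continuous F) {C : ℝ} (hC : ∀ ξ, |F ξ| ≤ C) :
    Tendsto (fun t => ∫ ξ, F ξ ∂(R.lawAt o lam (poissonProduct fun _ => r) t)) atTop
      (𝓝 (∫ ξ, F ξ ∂(poissonProduct (limitDensity R o lam r)))) := by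
  have hadm : R.Admissible fun _ => r := Admissible.of_bounded (fun _ => hr) fun _ => le_rfl
  have h1 : Tendsto (fun t => ∫ ξ, F ξ ∂(poissonProduct (R.density o lam (fun _ => r) t))) atTop
      (𝓝 (∫ ξ, F ξ ∂(poissonProduct (limitDensity R o lam r)))) := by
    refine tendsto_integral_poissonProduct ?_ (fun x => ?_) (fun x => ?_) hF hC
    · filter_upwards [eventually_ge_atTop 0] with t ht x
      exact hadm.density_nonneg o hlam ht x
    · exact add_nonneg hr (mul_nonneg hlam (integral_nonneg fun s => R.hitProb_nonneg o x s))
    · simp only [density_const_eq, limitDensity]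
      refine ((intervalIntegral_tendsto_integral_Ioi 0 ?_ tendsto_id).const_mul lam).const_add r
      exact (integrableOn_hitProb_iff o x).2 (R.green_ne_top_of_isTransient h x o)
  refine h1.congr' ?_
  filter_upwards [eventually_ge_atTop 0] with t ht
  rw [hadm.lawAt_poissonProduct o hlam ht]

end SymmRates

/-! ### The main theorem -/

theorem mainTheorem3 {V : Type*} [Countable V] [MeasurableSpace V] [DiscreteMeasurableSpace V]
    (R : SymmRates V) (o : V) (lam : ℝ) (hlam : 0 ≤ lam) :
    -- Intertwining of the two generators by the generating-function map.
    (∀ (Λ : Finset V) (f : (V → ℕ) → ℝ), DependsOn f (Λ : Set V) →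
      ∀ z : V → ℝ, (∀ x ∈ Λ, Summable fun y => R.p x y * |z y|) →
        (∀ᶠ w in 𝓝 z, Summable (genFunTerm Λ f w)) →
        (∀ x, DifferentiableAt ℝ (fun s : ℝ => genFun Λ f (fun y => z y + s * kron x y)) 0) ∧
        Summable (R.flowTerm (genFun Λ f) z) ∧
        HasGenFun (R.genIRW o lam f) z (R.genFlow o lam (genFun Λ f) z)) ∧
    -- The particle system has the stated generator.
    (∀ (η : V → ℕ), (Function.support η).Finite →
      ∀ (Λ : Finset V) (f : (V → ℕ) → ℝ), DependsOn f (Λ : Set V) → (∃ C, ∀ ξ, |f ξ| ≤ C) →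
        HasDerivWithinAt (fun t => ∫ ξ, f ξ ∂(R.lawAt o lam (Measure.dirac η) t))
          (R.genIRW o lam f η) (Set.Ici 0) 0) ∧
    -- Evolution of Poisson product measures.
    (∀ ρ : V → ℝ, R.Admissible ρ →
      (∀ t, 0 ≤ t → ∀ᵐ ω ∂(R.systemLaw o (poissonProduct ρ)), ∀ y,
        (R.initialAt t y ω).Finite ∧ (R.createdAt lam t y ω).Finite) ∧
      (∀ t, 0 ≤ t →
        R.lawAt o lam (poissonProduct ρ) t = poissonProduct (R.density o lam ρ t)) ∧
      -- the density solves the linear system with initial condition `ρ`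
      R.density o lam ρ 0 = ρ ∧
      (∀ t, 0 ≤ t → ∀ x,
        Summable (fun y => R.p x y * (R.density o lam ρ t y - R.density o lam ρ t x)) ∧
        HasDerivWithinAt (fun s => R.density o lam ρ s x)
          (R.genRW (R.density o lam ρ t) x + lam * kron o x) (Set.Ici 0) t) ∧
      -- for bounded `ρ` it is the only solution that is bounded on bounded time intervals
      ((∃ M, ∀ x, ρ x ≤ M) → ∀ z : ℝ → V → ℝ,
        (∀ T, ∃ M, ∀ t, 0 ≤ t → t ≤ T → ∀ x, |z t x| ≤ M) → z 0 = ρ →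
        (∀ t, 0 ≤ t → ∀ x, HasDerivWithinAt (fun s => z s x)
          (R.genRW (z t) x + lam * kron o x) (Set.Ici 0) t) →
        ∀ t, 0 ≤ t → z t = R.density o lam ρ t) ∧
      -- the evolved law solves the forward equation of the generator
      (∀ (Λ : Finset V) (f : (V → ℕ) → ℝ), DependsOn f (Λ : Set V) → (∃ C, ∀ ξ, |f ξ| ≤ C) →
        ∀ t, 0 ≤ t →
          Integrable (R.genIRW o lam f) (R.lawAt o lam (poissonProduct ρ) t) ∧
          HasDerivWithinAt (fun s => ∫ ξ, f ξ ∂(R.lawAt o lam (poissonProduct ρ) s))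
            (∫ ξ, R.genIRW o lam f ξ ∂(R.lawAt o lam (poissonProduct ρ) t)) (Set.Ici 0) t) ∧
      -- in the recurrent case the density diverges at every site
      (0 < lam → R.IsRecurrent → ∀ x, Tendsto (fun t => R.density o lam ρ t x) atTop atTop)) ∧
    -- Divergence of the density is equivalent to recurrence.
    (0 < lam → ∀ ρ : V → ℝ, (∀ x, 0 ≤ ρ x) → (∃ M, ∀ x, ρ x ≤ M) → ∀ x,
      (Tendsto (fun t => R.density o lam ρ t x) atTop atTop ↔ R.IsRecurrent)) ∧
    -- The transient case, started from a homogeneous Poisson product measure.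
    (R.IsTransient → ∀ r : ℝ, 0 ≤ r → ∃ ρinf : V → ℝ,
      (∀ x, IntegrableOn (R.hitProb o x) (Set.Ioi 0) ∧
        ρinf x = r + lam * ∫ s in Set.Ioi (0 : ℝ), R.hitProb o x s) ∧
      (∀ F : (V → ℕ) → ℝ, Continuous F → (∃ C, ∀ ξ, |F ξ| ≤ C) →
        Tendsto (fun t => ∫ ξ, F ξ ∂(R.lawAt o lam (poissonProduct fun _ => r) t)) atTop
          (𝓝 (∫ ξ, F ξ ∂(poissonProduct ρinf)))) ∧
      (∀ x, Summable (fun y => R.p x y * (ρinf y - ρinf x)) ∧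
        R.genRW ρinf x = -(lam * kron o x))) := by
  refine ⟨?_, ?_, ?_, ?_, ?_⟩
  · intro Λ f hf z hz hconv
    have hcb := convergesBeyond_of_eventually hconv
    exact ⟨fun x => (hasDerivAt_genFun_kron hf hcb x).differentiableAt,
      R.summable_flowTerm hf hcb hz, R.hasGenFun_genIRW hf hcb hz o lam⟩
  · intro η hη Λ f hf hC
    exact (R.hasGeneratorAt o hlam hη Λ f hf hC).2
  · intro ρ hρ
    refine ⟨fun t ht => ?_, fun t ht => hρ.lawAt_poissonProduct o hlam ht, hρ.density_zero o lam,
      fun t ht x => ⟨(hρ.hasSum_genRW_density o lam ht x).summable,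
        hρ.hasDerivWithinAt_density o lam ht x⟩, ?_, ?_,
      fun h hr x => hρ.tendsto_density_atTop o lam h hr x⟩
    · filter_upwards [hρ.ae_initialAt_finite o ht,
        R.ae_createdAt_finite o (mul_nonneg hlam ht) (poissonProduct ρ)] with ω h1 h2 y
      exact ⟨h1 y, h2 y⟩
    · rintro ⟨M, hM⟩ z hb hz hd t ht
      exact SymmRates.eq_density_of_bounded o lam hρ.1 hM hlam hb hz hd ht
    · rintro Λ f hf ⟨C, hC⟩ t ht
      obtain ⟨h1, h2⟩ := hρ.forward o hlam hf hC ht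
      rw [hρ.lawAt_poissonProduct o hlam ht]
      exact ⟨h1, h2.congr (fun s hs => by rw [hρ.lawAt_poissonProduct o hlam hs])
        (by rw [hρ.lawAt_poissonProduct o hlam ht])⟩
  · rintro h ρ h0 ⟨M, hM⟩ x
    exact SymmRates.tendsto_density_atTop_iff o lam h h0 hM x
  · intro ht r hr
    have hg := fun x => R.green_ne_top_of_isTransient ht x o
    refine ⟨SymmRates.limitDensity R o lam r, fun x =>
      ⟨(SymmRates.integrableOn_hitProb_iff o x).2 (hg x), rfl⟩, ?_, fun x => ?_⟩
    · rintro F hF ⟨C, hC⟩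
      exact R.tendsto_lawAt_of_isTransient ht o hlam hr hF hC
    · have h := SymmRates.hasSum_genRW_limitDensity (R := R) o lam r hg x
      exact ⟨h.summable, h.tsum_eq⟩
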